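/- All monoids below are finite unless they are free. For a monoid $M$ let $\mathcal R,\mathcal L,\mathcal J,\mathcal D$ be Green's relations ($x\,\mathcal R\,y\iff xM=yM$, $x\,\mathcal L\,y\iff Mx=My$, $x\,\mathcal J\,y\iff MxM=MyM$, $\mathcal D=\mathcal R\circ\mathcal L$). A *variety* is a class of finite monoids closed under submonoids, homomorphic images and (possibly empty) finite direct products; $\mathbf V\vee\mathbf W$ denotes the smallest variety containing $\mathbf V\cup\mathbf W$. On $M$ define the congruences $$x\sim_K y\iff \forall e=e^2\in M:\ (ex\,\mathcal R\,e\ \text{or}\ ey\,\mathcal R\,e)\Rightarrow ex=ey,$$ $$x\sim_D y\iff \forall e=e^2\in M:\ (xe\,\mathcal L\,e\ \text{or}\ ye\,\mathcal L\,e)\Rightarrow xe=ye.$$ Let $\mathbf J$ be the variety of $\mathcal J$-trivial monoids, let $\mathbf R_1=\mathbf L_1=\mathbf J$ and, for $m\ge 1$, $$M\in\mathbf R_{m+1}\iff M/{\sim_K}\in\mathbf L_m,\qquad M\in\mathbf L_{m+1}\iff M/{\sim_D}\in\mathbf R_m .$$ Let $\mathbf{DA}$ be the variety of monoids in which every $\mathcal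 D$-class that contains an idempotent is an aperiodic semigroup, that is, a subsemigroup none of whose divisors is a nontrivial group. Let $A$ be an alphabet that is finite or, more generally, countable with a fixed effective coding (one for which it is decidable which natural numbers are codes of letters). The *$\pi$-terms* over $A$ (also called $\omega$-terms) are the finite words over $A\cup\{\,(\,,\,)^\pi\}$ obtained as follows: the empty word and each letter are $\pi$-terms, and if $\alpha,\beta$ are $\pi$-terms then so are $\alpha\beta$ and $(\alpha)^\pi$. For $n\ge 1$ let $\alpha[n]\in A^*$ be the word obtained from $\alpha$ by replacing every formal exponent $\pi$ by $n$. For a finite monoid $M$ let $M!$ be the least $n\ge 1$ such that $x^n$ is idempotent for all $x\in M$. The equation $\alpha=\beta$ *holds in* $M$ if $\sigma(\alpha[M!])=\sigma(\beta[M!])$ for every homomorphism $\sigma:A^*\to M$, and it holds in a variety $\mathbf V$ if it holds in every $M\in\mathbf V$. The *word problem for $\pi$-terms over $\mathbf V$* is the following decision problem: given two words over $A\cup\{\,(\,,\,)^\pi\}$, decide whether they are $\pi$-terms $\alpha,\beta$ such that $\alpha=\beta$ holds in $\mathbf V$. **Corollary.** For every integer $m\ge 1$, the word problems for $\pi$-terms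 over $\mathbf R_m$, $\mathbf L_m$, $\mathbf R_m\vee\mathbf L_m$ and $\mathbf R_m\cap\mathbf L_m$ are decidable. Moreover, the word problem for $\pi$-terms over $\mathbf{DA}$ is decidable. -/

import Mathlib

namespace TrotterWeil

section PiTerms

/-- `π`-terms over the alphabet `A`: the empty word, letters, concatenations and
formal powers `(γ)^π`. -/
inductive PiTerm (A : Type*) where
  | eps : PiTerm A
  | letter (a : A) : PiTerm A
  | concat (α β : PiTerm A) : PiTerm A
  | pow (γ : PiTerm A) : PiTerm A

/-- The symbols from which `π`-terms are written: letters (`Sum.inl a`), the opening parenthesis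
`(` (`Sum.inr false`), and the closing parenthesis with its formal exponent `)^π`
(`Sum.inr true`). -/
abbrev Symb (A : Type*) := A ⊕ Bool

/-- The finite word of symbols that a `π`-term is. -/
def PiTerm.toWord {A : Type*} : PiTerm A → List (Symb A)
  | .eps => []
  | .letter a => [Sum.inl a]
  | .concat α β => α.toWord ++ β.toWord
  | .pow γ => [Sum.inr false] ++ γ.toWord ++ [Sum.inr true]

/-- The finite word over `A` that results from a `π`-term by substituting the natural number `n`
for all the formal exponents. -/
def PiTerm.subst {A : Type*} (n : ℕ) : PiTerm A → FreeMonoid A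
  | .eps => 1
  | .letter a => FreeMonoid.of a
  | .concat α β => α.subst n * β.subst n
  | .pow γ => γ.subst n ^ n

/-- The exponent `M!` of a finite monoid `M`: the smallest `n ≥ 1` such that `x ^ n` is idempotent
for all `x` in `M`. -/
noncomputable def exponent (M : Type*) [Monoid M] : ℕ :=
  sInf {n : ℕ | 0 < n ∧ ∀ x : M, IsIdempotentElem (x ^ n)}

/-- The equation `α = β` holds in the finite monoid `M`. -/
def Holds {A : Type*} (α β : PiTerm A) (M : Type*) [Monoid M] : Prop :=
  ∀ σ : FreeMonoid A →* M, σ (α.subst (exponent M)) = σ (β.subst (exponent M))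

end PiTerms

section Green

variable {M : Type*} [Monoid M]

/-- Green's relation `𝓡`: `xM = yM`. -/
def GreenR (x y : M) : Prop :=
  Set.range (fun m : M => x * m) = Set.range (fun m : M => y * m)

/-- Green's relation `𝓛`: `Mx = My`. -/
def GreenL (x y : M) : Prop :=
  Set.range (fun m : M => m * x) = Set.range (fun m : M => m * y)

/-- Green's relation `𝓙`: `MxM = MyM`. -/
def GreenJ (x y : M) : Prop :=
  Set.range (fun p : M × M => p.1 * x * p.2) = Set.range (fun p : M × M => p.1 * y * p.2)

/-- Green's relation `𝓓`: the composition of `𝓡` and `𝓛`. -/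
def GreenD (x y : M) : Prop :=
  ∃ z : M, GreenR x z ∧ GreenL z y

theorem greenR_iff {x y : M} : GreenR x y ↔ (∃ z, x * z = y) ∧ (∃ z, y * z = x) := by
  constructor
  · intro h
    constructor
    · have hy : y ∈ Set.range (fun m : M => y * m) := ⟨1, mul_one y⟩
      rw [← h] at hy
      exact hy
    · have hx : x ∈ Set.range (fun m : M => x * m) := ⟨1, mul_one x⟩
      rw [h] at hx
      exact hx
  · rintro ⟨⟨z, hz⟩, ⟨w, hw⟩⟩
    ext t
    constructor
    · rintro ⟨m, rfl⟩
      exact ⟨w * m, by simp only [← mul_assoc, hw]⟩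
    · rintro ⟨m, rfl⟩
      exact ⟨z * m, by simp only [← mul_assoc, hz]⟩

theorem greenL_iff {x y : M} : GreenL x y ↔ (∃ z, z * x = y) ∧ (∃ z, z * y = x) := by
  constructor
  · intro h
    constructor
    · have hy : y ∈ Set.range (fun m : M => m * y) := ⟨1, one_mul y⟩
      rw [← h] at hy
      exact hy
    · have hx : x ∈ Set.range (fun m : M => m * x) := ⟨1, one_mul x⟩
      rw [h] at hx
      exact hx
  · rintro ⟨⟨z, hz⟩, ⟨w, hw⟩⟩
    ext t
    constructor
    · rintro ⟨m, rfl⟩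
      exact ⟨m * w, by simp only [mul_assoc, hw]⟩
    · rintro ⟨m, rfl⟩
      exact ⟨m * z, by simp only [mul_assoc, hz]⟩

/-- `e x 𝓡 e` for an idempotent `e` just says that `e x` can be multiplied back to `e`. -/
theorem greenR_mul_iff {e x : M} : GreenR (e * x) e ↔ ∃ z, e * x * z = e :=
  ⟨fun h => (greenR_iff.1 h).1, fun h => greenR_iff.2 ⟨h, x, rfl⟩⟩

theorem greenL_mul_iff {e x : M} : GreenL (x * e) e ↔ ∃ z, z * (x * e) = e :=
  ⟨fun h => (greenL_iff.1 h).1, fun h => greenL_iff.2 ⟨h, x, rfl⟩⟩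

/-- The relation `∼_K`. -/
def SimK (x y : M) : Prop :=
  ∀ e : M, IsIdempotentElem e → GreenR (e * x) e ∨ GreenR (e * y) e → e * x = e * y

/-- The relation `∼_D`. -/
def SimD (x y : M) : Prop :=
  ∀ e : M, IsIdempotentElem e → GreenL (x * e) e ∨ GreenL (y * e) e → x * e = y * e

theorem SimK.symm {x y : M} (h : SimK x y) : SimK y x :=
  fun e he hxy => (h e he hxy.symm).symm

theorem SimD.symm {x y : M} (h : SimD x y) : SimD y x :=
  fun e he hxy => (h e he hxy.symm).symm

theorem SimK.trans {x y z : M} (h : SimK x y) (h' : SimK y z) : SimK x z := by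
  rintro e he (hx | hz)
  · have h1 := h e he (Or.inl hx)
    rw [h1] at hx ⊢
    exact h' e he (Or.inl hx)
  · have h1 := h' e he (Or.inr hz)
    rw [← h1] at hz ⊢
    exact h e he (Or.inr hz)

theorem SimD.trans {x y z : M} (h : SimD x y) (h' : SimD y z) : SimD x z := by
  rintro e he (hx | hz)
  · have h1 := h e he (Or.inl hx)
    rw [h1] at hx ⊢
    exact h' e he (Or.inl hx)
  · have h1 := h' e he (Or.inr hz)
    rw [← h1] at hz ⊢
    exact h e he (Or.inr hz)

theorem simK_mul_left_aux {x y : M} (h : SimK x y) (z : M) {e : M} (he : IsIdempotentElem e)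
    (hr : GreenR (e * (z * x)) e) : e * (z * x) = e * (z * y) := by
  obtain ⟨v, hv⟩ := greenR_mul_iff.1 hr
  have hw : e * z * (x * v) = e := by simpa only [mul_assoc] using hv
  have hf : IsIdempotentElem (x * v * e * z) := by
    calc x * v * e * z * (x * v * e * z) = x * v * (e * z * (x * v)) * e * z := by
          simp only [mul_assoc]
      _ = x * v * (e * e) * z := by rw [hw]; simp only [mul_assoc]
      _ = x * v * e * z := by rw [he.eq]
  have hx : GreenR (x * v * e * z * x) (x * v * e * z) :=
    greenR_mul_iff.2 ⟨v * e * z, by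
      calc x * v * e * z * x * (v * e * z) = x * v * (e * z * (x * v)) * e * z := by
            simp only [mul_assoc]
        _ = x * v * (e * e) * z := by rw [hw]; simp only [mul_assoc]
        _ = x * v * e * z := by rw [he.eq]⟩
  have hfxy := h _ hf (Or.inl hx)
  have key : ∀ t : M, e * z * (x * v * e * z * t) = e * (z * t) := by
    intro t
    calc e * z * (x * v * e * z * t) = e * z * (x * v) * e * z * t := by simp only [mul_assoc]
      _ = e * e * z * t := by rw [hw]
      _ = e * (z * t) := by rw [he.eq, mul_assoc]
  rw [← key x, hfxy, key y]

theorem SimK.mul_left {x y : M} (h : SimK x y) (z : M) : SimK (z * x) (z * y) := by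
  rintro e he (hx | hy)
  · exact simK_mul_left_aux h z he hx
  · exact (simK_mul_left_aux h.symm z he hy).symm

theorem simK_mul_right_aux {x y : M} (h : SimK x y) (z : M) {e : M} (he : IsIdempotentElem e)
    (hr : GreenR (e * (x * z)) e) : e * (x * z) = e * (y * z) := by
  obtain ⟨v, hv⟩ := greenR_mul_iff.1 hr
  have := h e he (Or.inl (greenR_mul_iff.2 ⟨z * v, by simpa only [mul_assoc] using hv⟩))
  rw [← mul_assoc, this, mul_assoc]

theorem SimK.mul_right {x y : M} (h : SimK x y) (z : M) : SimK (x * z) (y * z) := by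
  rintro e he (hx | hy)
  · exact simK_mul_right_aux h z he hx
  · exact (simK_mul_right_aux h.symm z he hy).symm

theorem simD_mul_right_aux {x y : M} (h : SimD x y) (z : M) {e : M} (he : IsIdempotentElem e)
    (hr : GreenL (x * z * e) e) : x * z * e = y * z * e := by
  obtain ⟨v, hv⟩ := greenL_mul_iff.1 hr
  have hw : v * x * (z * e) = e := by simpa only [mul_assoc] using hv
  have hf : IsIdempotentElem (z * e * (v * x)) := by
    calc z * e * (v * x) * (z * e * (v * x)) = z * e * (v * x * (z * e)) * (v * x) := by
          simp only [mul_assoc]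
      _ = z * (e * e) * (v * x) := by rw [hw]; simp only [mul_assoc]
      _ = z * e * (v * x) := by rw [he.eq]
  have hx : GreenL (x * (z * e * (v * x))) (z * e * (v * x)) :=
    greenL_mul_iff.2 ⟨z * e * v, by
      calc z * e * v * (x * (z * e * (v * x))) = z * e * (v * x * (z * e)) * (v * x) := by
            simp only [mul_assoc]
        _ = z * (e * e) * (v * x) := by rw [hw]; simp only [mul_assoc]
        _ = z * e * (v * x) := by rw [he.eq]⟩
  have hfxy := h _ hf (Or.inl hx)
  have key : ∀ t : M, t * (z * e * (v * x)) * (z * e) = t * z * e := by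
    intro t
    calc t * (z * e * (v * x)) * (z * e) = t * z * e * (v * x * (z * e)) := by
          simp only [mul_assoc]
      _ = t * z * (e * e) := by rw [hw]; simp only [mul_assoc]
      _ = t * z * e := by rw [he.eq]
  rw [← key x, hfxy, key y]

theorem SimD.mul_right {x y : M} (h : SimD x y) (z : M) : SimD (x * z) (y * z) := by
  rintro e he (hx | hy)
  · exact simD_mul_right_aux h z he hx
  · exact (simD_mul_right_aux h.symm z he hy).symm

theorem simD_mul_left_aux {x y : M} (h : SimD x y) (z : M) {e : M} (he : IsIdempotentElem e)
    (hr : GreenL (z * x * e) e) : z * x * e = z * y * e := by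
  obtain ⟨v, hv⟩ := greenL_mul_iff.1 hr
  have := h e he (Or.inl (greenL_mul_iff.2 ⟨v * z, by simpa only [mul_assoc] using hv⟩))
  rw [mul_assoc, this, ← mul_assoc]

theorem SimD.mul_left {x y : M} (h : SimD x y) (z : M) : SimD (z * x) (z * y) := by
  rintro e he (hx | hy)
  · exact simD_mul_left_aux h z he hx
  · exact (simD_mul_left_aux h.symm z he hy).symm

/-- `∼_K` as a congruence on `M`. -/
def conK (M : Type*) [Monoid M] : Con M where
  r := SimK
  iseqv := ⟨fun _ _ _ _ => rfl, SimK.symm, SimK.trans⟩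
  mul' := fun {_ x y _} h h' => (h.mul_right y).trans (h'.mul_left x)

/-- `∼_D` as a congruence on `M`. -/
def conD (M : Type*) [Monoid M] : Con M where
  r := SimD
  iseqv := ⟨fun _ _ _ _ => rfl, SimD.symm, SimD.trans⟩
  mul' := fun {_ x y _} h h' => (h.mul_right y).trans (h'.mul_left x)

end Green

section Varieties

/-- Classes of monoids. All the classes below consist of finite monoids only; up to isomorphism,
every finite monoid lives in `Type`. -/
abbrev MonoidClass := (M : Type) → [Monoid M] → Prop

/-- Varieties of finite monoids (pseudo-varieties). -/
structure IsVariety (V : MonoidClass) : Prop where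
  finite : ∀ (M : Type) [Monoid M], V M → Finite M
  submonoid : ∀ (M : Type) [Monoid M] (N : Submonoid M), V M → V N
  image : ∀ (M N : Type) [Monoid M] [Monoid N] (f : M →* N),
    Function.Surjective f → V M → V N
  prod : ∀ (ι : Type) [Finite ι] (M : ι → Type) [∀ i, Monoid (M i)],
    (∀ i, V (M i)) → V ((i : ι) → M i)

/-- The intersection of two classes. -/
def meet (V W : MonoidClass) : MonoidClass := fun M _ => V M ∧ W M

/-- The join of two varieties: the smallest variety that contains both. -/
def join (V W : MonoidClass) : MonoidClass := fun M _ =>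
  ∀ X : MonoidClass, IsVariety X →
    (∀ (N : Type) [Monoid N], V N → X N) → (∀ (N : Type) [Monoid N], W N → X N) → X M

/-- The Mal'cev product of `K` with `V`. -/
def malcevK (V : MonoidClass) : MonoidClass := fun M _ => Finite M ∧ V (conK M).Quotient

/-- The Mal'cev product of `D` with `V`. -/
def malcevD (V : MonoidClass) : MonoidClass := fun M _ => Finite M ∧ V (conD M).Quotient

/-- The variety of finite `𝓙`-trivial monoids. -/
def varJ : MonoidClass := fun M _ => Finite M ∧ ∀ x y : M, GreenJ x y → x = y

mutual
/-- The corners `R_m`, `m ≥ 1`, of the Trotter-Weil hierarchy (the value at `0` is not used). -/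
def varR : ℕ → MonoidClass
  | 0 => varJ
  | 1 => varJ
  | m + 2 => malcevK (varL (m + 1))
/-- The corners `L_m`, `m ≥ 1`, of the Trotter-Weil hierarchy (the value at `0` is not used). -/
def varL : ℕ → MonoidClass
  | 0 => varJ
  | 1 => varJ
  | m + 2 => malcevD (varR (m + 1))
end

/-- A finite semigroup is aperiodic if none of its divisors is a nontrivial group. -/
def IsAperiodic (S : Type) [Semigroup S] : Prop :=
  ∀ (T : Subsemigroup S) (G : Type) [Group G] (f : T →ₙ* G),
    Function.Surjective f → Subsingleton G

/-- The variety `DA` of finite monoids whose regular `𝓓`-classes (the `𝓓`-classes of idempotents)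
form aperiodic semigroups. -/
def varDA : MonoidClass := fun M _ => Finite M ∧
  ∀ e : M, IsIdempotentElem e →
    ∃ S : Subsemigroup M, (S : Set M) = {x | GreenD e x} ∧ IsAperiodic S

/-- The equation `α = β` holds in all the monoids of the class `V`. -/
def HoldsIn {A : Type*} (V : MonoidClass) (α β : PiTerm A) : Prop :=
  ∀ (M : Type) [Monoid M], V M → Holds α β M

/-- The word problem for `π`-terms over the class `V`, as a set of pairs of words:
those pairs of `π`-terms `(α, β)` over the alphabet `A` for which `α = β` holds in `V`. -/
def WordProblem (A : Type*) (V : MonoidClass) : Set (List (Symb A) × List (Symb A)) :=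
  {p | ∃ α β : PiTerm A, α.toWord = p.1 ∧ β.toWord = p.2 ∧ HoldsIn V α β}

/-- The word problem for `π`-terms over `V` is decidable: some algorithm decides, given two words
of symbols, whether they form a pair in `WordProblem A V`. -/
def WordProblemDecidable (A : Type*) [Primcodable A] (V : MonoidClass) : Prop :=
  ComputablePred fun p : List (Symb A) × List (Symb A) => p ∈ WordProblem A V

end Varieties

end TrotterWeil

-- Equations are tested by a back-and-forth game on two words. A round cuts the same kind of factor
-- out of both words, at first or last occurrences of letters, and the state says which cuts are
-- legal. Mode `x` passes to the right of a first occurrence for free and pays one level for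
-- turning, in mode `y`, to the part before it or to the whole word. Mode `y` is the mirror image.
-- Mode `w` has both free moves and pays for every other cut, including the centre between a last
-- and a first occurrence. Over a finite alphabet each `Agree n q` is a congruence of finite index.
-- For `m ≥ 1` the states `(x, m)`, `(y, m)`, `(w, m)` and `(x, none)` govern the equations of
-- `R_m`, `L_m`, `R_{m+1} ∩ L_{m+1}` and `DA`; for the join, `(x, m)` and `(y, m)` are required
-- together.
--
-- Soundness: in a monoid of `DA`, a letter of a word that stays in an 𝓡-class never leads out of
-- that class (`DAProp.greenR_letter`). So a word leaves an 𝓡-class at the first occurrence of a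
-- letter. Right ideals shrink only boundedly often, hence boundedly many first-occurrence cuts
-- evaluate a word once the prefixes are known up to `∼_K` (`DAProp.eq_of_agree_x`). Completeness:
-- the words modulo `Agree n (x, m)` form a monoid in `R_m`. For `m = 1` this is Simon's congruence;
-- for larger `m`, a power containing all letters hides the first occurrences behind it
-- (`agree_absorb`), so agreement in `(y, m - 1)` gives `∼_K`.
--
-- Intersections: here the join of two congruences has to be described. Long agreement in `(x, m +
-- 1)` or `(y, m + 1)` forces agreement in `(w, m)` (`exists_agree_w`). Conversely, words that agree
-- long in `(w, m)` are linked by a chain of agreements in `(x, m + 1)` and `(y, m + 1)`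
-- (`exists_link`). For this, one word is cut where it leaves 𝓡-classes from the left and the other
-- where it leaves 𝓛-classes from the right (`Splice`).
--
-- Decision: `n` cuts do not separate exponents above `n`, so an equation holds iff its sides, with
-- exponent `n + 1`, agree for `n` rounds, for every `n` (`Describes.holdsIn_iff`). Up to agreement,
-- the cuts of `α[N]` stay in a set of factors whose size is bounded in terms of `α` alone. A
-- decreasing sequence of relations between such factors is therefore stationary after an explicit
-- number of rounds (`agree_of_bound`), and a single finite game, played out by a primitive
-- recursive procedure, decides.

namespace TrotterWeil

-- The game on words and its compatibility with concatenation

section Words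

/-- The three modes of comparing words. -/
inductive Mode | x | y | w
  deriving DecidableEq

/-- The ways of cutting a factor out of a word: the part after or before the first occurrence of
a letter, the part before or after the last occurrence of a letter, the part between the last
occurrence of one letter and the first occurrence of another one, and the whole word. -/
inductive Op | xr | xl | yl | yr | ctr | stay
  deriving DecidableEq

instance : Fintype Mode := ⟨{.x, .y, .w}, fun d => by cases d <;> decide⟩

instance : Fintype Op :=
  ⟨{.xr, .xl, .yl, .yr, .ctr, .stay}, fun k => by cases k <;> decide⟩

/-- A mode together with the number of changes of direction that are left (`none`: unlimited). -/
abbrev State := Mode × Option ℕ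

/-- The mode after a cut; the Boolean tells whether the level is kept. -/
def modeStep : Mode → Op → Option (Mode × Bool)
  | .x, .xr => some (.x, true)
  | .x, .xl => some (.y, false)
  | .x, .stay => some (.y, false)
  | .y, .yl => some (.y, true)
  | .y, .yr => some (.x, false)
  | .y, .stay => some (.x, false)
  | .w, .xr => some (.w, true)
  | .w, .yl => some (.w, true)
  | .w, _ => some (.w, false)
  | _, _ => none

def predLevel (l : Option ℕ) : Option ℕ := l.map Nat.pred

/-- The state after a cut. -/
def step (q : State) (k : Op) : Option State :=
  if q.2 = some 0 then none
  else (modeStep q.1 k).map fun r => (r.1, if r.2 then q.2 else predLevel q.2)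

variable {A : Type*}

/-- `Cut k a b u s`: the operation `k` cuts the factor `s` out of `u`. -/
def Cut : Op → A → A → List A → List A → Prop
  | .xr, a, _, u, s => ∃ p, a ∉ p ∧ u = p ++ a :: s
  | .xl, a, _, u, s => ∃ p, a ∉ s ∧ u = s ++ a :: p
  | .yl, a, _, u, s => ∃ p, a ∉ p ∧ u = s ++ a :: p
  | .yr, a, _, u, s => ∃ p, a ∉ s ∧ u = p ++ a :: s
  | .ctr, a, b, u, s => ∃ p r, a ≠ b ∧ a ∉ p ∧ a ∉ s ∧ b ∉ s ∧ b ∉ r ∧ u = p ++ b :: (s ++ a :: r)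
  | .stay, _, _, u, s => s = u

/-- `Agree n q u v`: the words `u` and `v` are not distinguished by sequences of at most `n` cuts
that start in the state `q`. -/
def Agree : ℕ → State → List A → List A → Prop
  | 0, _, _, _ => True
  | n + 1, q, u, v => ∀ k a b q', step q k = some q' →
      (∀ s, Cut k a b u s → ∃ t, Cut k a b v t ∧ Agree n q' s t) ∧
      (∀ t, Cut k a b v t → ∃ s, Cut k a b u s ∧ Agree n q' s t)

theorem Agree.refl : ∀ (n : ℕ) (q : State) (u : List A), Agree n q u u
  | 0, _, _ => trivial
  | _ + 1, _, _ => fun _ _ _ _ _ =>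
      ⟨fun s hs => ⟨s, hs, Agree.refl _ _ s⟩, fun s hs => ⟨s, hs, Agree.refl _ _ s⟩⟩

theorem Agree.symm : ∀ {n : ℕ} {q : State} {u v : List A}, Agree n q u v → Agree n q v u
  | 0, _, _, _, _ => trivial
  | _ + 1, _, _, _, h => fun k a b q' hq =>
      ⟨fun s hs => let ⟨t, ht, h'⟩ := (h k a b q' hq).2 s hs; ⟨t, ht, h'.symm⟩,
       fun s hs => let ⟨t, ht, h'⟩ := (h k a b q' hq).1 s hs; ⟨t, ht, h'.symm⟩⟩

theorem Agree.trans : ∀ {n : ℕ} {q : State} {u v w : List A},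
    Agree n q u v → Agree n q v w → Agree n q u w
  | 0, _, _, _, _, _, _ => trivial
  | _ + 1, _, _, _, _, h, g => fun k a b q' hq =>
      ⟨fun s hs => by
        obtain ⟨t, ht, h'⟩ := (h k a b q' hq).1 s hs
        obtain ⟨r, hr, h''⟩ := (g k a b q' hq).1 t ht
        exact ⟨r, hr, h'.trans h''⟩,
       fun s hs => by
        obtain ⟨t, ht, h'⟩ := (g k a b q' hq).2 s hs
        obtain ⟨r, hr, h''⟩ := (h k a b q' hq).2 t ht
        exact ⟨r, hr, h''.trans h'⟩⟩

/-- By symmetry, one of the two directions suffices. -/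
theorem agree_succ_of {n : ℕ} {q : State} (R : List A → List A → Prop)
    (hs : ∀ u v, R u v → R v u)
    (h : ∀ u v, R u v → ∀ k a b q', step q k = some q' →
      ∀ s, Cut k a b u s → ∃ t, Cut k a b v t ∧ Agree n q' s t) {u v : List A} (hR : R u v) :
    Agree (n + 1) q u v := fun k a b q' hq =>
  ⟨h u v hR k a b q' hq, fun t ht =>
    let ⟨s, hs, h'⟩ := h v u (hs u v hR) k a b q' hq t ht; ⟨s, hs, h'.symm⟩⟩

theorem Agree.of_succ : ∀ {n : ℕ} {q : State} {u v : List A}, Agree (n + 1) q u v → Agree n q u v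
  | 0, _, _, _, _ => trivial
  | _ + 1, _, _, _, h => fun k a b q' hq =>
      ⟨fun s hs => let ⟨t, ht, h'⟩ := (h k a b q' hq).1 s hs; ⟨t, ht, h'.of_succ⟩,
       fun s hs => let ⟨t, ht, h'⟩ := (h k a b q' hq).2 s hs; ⟨t, ht, h'.of_succ⟩⟩

theorem Agree.mono {m n : ℕ} {q : State} {u v : List A} (h : Agree n q u v) (hmn : m ≤ n) :
    Agree m q u v := by
  induction n, hmn using Nat.le_induction with
  | base => exact h
  | succ n _ ih => exact ih h.of_succ

theorem step_top (k : Op) : step (.w, none) k = some (.w, none) := by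
  cases k <;> simp [step, modeStep, predLevel]

/-- The state `(w, none)` admits every cut and returns to itself, so it is the finest of all states.
-/
theorem Agree.of_top : ∀ {n : ℕ} {u v : List A} (_ : Agree n (.w, none) u v) (q : State),
    Agree n q u v
  | 0, _, _, _, _ => trivial
  | _ + 1, _, _, h, _ => fun k a b _ _ =>
      ⟨fun s hs => let ⟨t, ht, h'⟩ := (h k a b _ (step_top k)).1 s hs; ⟨t, ht, h'.of_top _⟩,
       fun s hs => let ⟨t, ht, h'⟩ := (h k a b _ (step_top k)).2 s hs; ⟨t, ht, h'.of_top _⟩⟩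

/-! ### Reversal -/

def Mode.dual : Mode → Mode
  | .x => .y
  | .y => .x
  | .w => .w

def State.dual (q : State) : State := (q.1.dual, q.2)

def Op.dual : Op → Op
  | .xr => .yl
  | .xl => .yr
  | .yl => .xr
  | .yr => .xl
  | .ctr => .ctr
  | .stay => .stay

theorem State.dual_dual (q : State) : q.dual.dual = q := by
  obtain ⟨d, l⟩ := q
  cases d <;> rfl

theorem step_dual (q : State) (k : Op) : step q.dual k.dual = (step q k).map State.dual := by
  obtain ⟨d, l⟩ := q
  by_cases hl : l = some 0
  · simp [step, State.dual, hl]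
  · cases d <;> cases k <;> simp [step, State.dual, hl, Mode.dual, Op.dual, modeStep]

theorem Cut.reverse {k : Op} {a b : A} {u s : List A} (h : Cut k a b u s) :
    ∃ a' b', Cut k.dual a' b' u.reverse s.reverse ∧
      ∀ v t, Cut k.dual a' b' v t → Cut k a b v.reverse t.reverse := by
  cases k
  case ctr =>
    obtain ⟨p, r, hab, h1, h2, h3, h4, rfl⟩ := h
    refine ⟨b, a, ⟨r.reverse, p.reverse, hab.symm, ?_⟩, ?_⟩
    · simp [h1, h2, h3, h4]
    · rintro v t ⟨p, r, hab, h1, h2, h3, h4, rfl⟩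
      exact ⟨r.reverse, p.reverse, hab.symm, by simp [h1, h2, h3, h4]⟩
  case stay =>
    cases h
    exact ⟨a, b, rfl, fun v t h => congrArg _ h⟩
  all_goals
    obtain ⟨p, h1, rfl⟩ := h
    refine ⟨a, b, ⟨p.reverse, by simpa using h1, by simp⟩, ?_⟩
    rintro v t ⟨p, h1, rfl⟩
    exact ⟨p.reverse, by simpa using h1, by simp⟩

theorem Agree.reverse : ∀ {n : ℕ} {q : State} {u v : List A}, Agree n q u v →
    Agree n q.dual u.reverse v.reverse
  | 0, _, _, _, _ => trivial
  | n + 1, q, u, v, h => by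
    refine agree_succ_of (fun u' v' => Agree (n + 1) q u'.reverse v'.reverse)
      (fun _ _ h => h.symm) ?_ (by simpa using h)
    intro u v h k a b q' hq s hs
    obtain ⟨a', b', hs', hb⟩ := hs.reverse
    have hq' : step q k.dual = some q'.dual := by
      have := step_dual q.dual k
      rwa [State.dual_dual, hq] at this
    obtain ⟨t, ht, hst⟩ := (h k.dual a' b' _ hq').1 _ hs'
    refine ⟨t.reverse, ?_, ?_⟩
    · simpa using hb _ _ ht
    · have := hst.reverse
      rwa [State.dual_dual, List.reverse_reverse] at this

theorem agree_reverse {n : ℕ} {q : State} {u v : List A} :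
    Agree n q u.reverse v.reverse ↔ Agree n q.dual u v := by
  constructor
  · intro h; simpa using h.reverse
  · intro h; simpa [State.dual_dual] using h.reverse

/-! ### The letters of a word, congruence -/

theorem exists_first {a : A} {u : List A} (h : a ∈ u) : ∃ p s, a ∉ p ∧ u = p ++ a :: s := by
  obtain ⟨p, s, h1, h2⟩ := List.eq_append_cons_of_mem h
  exact ⟨p, s, h2, h1⟩

theorem exists_last {a : A} {u : List A} (h : a ∈ u) : ∃ p s, a ∉ s ∧ u = p ++ a :: s := by
  obtain ⟨p, s, h1, h2⟩ := exists_first (List.mem_reverse.2 h)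
  refine ⟨s.reverse, p.reverse, by simpa using h1, ?_⟩
  have := congrArg List.reverse h2
  simpa using this

theorem first_unique {a : A} {p p' s s' : List A} (h : a ∉ p) (h' : a ∉ p')
    (e : p ++ a :: s = p' ++ a :: s') : p = p' ∧ s = s' := by
  induction p generalizing p' with
  | nil =>
    cases p' with
    | nil => exact ⟨rfl, (List.cons.inj e).2⟩
    | cons d p' => exact absurd ((List.cons.inj e).1 ▸ List.mem_cons_self) h'
  | cons c p ih =>
    cases p' with
    | nil => exact absurd ((List.cons.inj e).1 ▸ List.mem_cons_self) h
    | cons d p' =>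
      simp only [List.cons_append, List.cons.injEq, List.mem_cons, not_or] at e h h'
      have := ih h.2 h'.2 e.2
      exact ⟨by rw [e.1, this.1], this.2⟩

theorem last_unique {a : A} {p p' s s' : List A} (h : a ∉ s) (h' : a ∉ s')
    (e : p ++ a :: s = p' ++ a :: s') : p = p' ∧ s = s' := by
  have e' := congrArg List.reverse e
  simp only [List.reverse_append, List.reverse_cons, List.append_assoc, List.singleton_append] at e'
  have := first_unique (by simpa using h) (by simpa using h') e'
  exact ⟨List.reverse_injective this.2, List.reverse_injective this.1⟩

theorem step_ne {d : Mode} {l : Option ℕ} (hl : l ≠ some 0) (k : Op) :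
    step (d, l) k = (modeStep d k).map fun r => (r.1, if r.2 then l else predLevel l) := by
  simp [step, hl]

theorem Agree.mem_iff {n : ℕ} {q : State} (hq : q.2 ≠ some 0) {u v : List A}
    (h : Agree (n + 1) q u v) (a : A) : a ∈ u ↔ a ∈ v := by
  obtain ⟨d, l⟩ := q
  have key : ∀ u v : List A, Agree (n + 1) (d, l) u v → a ∈ u → a ∈ v := by
    intro u v h ha
    cases d
    case y =>
      obtain ⟨p, s, hp, rfl⟩ := exists_last ha
      obtain ⟨t, ⟨p', -, rfl⟩, -⟩ := (h .yr a a _ (by rw [step_ne hq]; rfl)).1 s ⟨p, hp, rfl⟩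
      simp
    all_goals
      obtain ⟨p, s, hp, rfl⟩ := exists_first ha
      obtain ⟨t, ⟨p', -, rfl⟩, -⟩ := (h .xr a a _ (by rw [step_ne hq]; rfl)).1 s ⟨p, hp, rfl⟩
      simp
  exact ⟨key u v h, key v u h.symm⟩

theorem step_ne_of_eq {q q' : State} {k : Op} (h : step q k = some q') : q.2 ≠ some 0 := by
  intro hq
  simp [step, hq] at h

/-- A cut of `c :: u` either comes from the corresponding cut of `u`, or uses the new letter. In the
second case there remains nothing, all of `u`, or the part of `u` before a first occurrence. The
operation `stay` serves the case where all of `u` remains at a lower level. -/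
theorem Agree.cons : ∀ {n : ℕ} {q : State} {u v : List A}, Agree n q u v → ∀ c,
    Agree n q (c :: u) (c :: v)
  | 0, _, _, _, _, _ => trivial
  | n + 1, q, u, v, h, c => by
    refine agree_succ_of (fun u' v' => ∃ u v, u' = c :: u ∧ v' = c :: v ∧ Agree (n + 1) q u v)
      ?_ ?_ ⟨u, v, rfl, rfl, h⟩
    · rintro _ _ ⟨u, v, rfl, rfl, h⟩
      exact ⟨v, u, rfl, rfl, h.symm⟩
    rintro _ _ ⟨u, v, rfl, rfl, h⟩ k a b q' hq s hs
    have hq0 := step_ne_of_eq hq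
    have hmem := h.mem_iff hq0
    have hsame : (k = .xr ∨ k = .yl) → q' = q := by
      obtain ⟨d, l⟩ := q
      rw [step_ne hq0] at hq
      rintro (rfl | rfl) <;> cases d <;> simp_all [modeStep]
    have hstay : (k = .xl ∨ k = .yr ∨ k = .ctr) → step q .stay = some q' := by
      obtain ⟨d, l⟩ := q
      rw [step_ne hq0] at hq ⊢
      rintro (rfl | rfl | rfl) <;> cases d <;> simp_all [modeStep]
    cases k
    case xr =>
      obtain ⟨p, hp, e⟩ := hs
      rcases p with _ | ⟨d, p⟩
      · obtain ⟨rfl, rfl⟩ : c = a ∧ u = s := by simpa using e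
        exact ⟨v, ⟨[], by simp, rfl⟩, hsame (Or.inl rfl) ▸ h.of_succ⟩
      · obtain ⟨rfl, rfl⟩ : c = d ∧ u = p ++ a :: s := by simpa using e
        obtain ⟨t, ⟨p', hp', rfl⟩, ht⟩ :=
          (h .xr a b q' hq).1 s ⟨p, fun hh => hp (List.mem_cons_of_mem _ hh), rfl⟩
        exact ⟨t, ⟨c :: p', by simp_all, rfl⟩, ht⟩
    case xl =>
      obtain ⟨p, hp, e⟩ := hs
      rcases s with _ | ⟨d, s⟩
      · obtain ⟨rfl, rfl⟩ : c = a ∧ u = p := by simpa using e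
        exact ⟨[], ⟨v, by simp, rfl⟩, Agree.refl _ _ _⟩
      · obtain ⟨rfl, rfl⟩ : c = d ∧ u = s ++ a :: p := by simpa using e
        obtain ⟨t, ⟨p', hp', rfl⟩, ht⟩ :=
          (h .xl a b q' hq).1 s ⟨p, fun hh => hp (List.mem_cons_of_mem _ hh), rfl⟩
        exact ⟨c :: t, ⟨p', by simp_all, rfl⟩, ht.cons c⟩
    case yl =>
      obtain ⟨p, hp, e⟩ := hs
      rcases s with _ | ⟨d, s⟩
      · obtain ⟨rfl, rfl⟩ : c = a ∧ u = p := by simpa using e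
        exact ⟨[], ⟨v, by rwa [← hmem], rfl⟩, Agree.refl _ _ _⟩
      · obtain ⟨rfl, rfl⟩ : c = d ∧ u = s ++ a :: p := by simpa using e
        obtain ⟨t, ⟨p', hp', rfl⟩, ht⟩ := (h .yl a b q' hq).1 s ⟨p, hp, rfl⟩
        exact ⟨c :: t, ⟨p', hp', rfl⟩, ht.cons c⟩
    case yr =>
      obtain ⟨p, hp, e⟩ := hs
      rcases p with _ | ⟨d, p⟩
      · obtain ⟨rfl, rfl⟩ : c = a ∧ u = s := by simpa using e
        obtain ⟨t, rfl, ht⟩ := (h .stay c c q' (hstay (by simp))).1 u rfl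
        exact ⟨t, ⟨[], by rwa [← hmem], rfl⟩, ht⟩
      · obtain ⟨rfl, rfl⟩ : c = d ∧ u = p ++ a :: s := by simpa using e
        obtain ⟨t, ⟨p', hp', rfl⟩, ht⟩ := (h .yr a b q' hq).1 s ⟨p, hp, rfl⟩
        exact ⟨t, ⟨c :: p', hp', rfl⟩, ht⟩
    case ctr =>
      obtain ⟨p, r, hab, h1, h2, h3, h4, e⟩ := hs
      rcases p with _ | ⟨d, p⟩
      · obtain ⟨rfl, rfl⟩ : c = b ∧ u = s ++ a :: r := by simpa using e
        -- With the new letter as its left end, the centre is the part of `u` before the first `a`.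
        -- Since `ctr` is legal only in mode `w`, the cut `xl` leads to the same state.
        have hxl : step q .xl = some q' := by
          obtain ⟨d, l⟩ := q
          rw [step_ne hq0] at hq ⊢
          cases d <;> simp_all [modeStep]
        have hb : c ∉ v := by
          rw [← hmem]
          simp [h3, h4, hab.symm]
        obtain ⟨t, ⟨p', hp', rfl⟩, ht⟩ := (h .xl a c q' hxl).1 s ⟨r, h2, rfl⟩
        exact ⟨t, ⟨[], p', hab, by simp, hp', by simp_all, by simp_all, rfl⟩, ht⟩
      · obtain ⟨rfl, rfl⟩ : c = d ∧ u = p ++ b :: (s ++ a :: r) := by simpa using e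
        obtain ⟨t, ⟨p', r', -, g1, g2, g3, g4, rfl⟩, ht⟩ := (h .ctr a b q' hq).1 s
          ⟨p, r, hab, fun hh => h1 (List.mem_cons_of_mem _ hh), h2, h3, h4, rfl⟩
        exact ⟨t, ⟨c :: p', r', hab, by simp_all, g2, g3, g4, rfl⟩, ht⟩
    case stay =>
      obtain rfl : s = c :: u := hs
      obtain ⟨t, rfl, ht⟩ := (h .stay a b q' hq).1 u rfl
      exact ⟨_, rfl, ht.cons c⟩

theorem Agree.append_left {n : ℕ} {q : State} {u v : List A} (h : Agree n q u v) (x : List A) :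
    Agree n q (x ++ u) (x ++ v) := by
  induction x with
  | nil => exact h
  | cons c x ih => exact ih.cons c

theorem Agree.append_right {n : ℕ} {q : State} {u v : List A} (h : Agree n q u v) (x : List A) :
    Agree n q (u ++ x) (v ++ x) := by
  have := (h.reverse.append_left x.reverse).reverse
  simpa [State.dual_dual] using this

theorem Agree.append {n : ℕ} {q : State} {u v x y : List A} (h : Agree n q u v)
    (h' : Agree n q x y) : Agree n q (u ++ x) (v ++ y) :=
  (h.append_right x).trans (h'.append_left v)

end Words

-- The moves of each mode; powers of words

section Modes

variable {A : Type*} {n : ℕ} {l : Option ℕ} {u v : List A}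

theorem agree_level_zero (n : ℕ) (d : Mode) (u v : List A) : Agree n (d, some 0) u v := by
  cases n with
  | zero => trivial
  | succ n =>
    intro k a b q' hq
    exact absurd rfl (step_ne_of_eq hq)

theorem Agree.x_stay (hl : l ≠ some 0) (h : Agree (n + 1) (.x, l) u v) :
    Agree n (.y, predLevel l) u v := by
  -- Every move names two letters, even `stay`, which ignores them. If both words are empty there
  -- may be no letter to name, but then reflexivity suffices.
  cases u with
  | nil =>
    cases v with
    | nil => exact Agree.refl _ _ _
    | cons c v =>
      obtain ⟨t, rfl, ht⟩ := (h .stay c c _ (by rw [step_ne hl]; rfl)).1 _ rfl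
      exact ht
  | cons c u =>
    obtain ⟨t, rfl, ht⟩ := (h .stay c c _ (by rw [step_ne hl]; rfl)).1 _ rfl
    exact ht

theorem Agree.x_first (hl : l ≠ some 0) (h : Agree (n + 1) (.x, l) u v) {a : A} {p s : List A}
    (hp : a ∉ p) (hu : u = p ++ a :: s) :
    ∃ p' s', a ∉ p' ∧ v = p' ++ a :: s' ∧ Agree n (.x, l) s s' ∧
      Agree n (.y, predLevel l) p p' := by
  obtain ⟨s', ⟨p', hp', rfl⟩, hs⟩ := (h .xr a a _ (by rw [step_ne hl]; rfl)).1 s ⟨p, hp, hu⟩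
  obtain ⟨p'', ⟨s'', hp'', e⟩, hps⟩ := (h .xl a a _ (by rw [step_ne hl]; rfl)).1 p ⟨s, hp, hu⟩
  obtain ⟨rfl, rfl⟩ := first_unique hp' hp'' e
  exact ⟨p', s', hp', rfl, hs, hps⟩

/-- A symmetric relation that is compatible with the cuts of mode `x` is contained in `Agree`. -/
theorem agree_x_of (R : List A → List A → Prop) (hs : ∀ u v, R u v → R v u)
    (hstay : ∀ u v, R u v → Agree n (.y, predLevel l) u v)
    (hfirst : ∀ u v, R u v → ∀ a p s, a ∉ p → u = p ++ a :: s →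
      ∃ p' s', a ∉ p' ∧ v = p' ++ a :: s' ∧ Agree n (.x, l) s s' ∧ Agree n (.y, predLevel l) p p')
    (hR : R u v) : Agree (n + 1) (.x, l) u v := by
  refine agree_succ_of R hs ?_ hR
  intro u v h k a b q' hq s hs
  have hl : l ≠ some 0 := step_ne_of_eq hq
  rw [step_ne hl] at hq
  cases k
  case xr =>
    obtain rfl : (Mode.x, l) = q' := by simpa [modeStep] using hq
    obtain ⟨p, hp, e⟩ := hs
    obtain ⟨p', s', h1, h2, h3, -⟩ := hfirst u v h a p s hp e
    exact ⟨s', ⟨p', h1, h2⟩, h3⟩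
  case xl =>
    obtain rfl : (Mode.y, predLevel l) = q' := by simpa [modeStep] using hq
    obtain ⟨p, hp, e⟩ := hs
    obtain ⟨p', s', h1, h2, -, h3⟩ := hfirst u v h a s p hp e
    exact ⟨p', ⟨s', h1, h2⟩, h3⟩
  case stay =>
    obtain rfl : (Mode.y, predLevel l) = q' := by simpa [modeStep] using hq
    exact ⟨v, rfl, by rw [show s = u from hs]; exact hstay u v h⟩
  all_goals simp [modeStep] at hq

theorem Agree.y_stay (hl : l ≠ some 0) (h : Agree (n + 1) (.y, l) u v) :
    Agree n (.x, predLevel l) u v := by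
  have := (h.reverse.x_stay hl).reverse
  simpa [State.dual, Mode.dual] using this

theorem Agree.y_last (hl : l ≠ some 0) (h : Agree (n + 1) (.y, l) u v) {a : A} {p s : List A}
    (hs : a ∉ s) (hu : u = p ++ a :: s) :
    ∃ p' s', a ∉ s' ∧ v = p' ++ a :: s' ∧ Agree n (.y, l) p p' ∧
      Agree n (.x, predLevel l) s s' := by
  obtain ⟨p', s', h1, h2, h3, h4⟩ := h.reverse.x_first (a := a) (p := s.reverse) (s := p.reverse)
    hl (by simpa using hs) (by simp [hu])
  refine ⟨s'.reverse, p'.reverse, by simpa using h1, ?_, ?_, ?_⟩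
  · simpa using congrArg List.reverse h2
  · simpa [State.dual, Mode.dual] using h3.reverse
  · simpa [State.dual, Mode.dual] using h4.reverse

theorem Agree.w_stay (hl : l ≠ some 0) (h : Agree (n + 1) (.w, l) u v) :
    Agree n (.w, predLevel l) u v := by
  cases u with
  | nil =>
    cases v with
    | nil => exact Agree.refl _ _ _
    | cons c v =>
      obtain ⟨t, rfl, ht⟩ := (h .stay c c _ (by rw [step_ne hl]; rfl)).1 _ rfl
      exact ht
  | cons c u =>
    obtain ⟨t, rfl, ht⟩ := (h .stay c c _ (by rw [step_ne hl]; rfl)).1 _ rfl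
    exact ht

theorem Agree.w_first (hl : l ≠ some 0) (h : Agree (n + 1) (.w, l) u v) {a : A} {p s : List A}
    (hp : a ∉ p) (hu : u = p ++ a :: s) :
    ∃ p' s', a ∉ p' ∧ v = p' ++ a :: s' ∧ Agree n (.w, l) s s' ∧
      Agree n (.w, predLevel l) p p' := by
  obtain ⟨s', ⟨p', hp', rfl⟩, hs⟩ := (h .xr a a _ (by rw [step_ne hl]; rfl)).1 s ⟨p, hp, hu⟩
  obtain ⟨p'', ⟨s'', hp'', e⟩, hps⟩ := (h .xl a a _ (by rw [step_ne hl]; rfl)).1 p ⟨s, hp, hu⟩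
  obtain ⟨rfl, rfl⟩ := first_unique hp' hp'' e
  exact ⟨p', s', hp', rfl, hs, hps⟩

theorem Agree.w_last (hl : l ≠ some 0) (h : Agree (n + 1) (.w, l) u v) {a : A} {p s : List A}
    (hs : a ∉ s) (hu : u = p ++ a :: s) :
    ∃ p' s', a ∉ s' ∧ v = p' ++ a :: s' ∧ Agree n (.w, l) p p' ∧
      Agree n (.w, predLevel l) s s' := by
  obtain ⟨p', s', h1, h2, h3, h4⟩ := h.reverse.w_first (a := a) (p := s.reverse) (s := p.reverse)
    hl (by simpa using hs) (by simp [hu])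
  refine ⟨s'.reverse, p'.reverse, by simpa using h1, ?_, ?_, ?_⟩
  · simpa using congrArg List.reverse h2
  · simpa [State.dual, Mode.dual] using h3.reverse
  · simpa [State.dual, Mode.dual] using h4.reverse

theorem Agree.w_ctr (hl : l ≠ some 0) (h : Agree (n + 1) (.w, l) u v) {a b : A}
    {p s r : List A} (hab : a ≠ b) (h1 : a ∉ p) (h2 : a ∉ s) (h3 : b ∉ s) (h4 : b ∉ r)
    (hu : u = p ++ b :: (s ++ a :: r)) :
    ∃ p' s' r', a ∉ p' ∧ a ∉ s' ∧ b ∉ s' ∧ b ∉ r' ∧ v = p' ++ b :: (s' ++ a :: r') ∧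
      Agree n (.w, predLevel l) s s' := by
  obtain ⟨s', ⟨p', r', -, g1, g2, g3, g4, rfl⟩, hs⟩ :=
    (h .ctr a b _ (by rw [step_ne hl]; rfl)).1 s ⟨p, r, hab, h1, h2, h3, h4, hu⟩
  exact ⟨p', s', r', g1, g2, g3, g4, rfl, hs⟩

/-- A symmetric relation that is compatible with the cuts of mode `w` is contained in `Agree`. -/
theorem agree_w_of (R : List A → List A → Prop) (hs : ∀ u v, R u v → R v u)
    (hstay : ∀ u v, R u v → Agree n (.w, predLevel l) u v)
    (hfirst : ∀ u v, R u v → ∀ a p s, a ∉ p → u = p ++ a :: s →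
      ∃ p' s', a ∉ p' ∧ v = p' ++ a :: s' ∧ Agree n (.w, l) s s' ∧ Agree n (.w, predLevel l) p p')
    (hlast : ∀ u v, R u v → ∀ a p s, a ∉ s → u = p ++ a :: s →
      ∃ p' s', a ∉ s' ∧ v = p' ++ a :: s' ∧ Agree n (.w, l) p p' ∧ Agree n (.w, predLevel l) s s')
    (hctr : ∀ u v, R u v → ∀ a b p s r, a ≠ b → a ∉ p → a ∉ s → b ∉ s → b ∉ r →
      u = p ++ b :: (s ++ a :: r) → ∃ p' s' r', a ∉ p' ∧ a ∉ s' ∧ b ∉ s' ∧ b ∉ r' ∧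
        v = p' ++ b :: (s' ++ a :: r') ∧ Agree n (.w, predLevel l) s s')
    (hR : R u v) : Agree (n + 1) (.w, l) u v := by
  refine agree_succ_of R hs ?_ hR
  intro u v h k a b q' hq s hs
  have hl : l ≠ some 0 := step_ne_of_eq hq
  rw [step_ne hl] at hq
  cases k
  case xr =>
    obtain rfl : (Mode.w, l) = q' := by simpa [modeStep] using hq
    obtain ⟨p, hp, e⟩ := hs
    obtain ⟨p', s', h1, h2, h3, -⟩ := hfirst u v h a p s hp e
    exact ⟨s', ⟨p', h1, h2⟩, h3⟩
  case xl =>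
    obtain rfl : (Mode.w, predLevel l) = q' := by simpa [modeStep] using hq
    obtain ⟨p, hp, e⟩ := hs
    obtain ⟨p', s', h1, h2, -, h3⟩ := hfirst u v h a s p hp e
    exact ⟨p', ⟨s', h1, h2⟩, h3⟩
  case yl =>
    obtain rfl : (Mode.w, l) = q' := by simpa [modeStep] using hq
    obtain ⟨p, hp, e⟩ := hs
    obtain ⟨p', s', h1, h2, h3, -⟩ := hlast u v h a s p hp e
    exact ⟨p', ⟨s', h1, h2⟩, h3⟩
  case yr =>
    obtain rfl : (Mode.w, predLevel l) = q' := by simpa [modeStep] using hq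
    obtain ⟨p, hp, e⟩ := hs
    obtain ⟨p', s', h1, h2, -, h3⟩ := hlast u v h a p s hp e
    exact ⟨s', ⟨p', h1, h2⟩, h3⟩
  case ctr =>
    obtain rfl : (Mode.w, predLevel l) = q' := by simpa [modeStep] using hq
    obtain ⟨p, r, hab, h1, h2, h3, h4, e⟩ := hs
    obtain ⟨p', s', r', g1, g2, g3, g4, e', hh⟩ := hctr u v h a b p s r hab h1 h2 h3 h4 e
    exact ⟨s', ⟨p', r', hab, g1, g2, g3, g4, e'⟩, hh⟩
  case stay =>
    obtain rfl : (Mode.w, predLevel l) = q' := by simpa [modeStep] using hq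
    exact ⟨v, rfl, by rw [show s = u from hs]; exact hstay u v h⟩

/-! ### Powers -/

/-- The `N`-th power of a word. -/
def wpow (N : ℕ) (u : List A) : List A := (List.replicate N u).flatten

@[simp] theorem wpow_zero (u : List A) : wpow 0 u = [] := rfl

theorem wpow_succ (N : ℕ) (u : List A) : wpow (N + 1) u = u ++ wpow N u := rfl

theorem wpow_succ' (N : ℕ) (u : List A) : wpow (N + 1) u = wpow N u ++ u := by
  simp [wpow, List.replicate_succ']

theorem mem_wpow {N : ℕ} {u : List A} {a : A} : a ∈ wpow N u ↔ N ≠ 0 ∧ a ∈ u := by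
  induction N with
  | zero => simp
  | succ N ih => simp only [wpow_succ, List.mem_append, ih]; tauto

/-- A cut at a first or last occurrence happens inside the outermost copy of `u`. So it consumes at
most one copy, and the outcome differs only in exponents that are still larger than the number of
remaining rounds. -/
theorem agree_wpow (u : List A) : ∀ (n N N' : ℕ), n < N → n < N' →
    Agree n (.w, none) (wpow N u) (wpow N' u)
  | 0, _, _, _, _ => trivial
  | n + 1, N, N', h, h' => by
    have ih := agree_wpow u n
    refine agree_w_of (fun x y => ∃ N N', n + 1 < N ∧ n + 1 < N' ∧ x = wpow N u ∧ y = wpow N' u)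
      ?_ ?_ ?_ ?_ ?_ ⟨N, N', h, h', rfl, rfl⟩
    · rintro _ _ ⟨N, N', h, h', rfl, rfl⟩
      exact ⟨N', N, h', h, rfl, rfl⟩
    · rintro _ _ ⟨N, N', h, h', rfl, rfl⟩
      exact ih N N' (by omega) (by omega)
    · rintro _ _ ⟨N, N', h, h', rfl, rfl⟩ a p s hp e
      obtain ⟨N, rfl⟩ : ∃ k, N = k + 1 := ⟨N - 1, by omega⟩
      obtain ⟨N', rfl⟩ : ∃ k, N' = k + 1 := ⟨N' - 1, by omega⟩
      have ha : a ∈ u := (mem_wpow (N := N + 1)).1 (by rw [e]; simp) |>.2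
      obtain ⟨p0, s0, hp0, rfl⟩ := exists_first ha
      rw [wpow_succ, List.append_assoc, List.cons_append] at e
      obtain ⟨rfl, rfl⟩ := first_unique hp0 hp e
      exact ⟨p0, s0 ++ wpow N' (p0 ++ a :: s0), hp0, by simp [wpow_succ],
        (ih N N' (by omega) (by omega)).append_left _, Agree.refl _ _ _⟩
    · rintro _ _ ⟨N, N', h, h', rfl, rfl⟩ a p s hp e
      obtain ⟨N, rfl⟩ : ∃ k, N = k + 1 := ⟨N - 1, by omega⟩
      obtain ⟨N', rfl⟩ : ∃ k, N' = k + 1 := ⟨N' - 1, by omega⟩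
      have ha : a ∈ u := (mem_wpow (N := N + 1)).1 (by rw [e]; simp) |>.2
      obtain ⟨p0, s0, hp0, rfl⟩ := exists_last ha
      rw [wpow_succ', ← List.append_assoc] at e
      obtain ⟨rfl, rfl⟩ := last_unique hp0 hp e
      exact ⟨wpow N' (p0 ++ a :: s0) ++ p0, s0, hp0, by simp [wpow_succ'],
        (ih N N' (by omega) (by omega)).append_right _, Agree.refl _ _ _⟩
    · rintro _ _ ⟨N, N', h, h', rfl, rfl⟩ a b p s r hab h1 h2 h3 h4 e
      -- No centre exists in a power: the first `a` lies in the first copy, and a full copy,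
      -- containing `b`, follows it.
      exfalso
      obtain ⟨N, rfl⟩ : ∃ k, N = k + 2 := ⟨N - 2, by omega⟩
      have ha : a ∈ u := (mem_wpow (N := N + 2)).1 (by rw [e]; simp) |>.2
      have hb : b ∈ u := (mem_wpow (N := N + 2)).1 (by rw [e]; simp) |>.2
      obtain ⟨p0, s0, hp0, hu⟩ := exists_first ha
      have e' : p0 ++ a :: (s0 ++ wpow (N + 1) u) = (p ++ b :: s) ++ a :: r := by
        calc p0 ++ a :: (s0 ++ wpow (N + 1) u) = (p0 ++ a :: s0) ++ wpow (N + 1) u := by simp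
          _ = wpow (N + 2) u := by rw [← hu, ← wpow_succ]
          _ = (p ++ b :: s) ++ a :: r := by rw [e]; simp
      obtain ⟨-, rfl⟩ := first_unique hp0 (by simp [h1, h2, hab]) e'
      exact h4 (List.mem_append_right _ (mem_wpow.2 ⟨by omega, hb⟩))

/-- A power of a word makes the first occurrences of its letters in the remaining word
invisible. -/
theorem agree_absorb {G : List A} (l : Option ℕ) : ∀ (n N : ℕ) (U V : List A), n < N →
    (∀ a ∈ U, a ∈ G) → (∀ a ∈ V, a ∈ G) → Agree n (.y, predLevel l) U V →
    Agree n (.x, l) (wpow N G ++ U) (wpow N G ++ V)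
  | 0, _, _, _, _, _, _, _ => trivial
  | n + 1, N, U, V, hN, hU, hV, h => by
    have ih := agree_absorb (G := G) l n
    refine agree_x_of (fun x y => ∃ U V, (∀ a ∈ U, a ∈ G) ∧ (∀ a ∈ V, a ∈ G) ∧
      Agree (n + 1) (.y, predLevel l) U V ∧ x = wpow N G ++ U ∧ y = wpow N G ++ V) ?_ ?_ ?_
      ⟨U, V, hU, hV, h, rfl, rfl⟩
    · rintro _ _ ⟨U, V, hU, hV, h, rfl, rfl⟩
      exact ⟨V, U, hV, hU, h.symm, rfl, rfl⟩
    · rintro _ _ ⟨U, V, hU, hV, h, rfl, rfl⟩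
      exact h.of_succ.append_left _
    · rintro _ _ ⟨U, V, hU, hV, h, rfl, rfl⟩ a p s hp e
      obtain ⟨N, rfl⟩ : ∃ k, N = k + 1 := ⟨N - 1, by omega⟩
      have ha : a ∈ G := by
        have : a ∈ wpow (N + 1) G ++ U := by rw [e]; simp
        rcases List.mem_append.1 this with h | h
        · exact (mem_wpow.1 h).2
        · exact hU a h
      obtain ⟨p0, s0, hp0, rfl⟩ := exists_first ha
      rw [wpow_succ, List.append_assoc, List.append_assoc, List.cons_append] at e
      obtain ⟨rfl, rfl⟩ := first_unique hp0 hp e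
      exact ⟨p0, s0 ++ (wpow N (p0 ++ a :: s0) ++ V), hp0, by simp [wpow_succ],
        (ih N U V (by omega) hU hV h.of_succ).append_left _, Agree.refl _ _ _⟩

end Modes

-- Green's relations in finite monoids and in `DA`

section FiniteMonoids

variable {M : Type*} [Monoid M]

theorem exists_isIdempotentElem_pow (M : Type*) [Monoid M] [Finite M] :
    ∃ N : ℕ, 0 < N ∧ ∀ x : M, IsIdempotentElem (x ^ N) := by
  -- The factorial is at least the index of every element and a multiple of its period, both of
  -- which are at most the cardinality.
  refine ⟨(Nat.card M).factorial, Nat.factorial_pos _, fun x => ?_⟩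
  have : ¬ Function.Injective fun i : Fin (Nat.card M + 1) => x ^ (i : ℕ) := by
    intro h
    have := Nat.card_le_card_of_injective _ h
    simp at this
  have h2 : ∃ i p : ℕ, 0 < p ∧ i + p ≤ Nat.card M ∧ x ^ i = x ^ (i + p) := by
    simp only [Function.Injective, not_forall] at this
    obtain ⟨i, j, hij, hne⟩ := this
    rcases lt_or_gt_of_ne (fun h => hne (Fin.ext h) : (i : ℕ) ≠ j) with h | h
    · exact ⟨i, j - i, by omega, by omega, by rw [Nat.add_sub_cancel' h.le]; exact hij⟩
    · exact ⟨j, i - j, by omega, by omega, by rw [Nat.add_sub_cancel' h.le]; exact hij.symm⟩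
  obtain ⟨i, p, hp, hip, e⟩ := h2
  set N := (Nat.card M).factorial with hN
  have hiN : i ≤ N := by
    have := Nat.self_le_factorial (Nat.card M)
    omega
  have hper : ∀ k, x ^ (N + p * k) = x ^ N := by
    intro k
    induction k with
    | zero => simp
    | succ k ih =>
      calc x ^ (N + p * (k + 1)) = x ^ (i + p) * x ^ (N - i + p * k) := by
            rw [← pow_add]; congr 1; rw [Nat.mul_succ]; omega
        _ = x ^ (N + p * k) := by rw [← e, ← pow_add]; congr 1; omega
        _ = x ^ N := ih
  obtain ⟨k, hk⟩ : p ∣ N := Nat.dvd_factorial hp (by omega)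
  change x ^ N * x ^ N = x ^ N
  rw [← pow_add]
  conv_lhs => rw [show N + N = N + p * k by omega]
  exact hper k

theorem GreenR.trans {x y z : M} (h : GreenR x y) (h' : GreenR y z) : GreenR x z :=
  Eq.trans h h'

theorem GreenL.trans {x y z : M} (h : GreenL x y) (h' : GreenL y z) : GreenL x z :=
  Eq.trans h h'

theorem greenR_of_mul {s x y : M} (h : GreenR (s * (x * y)) s) : GreenR (s * x) s := by
  obtain ⟨z, hz⟩ := greenR_mul_iff.1 h
  exact greenR_mul_iff.2 ⟨y * z, by simpa only [mul_assoc] using hz⟩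

theorem greenL_of_mul {s x y : M} (h : GreenL (x * y * s) s) : GreenL (y * s) s := by
  obtain ⟨z, hz⟩ := greenL_mul_iff.1 h
  exact greenL_mul_iff.2 ⟨z * x, by simpa only [mul_assoc] using hz⟩

theorem greenL_iff_op {x y : M} : GreenL x y ↔ GreenR (MulOpposite.op x) (MulOpposite.op y) := by
  rw [greenL_iff, greenR_iff]
  simp only [MulOpposite.exists, ← MulOpposite.op_mul, MulOpposite.op_inj]

theorem isIdempotentElem_op {x : M} : IsIdempotentElem (MulOpposite.op x) ↔ IsIdempotentElem x := by
  simp only [IsIdempotentElem, ← MulOpposite.op_mul, MulOpposite.op_inj]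

theorem simD_iff_op {x y : M} : SimD x y ↔ SimK (MulOpposite.op x) (MulOpposite.op y) := by
  simp only [SimD, SimK, MulOpposite.forall, isIdempotentElem_op, ← MulOpposite.op_mul,
    MulOpposite.op_inj, greenL_iff_op]

/-- The size of the right ideal of an element. -/
noncomputable def rsize (s : M) : ℕ := (Set.range (fun m : M => s * m)).ncard

/-- The size of the left ideal of an element. -/
noncomputable def lsize (s : M) : ℕ := (Set.range (fun m : M => m * s)).ncard

theorem rsize_mul_lt [Finite M] {s x : M} (h : ¬ GreenR (s * x) s) : rsize (s * x) < rsize s := by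
  refine Set.ncard_lt_ncard (LE.le.ssubset_of_ne ?_ h) (Set.toFinite _)
  rintro _ ⟨m, rfl⟩
  exact ⟨x * m, by simp only [mul_assoc]⟩

theorem lsize_mul_lt [Finite M] {s x : M} (h : ¬ GreenL (x * s) s) : lsize (x * s) < lsize s := by
  refine Set.ncard_lt_ncard (LE.le.ssubset_of_ne ?_ h) (Set.toFinite _)
  rintro _ ⟨m, rfl⟩
  exact ⟨m * x, by simp only [mul_assoc]⟩

theorem GreenR.rsize_eq {s t : M} (h : GreenR s t) : rsize s = rsize t := congrArg Set.ncard h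

theorem GreenL.lsize_eq {s t : M} (h : GreenL s t) : lsize s = lsize t := congrArg Set.ncard h

instance [Finite M] : Finite Mᵐᵒᵖ := Finite.of_equiv M MulOpposite.opEquiv

theorem pow_pred_mul {N : ℕ} (hN : 0 < N) (x : M) : x ^ (N - 1) * x = x ^ N := by
  rw [← pow_succ, Nat.sub_add_cancel hN]

/-- Stability of finite monoids, in the form that is used below. -/
theorem exists_mul_eq_of_mul_mul [Finite M] {e c w : M} (h : c * e * w = e) :
    ∃ z, e * w * z = e := by
  obtain ⟨N, hN, hid⟩ := exists_isIdempotentElem_pow M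
  have h1 : ∀ k, c ^ k * e * w ^ k = e := by
    intro k
    induction k with
    | zero => simp
    | succ k ih =>
      calc c ^ (k + 1) * e * w ^ (k + 1) = c ^ k * (c * e * w) * w ^ k := by
            rw [pow_succ, pow_succ']; simp only [mul_assoc]
        _ = e := by rw [h, ih]
  have h2 : e * w ^ N = e := by
    calc e * w ^ N = c ^ N * e * w ^ N * w ^ N := by rw [h1]
      _ = c ^ N * e * w ^ N := by rw [mul_assoc, (hid w).eq]
      _ = e := h1 N
  refine ⟨w ^ (N - 1), ?_⟩
  rw [mul_assoc, ← pow_succ', Nat.sub_add_cancel hN, h2]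

theorem exists_mul_eq_of_mul_mul' [Finite M] {e c w : M} (h : c * e * w = e) :
    ∃ z, z * (c * e) = e := by
  have h' : MulOpposite.op w * MulOpposite.op e * MulOpposite.op c = MulOpposite.op e := by
    rw [← MulOpposite.op_mul, ← MulOpposite.op_mul, ← mul_assoc, h]
  obtain ⟨z, hz⟩ := exists_mul_eq_of_mul_mul h'
  exact ⟨z.unop, MulOpposite.op_injective (by simpa using hz)⟩

/-- The characteristic property of the monoids in `DA`: `e x e = e` whenever the idempotent `e`
is `𝓙`-below `x`. -/
def DAProp (M : Type*) [Monoid M] : Prop :=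
  ∀ e x p q : M, IsIdempotentElem e → p * x * q = e → e * x * e = e

theorem DAProp.op (h : DAProp M) : DAProp Mᵐᵒᵖ := by
  intro e x p q he hx
  have := h e.unop x.unop q.unop p.unop (isIdempotentElem_op.1 he) (by
    rw [← hx]; simp [mul_assoc])
  apply MulOpposite.unop_injective
  simpa [mul_assoc] using this

/-- Monoids with this property are 𝓗-trivial: from `y = x p` and `x = q y` follows `x = q ^ N x p ^
N`, and the property applied to the idempotent `p ^ N` gives `p ^ N p = p ^ N`. -/
theorem DAProp.eq_of_greenR_greenL [Finite M] (h : DAProp M) {x y : M} (hR : GreenR x y)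
    (hL : GreenL x y) : x = y := by
  obtain ⟨N, hN, hid⟩ := exists_isIdempotentElem_pow M
  obtain ⟨⟨p, hp⟩, -⟩ := greenR_iff.1 hR
  obtain ⟨-, ⟨q, hq⟩⟩ := greenL_iff.1 hL
  have hx : q * x * p = x := by rw [mul_assoc, hp, hq]
  have h1 : ∀ k, q ^ k * x * p ^ k = x := by
    intro k
    induction k with
    | zero => simp
    | succ k ih =>
      calc q ^ (k + 1) * x * p ^ (k + 1) = q ^ k * (q * x * p) * p ^ k := by
            rw [pow_succ, pow_succ']; simp only [mul_assoc]
        _ = x := by rw [hx, ih]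
  have h2 : p ^ N * p = p ^ N := by
    have := h (p ^ N) p (p ^ (N - 1)) 1 (hid p) (by
      rw [mul_one, ← pow_succ, Nat.sub_add_cancel hN])
    calc p ^ N * p = p ^ N * p ^ N * p := by rw [(hid p).eq]
      _ = p ^ N * p * p ^ N := by rw [mul_assoc, mul_assoc, ← pow_succ, ← pow_succ']
      _ = p ^ N := this
  calc x = q ^ N * x * p ^ N := (h1 N).symm
    _ = q ^ N * x * (p ^ N * p) := by rw [h2]
    _ = x * p := by rw [← mul_assoc, h1]
    _ = y := hp

/-- If `s e = s` for an element `e` that is `𝓙`-below `c`, then `c` stabilizes the `𝓡`-class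
of `s`. -/
theorem DAProp.greenR_mul [Finite M] (h : DAProp M) {s t e c p q : M}
    (hs : s * e = s) (hc : p * c * q = e) (ht : GreenR t s) : GreenR (t * c) t := by
  obtain ⟨N, hN, hid⟩ := exists_isIdempotentElem_pow M
  obtain ⟨⟨y, hy⟩, ⟨z, hz⟩⟩ := greenR_iff.1 ht
  -- Conjugation carries `e`, which stabilizes `s`, to an element that stabilizes `t`.
  set g := y * e * z with hg
  have htg : t * g = t := by rw [hg, ← mul_assoc, ← mul_assoc, hy, hs, hz]
  have htk : ∀ k, t * g ^ k = t := by
    intro k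
    induction k with
    | zero => simp
    | succ k ih => rw [pow_succ, ← mul_assoc, ih, htg]
  have key := h (g ^ N) c (g ^ (N - 1) * y * p) (q * z) (hid g) (by
    calc g ^ (N - 1) * y * p * c * (q * z) = g ^ (N - 1) * (y * (p * c * q) * z) := by
          simp only [mul_assoc]
      _ = g ^ N := by rw [hc, ← hg, pow_pred_mul hN])
  refine greenR_mul_iff.2 ⟨g ^ N, ?_⟩
  calc t * c * g ^ N = t * g ^ N * c * g ^ N := by rw [htk]
    _ = t * (g ^ N * c * g ^ N) := by simp only [mul_assoc]
    _ = t := by rw [key, htk]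

/-! ### Evaluation of words -/

variable {A : Type*}

/-- The value of a word in a monoid. -/
def ev (f : A → M) (u : List A) : M := (u.map f).prod

@[simp] theorem ev_nil (f : A → M) : ev f [] = 1 := rfl

@[simp] theorem ev_cons (f : A → M) (a : A) (u : List A) : ev f (a :: u) = f a * ev f u := by
  simp [ev]

@[simp] theorem ev_append (f : A → M) (u v : List A) : ev f (u ++ v) = ev f u * ev f v := by
  simp [ev]

theorem ev_wpow (f : A → M) (N : ℕ) (u : List A) : ev f (wpow N u) = ev f u ^ N := by
  induction N with
  | zero => simp
  | succ N ih => rw [wpow_succ, ev_append, ih, pow_succ']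

theorem ev_op (f : A → M) (u : List A) :
    ev (fun a => MulOpposite.op (f a)) u = MulOpposite.op (ev f u.reverse) := by
  induction u with
  | nil => simp
  | cons a u ih => simp [ih]

/-- If `s · ev f u · z = s`, an idempotent power of `ev f u · z` stabilizes `s` and is 𝓙-below `f
c`. Hence `c` is harmless in the whole 𝓡-class of `s`; this is why only first occurrences of letters
matter. -/
theorem DAProp.greenR_letter [Finite M] (h : DAProp M) {f : A → M} {s t : M} {u : List A} {c : A}
    (hu : GreenR (s * ev f u) s) (hc : c ∈ u) (ht : GreenR t s) : GreenR (t * f c) t := by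
  obtain ⟨N, hN, hid⟩ := exists_isIdempotentElem_pow M
  obtain ⟨z, hz⟩ := greenR_mul_iff.1 hu
  obtain ⟨u1, u2, -, rfl⟩ := exists_first hc
  set g := ev f (u1 ++ c :: u2) * z with hg
  have hk : ∀ k, s * g ^ k = s := by
    intro k
    induction k with
    | zero => simp
    | succ k ih => rw [pow_succ, ← mul_assoc, ih, hg, ← mul_assoc, hz]
  refine h.greenR_mul (p := g ^ (N - 1) * ev f u1) (q := ev f u2 * z) (hk N) ?_ ht
  calc g ^ (N - 1) * ev f u1 * f c * (ev f u2 * z) = g ^ (N - 1) * g := by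
        rw [hg]; simp [mul_assoc]
    _ = g ^ N := pow_pred_mul hN g

theorem DAProp.greenR_word [Finite M] (h : DAProp M) {f : A → M} {s : M} {u v : List A}
    (hu : GreenR (s * ev f u) s) (hv : ∀ c ∈ v, c ∈ u) : GreenR (s * ev f v) s := by
  induction v using List.reverseRecOn with
  | nil => simp [GreenR]
  | append_singleton v c ih =>
    have ih := ih fun d hd => hv d (by simp [hd])
    have := (h.greenR_letter hu (hv c (by simp)) ih).trans ih
    simpa [mul_assoc] using this

theorem DAProp.greenL_word [Finite M] (h : DAProp M) {f : A → M} {t : M} {u v : List A}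
    (hu : GreenL (ev f u * t) t) (hv : ∀ c ∈ v, c ∈ u) : GreenL (ev f v * t) t := by
  have := h.op.greenR_word (f := fun a => MulOpposite.op (f a)) (s := MulOpposite.op t)
    (u := u.reverse) (v := v.reverse)
    (by rw [ev_op, List.reverse_reverse, ← MulOpposite.op_mul]; exact greenL_iff_op.1 hu)
    (by simpa using hv)
  rw [ev_op, List.reverse_reverse, ← MulOpposite.op_mul] at this
  exact greenL_iff_op.2 this

/-- Either a word stays in the `𝓡`-class of `s`, or it leaves it for the first time at the first
occurrence of some letter. -/
theorem DAProp.first_drop [Finite M] (h : DAProp M) (f : A → M) (s : M) (u : List A) :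
    GreenR (s * ev f u) s ∨ ∃ p a r, u = p ++ a :: r ∧ a ∉ p ∧ GreenR (s * ev f p) s ∧
      ¬ GreenR (s * ev f p * f a) s := by
  induction u using List.reverseRecOn with
  | nil => left; simp [GreenR]
  | append_singleton u c ih =>
    rcases ih with ih | ⟨p, a, r, rfl, h1, h2, h3⟩
    · by_cases hc : GreenR (s * ev f u * f c) s
      · left; simpa [mul_assoc] using hc
      -- A letter that was read before could not lead out, so this is the first occurrence of `c`.
      · exact Or.inr ⟨u, c, [], rfl, fun hm => hc ((h.greenR_letter ih hm ih).trans ih), ih, hc⟩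
    · exact Or.inr ⟨p, a, r ++ [c], by simp, h1, h2, h3⟩

theorem DAProp.last_drop [Finite M] (h : DAProp M) (f : A → M) (t : M) (v : List A) :
    GreenL (ev f v * t) t ∨ ∃ p a r, v = p ++ a :: r ∧ a ∉ r ∧ GreenL (ev f r * t) t ∧
      ¬ GreenL (f a * (ev f r * t)) t := by
  rcases h.op.first_drop (fun a => MulOpposite.op (f a)) (MulOpposite.op t) v.reverse with
    h1 | ⟨p, a, r, h1, h2, h3, h4⟩
  · left
    rw [ev_op, List.reverse_reverse, ← MulOpposite.op_mul] at h1
    exact greenL_iff_op.2 h1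
  · right
    refine ⟨r.reverse, a, p.reverse, ?_, by simpa using h2, ?_, ?_⟩
    · simpa using congrArg List.reverse h1
    · rw [ev_op, ← MulOpposite.op_mul] at h3
      exact greenL_iff_op.2 h3
    · rw [ev_op, ← MulOpposite.op_mul, ← MulOpposite.op_mul] at h4
      exact fun hh => h4 (greenL_iff_op.1 hh)

end FiniteMonoids

-- Membership in `DA`, and the corners as subclasses of it

section DA

variable {M : Type} [Monoid M]

theorem greenD_idem_iff {e x : M} : GreenD e x ↔
    ∃ a b c d, x = d * e * b ∧ c * d * e = e ∧ e * b * a = e := by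
  constructor
  · rintro ⟨z, hR, hL⟩
    obtain ⟨⟨b, rfl⟩, ⟨a, ha⟩⟩ := greenR_iff.1 hR
    obtain ⟨⟨d, rfl⟩, ⟨c, hc⟩⟩ := greenL_iff.1 hL
    refine ⟨a, b, c, d, by rw [mul_assoc], ?_, ha⟩
    calc c * d * e = c * (d * (e * b)) * a := by
          conv_lhs => rw [← ha]
          simp only [mul_assoc]
      _ = e := by rw [hc, ha]
  · rintro ⟨a, b, c, d, rfl, h1, h2⟩
    refine ⟨e * b, greenR_iff.2 ⟨⟨b, rfl⟩, ⟨a, h2⟩⟩, greenL_iff.2 ⟨⟨d, by rw [mul_assoc]⟩, ⟨c, ?_⟩⟩⟩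
    rw [← mul_assoc, ← mul_assoc, h1]

/-- The idempotent `g = a e b` is 𝓙-below `d e c`, so `g (d e c) g = g`. It follows that `e` is
𝓙-below `b d`. The identity makes products in the 𝓓-class of `e` collapse to elements of that class.
-/
theorem DAProp.mul_mul_eq (h : DAProp M) {e a b c d : M} (he : IsIdempotentElem e)
    (h1 : c * d * e = e) (h2 : e * b * a = e) : e * (b * d) * e = e := by
  have hg : IsIdempotentElem (a * e * b) := by
    calc a * e * b * (a * e * b) = a * (e * b * a) * e * b := by simp only [mul_assoc]
      _ = a * (e * e) * b := by rw [h2]; simp only [mul_assoc]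
      _ = a * e * b := by rw [he.eq]
  have key := h (a * e * b) (d * e * c) (a * c) (d * e * b) hg (by
    calc a * c * (d * e * c) * (d * e * b) = a * (c * d * e) * (c * d * e) * b := by
          simp only [mul_assoc]
      _ = a * (e * e) * b := by rw [h1]; simp only [mul_assoc]
      _ = a * e * b := by rw [he.eq])
  refine h e (b * d) e (e * c * a * e) he ?_
  calc e * (b * d) * (e * c * a * e) = e * b * d * e * c * a * e := by simp only [mul_assoc]
    _ = e * e * b * d * e * c * a * e := by rw [he.eq]
    _ = (e * b * a) * e * b * d * e * c * a * (e * b * a) := by rw [h2]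
    _ = e * b * (a * e * b * (d * e * c) * (a * e * b)) * a := by simp only [mul_assoc]
    _ = (e * b * a) * (e * b * a) := by rw [key]; simp only [mul_assoc]
    _ = e := by rw [h2, he.eq]

/-- All elements of a regular 𝓓-class are idempotent, and a group that is an image of idempotents is
trivial. -/
theorem varDA_of_daProp [Finite M] (h : DAProp M) : varDA M := by
  refine ⟨inferInstance, fun e he => ⟨⟨{x | GreenD e x}, ?_⟩, rfl, ?_⟩⟩
  · intro x y hx hy
    obtain ⟨a, b, c, d, rfl, h1, h2⟩ := greenD_idem_iff.1 hx
    obtain ⟨a', b', c', d', rfl, h1', h2'⟩ := greenD_idem_iff.1 hy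
    refine greenD_idem_iff.2 ⟨a', b', c, d, ?_, h1, h2'⟩
    calc d * e * b * (d' * e * b') = d * (e * (b * d') * e) * b' := by simp only [mul_assoc]
      _ = d * e * b' := by rw [h.mul_mul_eq he h1' h2]
  · intro T G _ f hf
    refine ⟨fun g g' => ?_⟩
    have hone : ∀ g : G, g = 1 := by
      intro g
      obtain ⟨t, rfl⟩ := hf g
      have ht : t * t = t := by
        apply Subtype.ext
        apply Subtype.ext
        obtain ⟨a, b, c, d, hx, h1, h2⟩ := greenD_idem_iff.1 t.1.2
        change (t.1.1 : M) * t.1.1 = t.1.1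
        rw [hx]
        calc d * e * b * (d * e * b) = d * (e * (b * d) * e) * b := by simp only [mul_assoc]
          _ = d * e * b := by rw [h.mul_mul_eq he h1 h2]
      have := congrArg f ht
      rw [map_mul] at this
      exact mul_eq_left.1 this
    rw [hone g, hone g']

/-- The invertible elements of the local monoid at `e`. -/
def LocalUnit (e : M) : Type :=
  {t : M // e * t = t ∧ t * e = t ∧ ∃ w, e * w = w ∧ w * e = w ∧ w * t = e ∧ t * w = e}

/-- The units of the local monoid at `e` form a group inside the 𝓓-class of `e`. So this group is a
divisor of `S`, and aperiodicity makes it trivial. -/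
theorem LocalUnit.eq_of_subsingleton {e h : M} (he : IsIdempotentElem e)
    (h1 : e * h = h) (h2 : h * e = h) (h3 : ∃ w, e * w = w ∧ w * e = w ∧ w * h = e ∧ h * w = e)
    (S : Subsemigroup M) (hS : ∀ t, GreenD e t → t ∈ S) (hap : IsAperiodic S) : h = e := by
  let G := LocalUnit e
  let mulG : G → G → G := fun s t => ⟨s.1 * t.1, by rw [← mul_assoc, s.2.1],
    by rw [mul_assoc, t.2.2.1], by
      obtain ⟨s, s1, s2, w, w1, w2, w3, w4⟩ := s
      obtain ⟨t, t1, t2, x, x1, x2, x3, x4⟩ := t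
      refine ⟨x * w, by rw [← mul_assoc, x1], by rw [mul_assoc, w2], ?_, ?_⟩
      · calc x * w * (s * t) = x * (w * s) * t := by simp only [mul_assoc]
          _ = e := by rw [w3, x2, x3]
      · calc s * t * (x * w) = s * (t * x) * w := by simp only [mul_assoc]
          _ = e := by rw [x4, s2, w4]⟩
  let oneG : G := ⟨e, he, he, e, he, he, he, he⟩
  let invG : G → G := fun t => ⟨t.2.2.2.choose, t.2.2.2.choose_spec.1, t.2.2.2.choose_spec.2.1,
    t.1, t.2.1, t.2.2.1, t.2.2.2.choose_spec.2.2.2, t.2.2.2.choose_spec.2.2.1⟩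
  let _ : Mul G := ⟨mulG⟩
  let _ : One G := ⟨oneG⟩
  let _ : Inv G := ⟨invG⟩
  let _ : Group G := Group.ofLeftAxioms
    (fun a b c => Subtype.ext (mul_assoc a.1 b.1 c.1)) (fun a => Subtype.ext a.2.1)
    (fun a => Subtype.ext a.2.2.2.choose_spec.2.2.1)
  let T : Subsemigroup S :=
    ⟨{t | e * t.1 = t.1 ∧ t.1 * e = t.1 ∧
        ∃ w, e * w = w ∧ w * e = w ∧ w * t.1 = e ∧ t.1 * w = e},
      fun {a b} ha hb => (mulG ⟨a.1, ha⟩ ⟨b.1, hb⟩).2⟩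
  let f : T →ₙ* G := ⟨fun t => ⟨t.1.1, t.2⟩, fun a b => rfl⟩
  have hf : Function.Surjective f := by
    rintro ⟨t, ht⟩
    have htS : t ∈ S := by
      obtain ⟨t1, t2, w, w1, w2, w3, w4⟩ := ht
      refine hS t (greenD_idem_iff.2 ⟨e, e, w, t, by rw [t2, t2], by rw [w3, he.eq], ?_⟩)
      rw [he.eq, he.eq]
    exact ⟨⟨⟨t, htS⟩, ht⟩, rfl⟩
  have := (hap T G f hf).elim ⟨h, h1, h2, h3⟩ oneG
  exact congrArg Subtype.val this

/-- After normalizing to `e p = p` and `q e = q`, the element `x q p x` lies in the 𝓓-class of `e`,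
which is closed under products. By stability, elements of this class in the local monoid at `e` are
units there. This applies to `e x q p x e`, so `e x` is 𝓡-equivalent to `e`, and then to `e x e`,
which equals `e` since the group of units is trivial. -/
theorem daProp_of_varDA (h : varDA M) : DAProp M := by
  obtain ⟨hfin, h⟩ := h
  intro e x p q he hx
  obtain ⟨S, hS, hap⟩ := h e he
  have hmem : ∀ t, t ∈ S ↔ GreenD e t := fun t => by
    change t ∈ (S : Set M) ↔ _
    rw [hS]; rfl
  obtain ⟨p, q, hpxq, hep, hqe⟩ : ∃ p' q', p' * x * q' = e ∧ e * p' = p' ∧ q' * e = q' := by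
    refine ⟨e * p, q * e, ?_, by rw [← mul_assoc, he.eq], by rw [mul_assoc, he.eq]⟩
    calc e * p * x * (q * e) = e * (p * x * q) * e := by simp only [mul_assoc]
      _ = e := by rw [hx, he.eq, he.eq]
  have heS : e ∈ S := (hmem e).2 (greenD_idem_iff.2 ⟨1, 1, 1, 1, by simp, by simp, by simp⟩)
  have hxg : x * q * p * x ∈ S := by
    refine (hmem _).2 (greenD_idem_iff.2 ⟨q, p * x, p, x * q, ?_, ?_, ?_⟩)
    · simp only [mul_assoc]; rw [← mul_assoc e, hep]
    · rw [← mul_assoc, hpxq, he.eq]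
    · rw [← mul_assoc, hep, hpxq]
  have htS : e * (x * q * p * x) * e ∈ S := S.mul_mem (S.mul_mem heS hxg) heS
  have hstab : ∀ t ∈ S, e * t = t → t * e = t → (∃ z, t * z = e) ∧ ∃ z, z * t = e := by
    intro t ht h1 h2
    obtain ⟨a, b, c, d, rfl, g1, g2⟩ := greenD_idem_iff.1 ((hmem t).1 ht)
    have hc : c * (d * e * b) * a = e := by
      calc c * (d * e * b) * a = (c * d * e) * b * a := by simp only [mul_assoc]
        _ = e := by rw [g1, g2]
    constructor
    · obtain ⟨z, hz⟩ := exists_mul_eq_of_mul_mul (e := e) (c := c) (w := d * e * b * a) (by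
        rw [mul_assoc, ← mul_assoc e, h1, ← mul_assoc, hc])
      exact ⟨a * z, by rw [← mul_assoc e, h1] at hz; rw [← mul_assoc, hz]⟩
    · obtain ⟨z, hz⟩ := exists_mul_eq_of_mul_mul' (e := e) (c := c * (d * e * b)) (w := a) (by
        rw [mul_assoc c, h2, hc])
      exact ⟨z * c, by rw [mul_assoc c, h2] at hz; rw [mul_assoc, hz]⟩
  obtain ⟨⟨z, hz⟩, ⟨z', hz'⟩⟩ := hstab _ htS
    (by rw [← mul_assoc, ← mul_assoc, he.eq]) (by rw [mul_assoc, he.eq])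
  have hexS : e * x ∈ S := (hmem _).2 (greenD_idem_iff.2 ⟨q * p * x * e * z, x, 1, 1, by simp,
    by simp, by
      calc e * x * (q * p * x * e * z) = e * (x * q * p * x) * e * z := by simp only [mul_assoc]
        _ = e := hz⟩)
  have hS' : e * x * e ∈ S := S.mul_mem hexS heS
  have h1 : e * (e * x * e) = e * x * e := by rw [← mul_assoc, ← mul_assoc, he.eq]
  have h2 : e * x * e * e = e * x * e := by rw [mul_assoc, he.eq]
  obtain ⟨⟨y, hy⟩, ⟨y', hy'⟩⟩ := hstab _ hS' h1 h2
  refine LocalUnit.eq_of_subsingleton he h1 h2 ⟨e * y * e, ?_, ?_, ?_, ?_⟩ S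
    (fun t ht => (hmem t).2 ht) hap
  · rw [← mul_assoc, ← mul_assoc, he.eq]
  · rw [mul_assoc, he.eq]
  · have hyy : e * y' * e = e * y * e := by
      calc e * y' * e = e * (y' * e) := by rw [mul_assoc]
        _ = e * (y' * (e * x * e * y)) := by rw [hy]
        _ = e * (y' * (e * x * e)) * y := by simp only [mul_assoc]
        _ = e * y := by rw [hy', he.eq]
        _ = e * (y' * (e * x * e)) * y := by rw [hy', he.eq]
        _ = e * (y' * (e * x * e)) * y * e := by
          calc _ = e * (y' * (e * x * e * y)) := by simp only [mul_assoc]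
            _ = e * (y' * (e * x * e * y * e)) := by rw [hy, he.eq]
            _ = _ := by simp only [mul_assoc]
        _ = e * y * e := by rw [hy', he.eq]
    calc e * y * e * (e * x * e) = e * y' * e * (e * x * e) := by rw [hyy]
      _ = e * (y' * (e * x * e)) := by rw [mul_assoc _ e, h1]; simp only [mul_assoc]
      _ = e := by rw [hy', he.eq]
  · calc e * x * e * (e * y * e) = (e * x * e * e) * y * e := by simp only [mul_assoc]
      _ = e := by rw [h2, hy, he.eq]

theorem varJ_daProp (h : varJ M) : DAProp M := by
  obtain ⟨-, hJ⟩ := h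
  have hJ' : ∀ x y a b c d : M, a * x * b = y → c * y * d = x → x = y := by
    intro x y a b c d h1 h2
    refine hJ x y (Set.ext fun t => ⟨?_, ?_⟩)
    · rintro ⟨⟨p, q⟩, rfl⟩
      exact ⟨(p * c, d * q), by simp only [← h2, mul_assoc]⟩
    · rintro ⟨⟨p, q⟩, rfl⟩
      exact ⟨(p * a, b * q), by simp only [← h1, mul_assoc]⟩
  intro e x p q he hx
  have h1 : e * p = e := hJ' _ _ 1 (x * q) 1 p (by rw [one_mul, ← mul_assoc, mul_assoc e, mul_assoc e,
    hx, he.eq]) (by rw [one_mul])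
  have h2 : e * x = e := hJ' _ _ 1 q 1 x (by
    rw [one_mul]
    calc e * x * q = e * p * x * q := by rw [h1]
      _ = e := by rw [mul_assoc e, mul_assoc e, hx, he.eq]) (by rw [one_mul])
  rw [h2, he.eq]

/-- In the quotient `e x e = e`, and `∼_K`, tested at `e` itself, makes this an equality in `M`. -/
theorem daProp_of_conK (h : DAProp (conK M).Quotient) : DAProp M := by
  intro e x p q he hx
  have := h (conK M |>.mk' e) (conK M |>.mk' x) (conK M |>.mk' p) (conK M |>.mk' q)
    (by change _ * _ = _; rw [← map_mul, he.eq]) (by rw [← map_mul, ← map_mul, hx])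
  rw [← map_mul, ← map_mul] at this
  have h2 : SimK (e * x * e) e := (Con.eq _).1 this
  have h3 := h2 e he (Or.inr (by rw [he.eq]; rfl))
  rwa [← mul_assoc, ← mul_assoc, he.eq] at h3

theorem daProp_of_conD (h : DAProp (conD M).Quotient) : DAProp M := by
  intro e x p q he hx
  have := h (conD M |>.mk' e) (conD M |>.mk' x) (conD M |>.mk' p) (conD M |>.mk' q)
    (by change _ * _ = _; rw [← map_mul, he.eq]) (by rw [← map_mul, ← map_mul, hx])
  rw [← map_mul, ← map_mul] at this
  have h2 : SimD (e * x * e) e := (Con.eq _).1 this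
  have h3 := h2 e he (Or.inr (by rw [he.eq]; rfl))
  rwa [mul_assoc _ e, he.eq] at h3

theorem finite_daProp_of_corner : ∀ (m : ℕ),
    (∀ (M : Type) [Monoid M], varR m M → Finite M ∧ DAProp M) ∧
    (∀ (M : Type) [Monoid M], varL m M → Finite M ∧ DAProp M)
  | 0 => ⟨fun _ _ h => by rw [varR] at h; exact ⟨h.1, varJ_daProp h⟩,
      fun _ _ h => by rw [varL] at h; exact ⟨h.1, varJ_daProp h⟩⟩
  | 1 => ⟨fun _ _ h => by rw [varR] at h; exact ⟨h.1, varJ_daProp h⟩,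
      fun _ _ h => by rw [varL] at h; exact ⟨h.1, varJ_daProp h⟩⟩
  | m + 2 => by
    have ih := finite_daProp_of_corner (m + 1)
    exact ⟨fun M _ h => by
        rw [varR] at h; exact ⟨h.1, daProp_of_conK (ih.2 _ h.2).2⟩,
      fun M _ h => by
        rw [varL] at h; exact ⟨h.1, daProp_of_conD (ih.1 _ h.2).2⟩⟩

end DA

-- Agreement forces equal values

section Soundness

variable {M : Type*} [Monoid M] {A : Type*}

/-- The definition of `∼_K` speaks of idempotents only; an arbitrary `s` with `s x z = s` is reached
because `s` absorbs the idempotent power of `x z`. -/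
theorem SimK.mul_eq [Finite M] {x y s : M} (h : SimK x y) (hs : GreenR (s * x) s) :
    s * x = s * y := by
  obtain ⟨N, hN, hid⟩ := exists_isIdempotentElem_pow M
  obtain ⟨z, hz⟩ := greenR_mul_iff.1 hs
  have hk : ∀ k, s * (x * z) ^ k = s := by
    intro k
    induction k with
    | zero => simp
    | succ k ih => rw [pow_succ, ← mul_assoc, ih, ← mul_assoc, hz]
  have := h ((x * z) ^ N) (hid _) (Or.inl (greenR_mul_iff.2 ⟨z * (x * z) ^ (N - 1), by
    calc (x * z) ^ N * x * (z * (x * z) ^ (N - 1)) = (x * z) ^ N * (x * z * (x * z) ^ (N - 1)) := by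
          simp only [mul_assoc]
      _ = (x * z) ^ N := by rw [← pow_succ', Nat.sub_add_cancel hN, (hid _).eq]⟩))
  calc s * x = s * ((x * z) ^ N * x) := by rw [← mul_assoc, hk]
    _ = s * y := by rw [this, ← mul_assoc, hk]

theorem SimD.mul_eq [Finite M] {x y t : M} (h : SimD x y) (ht : GreenL (x * t) t) :
    x * t = y * t := by
  have := (simD_iff_op.1 h).mul_eq (s := MulOpposite.op t)
    (by rw [← MulOpposite.op_mul]; exact greenL_iff_op.1 ht)
  exact MulOpposite.op_injective (by simpa using this)

/-- If words that agree in the state `(y, l - 1)` are `∼_K`-equivalent, then words that agree in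
the state `(x, l)` are equal. -/
theorem DAProp.eq_of_agree_x [Finite M] (h : DAProp M) {f : A → M} {l : Option ℕ}
    (hl : l ≠ some 0) {n0 : ℕ}
    (hK : ∀ u v, Agree n0 (.y, predLevel l) u v → SimK (ev f u) (ev f v)) :
    ∀ (d : ℕ) (s : M), rsize s ≤ d → ∀ u v, Agree (n0 + 1 + d) (.x, l) u v →
      s * ev f u = s * ev f v := by
  intro d
  induction d with
  | zero =>
    intro s hs
    have : 0 < rsize s := (Set.ncard_pos (Set.toFinite _)).2 ⟨_, 1, rfl⟩
    omega
  | succ d ih =>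
    intro s hs u v huv
    replace huv : Agree (n0 + 1 + d + 1) _ _ _ := huv
    rcases h.first_drop f s u with hu | ⟨p, a, r, rfl, hap, hp, hd⟩
    · exact (hK u v ((huv.x_stay hl).mono (by omega))).mul_eq hu
    · obtain ⟨p', r', hap', rfl, hr, hpp⟩ := huv.x_first hl hap rfl
      -- The prefix `p` stays in the 𝓡-class of `s`, where `∼_K` means equality. The letter `a` then
      -- shrinks the right ideal, which pays for the round.
      have e1 : s * ev f p = s * ev f p' := (hK p p' (hpp.mono (by omega))).mul_eq hp
      have hlt : rsize (s * ev f p * f a) < rsize s := by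
        have h1 : ¬ GreenR (s * ev f p * f a) (s * ev f p) := fun hh => hd (hh.trans hp)
        exact hp.rsize_eq ▸ rsize_mul_lt h1
      have e2 := ih (s * ev f p * f a) (by omega) r r' hr
      simp only [ev_append, ev_cons]
      rw [← mul_assoc, ← mul_assoc, e2, ← mul_assoc, ← mul_assoc, e1]

/-- The prefix before the first `a` lacks the letter `a`, so its value is known by the hypothesis on
smaller alphabets. Once `u` no longer leaves its 𝓡-class, `v` does not either, having the same
letters. Only 𝓡-equivalence results here; with the dual statement it gives 𝓗-equivalence, hence
equality. -/
theorem DAProp.greenR_of_agree [Finite M] [DecidableEq A] (h : DAProp M) {f : A → M} {n0 k : ℕ}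
    (hK : ∀ L : Finset A, L.card < k → ∀ u v, (∀ c ∈ u, c ∈ L) → Agree n0 (.y, none) u v →
      ev f u = ev f v) (L : Finset A) (hL : L.card ≤ k) :
    ∀ (d : ℕ) (s : M), rsize s ≤ d → ∀ u v, (∀ c ∈ u, c ∈ L) → Agree (n0 + 1 + d) (.x, none) u v →
      GreenR (s * ev f u) (s * ev f v) := by
  intro d
  induction d with
  | zero =>
    intro s hs
    have : 0 < rsize s := (Set.ncard_pos (Set.toFinite _)).2 ⟨_, 1, rfl⟩
    omega
  | succ d ih =>
    intro s hs u v hu huv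
    replace huv : Agree (n0 + 1 + d + 1) _ _ _ := huv
    rcases h.first_drop f s u with h1 | ⟨p, a, r, rfl, hap, hp, hd⟩
    · exact h1.trans (h.greenR_word h1 fun c hc =>
        ((Agree.mem_iff (n := n0 + 1 + d) (by simp) huv c).2 hc)).symm
    · obtain ⟨p', r', hap', rfl, hr, hpp⟩ := huv.x_first (by simp) hap rfl
      have e1 : ev f p = ev f p' := by
        refine hK (L.erase a) ?_ p p' ?_ (hpp.mono (by omega))
        · have := Finset.card_erase_lt_of_mem (hu a (by simp))
          omega
        · intro c hc
          exact Finset.mem_erase.2 ⟨fun hca => hap (hca ▸ hc), hu c (by simp [hc])⟩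
      have hlt : rsize (s * ev f p * f a) < rsize s := by
        have h1 : ¬ GreenR (s * ev f p * f a) (s * ev f p) := fun hh => hd (hh.trans hp)
        exact hp.rsize_eq ▸ rsize_mul_lt h1
      have e2 := ih (s * ev f p * f a) (by omega) r r' (fun c hc => hu c (by simp [hc]))
        hr
      simpa only [ev_append, ev_cons, ← mul_assoc, ← e1] using e2

/-- In a monoid from `DA`, long enough agreement without restriction on the number of changes of
direction implies equality. -/
theorem DAProp.eq_of_agree_top [Finite M] [DecidableEq A] (h : DAProp M) (f : A → M) :
    ∀ k : ℕ, ∃ n, ∀ L : Finset A, L.card ≤ k → ∀ u v, (∀ c ∈ u, c ∈ L) →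
      Agree n (.x, none) u v → ev f u = ev f v := by
  have key : ∀ k : ℕ, (∃ n0, ∀ L : Finset A, L.card < k → ∀ u v, (∀ c ∈ u, c ∈ L) →
      Agree n0 (.x, none) u v → ev f u = ev f v) → ∃ n, ∀ L : Finset A, L.card ≤ k → ∀ u v,
      (∀ c ∈ u, c ∈ L) → Agree n (.x, none) u v → ev f u = ev f v := by
    rintro k ⟨n0, hn0⟩
    -- The two sizes bound the descents from the left and from the right; the constant pays for the
    -- turns between the modes and for comparing letters.
    refine ⟨n0 + 3 + rsize (1 : M) + rsize (1 : Mᵐᵒᵖ), fun L hL u v hu huv => ?_⟩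
    have hR := h.greenR_of_agree (f := f) (n0 := n0 + 1) (fun L hL u v hu huv =>
      hn0 L hL u v hu (huv.y_stay (by simp))) L hL _ 1 le_rfl u v hu (huv.mono (by omega))
    have huv' : Agree (n0 + 2 + rsize (1 : M) + rsize (1 : Mᵐᵒᵖ)) (.x, none) u.reverse v.reverse :=
      agree_reverse.2 (Agree.x_stay (by simp) (huv.mono (by omega)))
    have hL' := h.op.greenR_of_agree (f := fun a => MulOpposite.op (f a)) (n0 := n0)
      (fun L hL u v hu huv => by
        rw [ev_op, ev_op, hn0 L hL u.reverse v.reverse (by simpa using hu) (agree_reverse.2 huv)])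
      L hL _ 1 le_rfl u.reverse v.reverse (by simpa using hu) (huv'.mono (by omega))
    simp only [ev_op, List.reverse_reverse, one_mul] at hR hL'
    exact h.eq_of_greenR_greenL hR (greenL_iff_op.2 hL')
  intro k
  induction k with
  | zero => exact key 0 ⟨0, fun L hL => absurd hL (by simp)⟩
  | succ k ih =>
    obtain ⟨n0, hn0⟩ := ih
    exact key (k + 1) ⟨n0, fun L hL => hn0 L (by omega)⟩

/-! ### Cutting from both sides -/

/-- A relation between words in a context that can be put together from factors, where the factors
of `u` are read from the left without leaving the `𝓡`-class of `s`, and those of `v` are read from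
the right without leaving the `𝓛`-class of `t`. -/
structure Splice (f : A → M) (q : State) (n : ℕ) (C : M → M → List A → List A → Prop) : Prop where
  factor : ∀ s t u v, Agree n q u v → GreenR (s * ev f u) s → GreenL (ev f v * t) t → C s t u v
  comb : ∀ s t u u' a v v', C s (f a * (ev f v' * t)) u u' → C (s * ev f u * f a) t v v' →
    C s t (u ++ a :: v) (u' ++ a :: v')

section

variable [Finite M] {f : A → M} {l : Option ℕ} {n0 : ℕ} {C : M → M → List A → List A → Prop}

/-- Since `u` stays in the 𝓡-class of `s`, only `v` has to be cut, at the last occurrences at which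
it leaves 𝓛-classes when read from the right. -/
theorem Splice.aux_right (hf : Splice f (.w, predLevel l) n0 C) (h : DAProp M)
    (hl : l ≠ some 0) : ∀ (d : ℕ) (s t : M), lsize t ≤ d → ∀ u v,
      Agree (n0 + 1 + d) (.w, l) u v → GreenR (s * ev f u) s → C s t u v := by
  intro d
  induction d with
  | zero =>
    intro s t ht
    have : 0 < lsize t := (Set.ncard_pos (Set.toFinite _)).2 ⟨_, 1, rfl⟩
    omega
  | succ d ih =>
    intro s t ht u v huv hu
    replace huv : Agree (n0 + 1 + d + 1) _ _ _ := huv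
    rcases h.last_drop f t v with hv | ⟨p, b, r, rfl, hbr, hr, hd⟩
    · exact hf.factor s t u v ((huv.w_stay hl).mono (by omega)) hu hv
    · obtain ⟨p', r', hbr', rfl, hpp, hrr⟩ := huv.symm.w_last hl hbr rfl
      simp only [ev_append, ev_cons] at hu
      have hlt : lsize (f b * (ev f r * t)) < lsize t := by
        have h1 : ¬ GreenL (f b * (ev f r * t)) (ev f r * t) := fun hh => hd (hh.trans hr)
        exact hr.lsize_eq ▸ lsize_mul_lt h1
      refine hf.comb _ _ _ _ _ _ _ (ih s _ (by omega) p' p (hpp.symm.mono (by omega))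
        (greenR_of_mul hu)) (hf.factor _ t r' r (hrr.symm.mono (by omega)) ?_ hr)
      have h1 : GreenR (s * (ev f p' * f b)) s :=
        greenR_of_mul (y := ev f r') (by simpa only [mul_assoc] using hu)
      rw [mul_assoc s]
      exact GreenR.trans (by simpa only [mul_assoc] using hu) h1.symm

/-- The right context of the prefix `p'` is the rest of the second word, so the places where that
word leaves 𝓛-classes are located in the word as a whole. Such a place may come after the chosen
`a`, be that `a`, or come before it; the last case is the reason for the cut `ctr`. -/
theorem Splice.aux_left (hf : Splice f (.w, predLevel l) n0 C) (h : DAProp M)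
    (hl : l ≠ some 0) : ∀ (d : ℕ) (s t : M), lsize t ≤ d →
      ∀ (a : A) (p r p' r' : List A), a ∉ p → a ∉ p' →
      Agree (n0 + 2 + d) (.w, l) (p ++ a :: r) (p' ++ a :: r') → GreenR (s * ev f p) s →
      C s (f a * (ev f r' * t)) p p' := by
  intro d
  induction d with
  | zero =>
    intro s t ht
    have : 0 < lsize t := (Set.ncard_pos (Set.toFinite _)).2 ⟨_, 1, rfl⟩
    omega
  | succ d ih =>
    intro s t ht a p r p' r' hp hp' huv hu
    replace huv : Agree (n0 + 2 + d + 1) _ _ _ := huv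
    rcases h.last_drop f t (p' ++ a :: r') with hv | ⟨x, b, y, hxy, hby, hr, hd⟩
    · obtain ⟨p'', r'', hp'', e, -, hpp⟩ := huv.w_first hl hp rfl
      obtain ⟨rfl, rfl⟩ := first_unique hp' hp'' e
      refine hf.factor s _ p p' (hpp.mono (by omega)) hu ?_
      have hv' : GreenL (ev f p' * (f a * ev f r') * t) t := by simpa using hv
      have h2 := greenL_of_mul hv'
      refine GreenL.trans ?_ (GreenL.trans h2.symm ?_)
      · simpa only [mul_assoc] using hv'
      · simp only [mul_assoc]; rfl
    · have hlt : lsize (f b * (ev f y * t)) < lsize t := by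
        have h1 : ¬ GreenL (f b * (ev f y * t)) (ev f y * t) := fun hh => hd (hh.trans hr)
        exact hr.lsize_eq ▸ lsize_mul_lt h1
      obtain ⟨x', y', hby', e, hxx, hyy⟩ := huv.symm.w_last hl hby hxy
      -- The second word leaves the 𝓛-class at `a` itself: this `a` is both a first and a last
      -- occurrence, and what precedes it agrees at the full level.
      have hsame : a = b → p' = x → r' = y → C s (f a * (ev f r' * t)) p p' := by
        rintro rfl rfl rfl
        have hx' : a ∉ x' := by
          rwa [← Agree.mem_iff (n := n0 + 1 + d) hl (hxx.mono (by omega))]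
        obtain ⟨rfl, rfl⟩ := first_unique hp hx' e
        exact hf.aux_right h hl d s _ (by omega) p p' (hxx.symm.mono (by omega)) hu
      rcases List.append_eq_append_iff.1 hxy with ⟨c, hc1, hc2⟩ | ⟨c, hc1, hc2⟩
      · rcases c with _ | ⟨c, z⟩
        · obtain ⟨rfl, rfl⟩ : a = b ∧ r' = y := by simpa using hc2
          exact hsame rfl (by simpa using hc1.symm) rfl
        -- The 𝓛-class is left after the chosen `a`: everything from `b` on moves into the right
        -- context, whose left ideal is smaller.
        · obtain ⟨rfl, rfl⟩ : a = c ∧ r' = z ++ b :: y := by simpa using hc2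
          subst hc1
          have ha : a ∈ x' := by
            rw [← Agree.mem_iff (n := n0 + 1 + d) hl (hxx.mono (by omega))]
            simp
          obtain ⟨p1, r1, hp1, rfl⟩ := exists_first ha
          rw [List.append_assoc, List.cons_append] at e
          obtain ⟨rfl, rfl⟩ := first_unique hp hp1 e
          have := ih s (f b * (ev f y * t)) (by omega) a p r1 p' z hp hp'
            (hxx.symm.mono (by omega)) hu
          simpa only [ev_append, ev_cons, mul_assoc] using this
      · rcases c with _ | ⟨c, z⟩
        · obtain ⟨rfl, rfl⟩ : b = a ∧ y = r' := by simpa using hc2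
          exact hsame rfl (by simpa using hc1) rfl
        -- The 𝓛-class is left before the chosen `a`: the centre between the last `b` and the first
        -- `a` is a factor at the lower level, and the part before `b` needs cuts from the right
        -- only.
        · obtain ⟨rfl, rfl⟩ : b = c ∧ y = z ++ a :: r' := by simpa using hc2
          subst hc1
          simp only [List.mem_append, List.mem_cons, not_or] at hp' hby
          obtain ⟨x2, z2, r2, g1, g2, g3, g4, e', hzz⟩ := huv.symm.w_ctr (a := a) (b := b) (p := x)
            (s := z) (r := r') hl hp'.2.1 hp'.1 hp'.2.2 hby.1 hby.2.2 (by simp)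
          have e'' : x2 ++ b :: (z2 ++ a :: r2) = x' ++ b :: y' := e'.symm.trans e
          obtain ⟨rfl, rfl⟩ := last_unique (by simp [g3, g4, Ne.symm hp'.2.1]) hby' e''
          have e3 : p ++ a :: r = (x2 ++ b :: z2) ++ a :: r2 := by simpa using e'
          obtain ⟨rfl, rfl⟩ := first_unique hp (by simp [g1, g2, hp'.2.1]) e3
          have hlt' : lsize (f b * (ev f z * (f a * (ev f r' * t)))) < lsize t := by
            simpa only [ev_append, ev_cons, mul_assoc] using hlt
          simp only [ev_append, ev_cons] at hu hr
          refine hf.comb _ _ _ _ _ _ _ (hf.aux_right h hl d s _ (by omega) x2 x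
            (hxx.symm.mono (by omega)) (greenR_of_mul hu))
            (hf.factor _ _ z2 z (hzz.symm.mono (by omega)) ?_ ?_)
          · have h1 : GreenR (s * (ev f x2 * f b)) s :=
              greenR_of_mul (y := ev f z2) (by simpa only [mul_assoc] using hu)
            rw [mul_assoc s]
            exact GreenR.trans (by simpa only [mul_assoc] using hu) h1.symm
          · have h2 := greenL_of_mul hr
            refine GreenL.trans ?_ (GreenL.trans h2.symm ?_)
            · simpa only [mul_assoc] using hr
            · simp only [mul_assoc]; rfl

/-- The word `u` is cut where it leaves 𝓡-classes; each piece is then refined from the right by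
`Splice.aux_left`, the last one by `Splice.aux_right`. -/
theorem Splice.aux (hf : Splice f (.w, predLevel l) n0 C) (h : DAProp M) (hl : l ≠ some 0)
    (t : M) : ∀ (d : ℕ) (s : M), rsize s ≤ d → ∀ u v,
      Agree (n0 + 2 + lsize t + d) (.w, l) u v → C s t u v := by
  intro d
  induction d with
  | zero =>
    intro s hs
    have : 0 < rsize s := (Set.ncard_pos (Set.toFinite _)).2 ⟨_, 1, rfl⟩
    omega
  | succ d ih =>
    intro s hs u v huv
    replace huv : Agree (n0 + 2 + lsize t + d + 1) _ _ _ := huv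
    rcases h.first_drop f s u with hu | ⟨p, a, r, rfl, hap, hp, hd⟩
    · exact hf.aux_right h hl _ s t le_rfl u v (huv.mono (by omega)) hu
    · obtain ⟨p', r', hap', rfl, hrr, hpp⟩ := huv.w_first hl hap rfl
      have hlt : rsize (s * ev f p * f a) < rsize s := by
        have h1 : ¬ GreenR (s * ev f p * f a) (s * ev f p) := fun hh => hd (hh.trans hp)
        exact hp.rsize_eq ▸ rsize_mul_lt h1
      exact hf.comb _ _ _ _ _ _ _ (hf.aux_left h hl _ s t le_rfl a p r p' r' hap hap'
        (huv.mono (by omega)) hp) (ih _ (by omega) r r' (hrr.mono (by omega)))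

/-- The relation holds for words that agree for long enough. -/
theorem Splice.of_agree (hf : Splice f (.w, predLevel l) n0 C) (h : DAProp M) (hl : l ≠ some 0)
    {u v : List A} (huv : Agree (n0 + 2 + lsize (1 : M) + rsize (1 : M)) (.w, l) u v) :
    C 1 1 u v :=
  hf.aux h hl 1 _ 1 le_rfl u v huv

end

end Soundness

universe u

-- Change of alphabet and finite index

section Letters

variable {A : Type u}

theorem Cut.exists_letters {k : Op} {a b : A} {u s : List A} (h : Cut k a b u s)
    (hk : k ≠ .stay) : ∃ a' b', a' ∈ u ∧ b' ∈ u ∧ ∀ v t, Cut k a b v t ↔ Cut k a' b' v t := by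
  cases k
  case stay => exact absurd rfl hk
  case ctr =>
    obtain ⟨p, r, -, -, -, -, -, rfl⟩ := h
    exact ⟨a, b, by simp, by simp, fun _ _ => Iff.rfl⟩
  all_goals
    obtain ⟨p, -, rfl⟩ := h
    exact ⟨a, a, by simp, by simp, fun _ _ => Iff.rfl⟩

variable {B : Type*} {g : B → A}

theorem Cut.map (hg : Function.Injective g) {k : Op} {a b : B} {u s : List B}
    (h : Cut k a b u s) : Cut k (g a) (g b) (u.map g) (s.map g) := by
  cases k
  case stay => exact congrArg _ h
  case ctr =>
    obtain ⟨p, r, h0, h1, h2, h3, h4, rfl⟩ := h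
    refine ⟨p.map g, r.map g, hg.ne h0, ?_⟩
    simp [List.mem_map_of_injective hg, h1, h2, h3, h4]
  all_goals
    obtain ⟨p, h1, rfl⟩ := h
    exact ⟨p.map g, by simpa [List.mem_map_of_injective hg] using h1, by simp⟩

theorem Cut.of_map (hg : Function.Injective g) {k : Op} {a b : B} {u : List B} {s' : List A}
    (h : Cut k (g a) (g b) (u.map g) s') : ∃ s, s' = s.map g ∧ Cut k a b u s := by
  cases k
  case stay => exact ⟨u, h, rfl⟩
  case ctr =>
    obtain ⟨p, r, h0, h1, h2, h3, h4, e⟩ := h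
    obtain ⟨p, x, rfl, rfl, e1⟩ := List.map_eq_append_iff.1 e
    obtain ⟨b', x, rfl, hb, e2⟩ := List.map_eq_cons_iff.1 e1
    obtain ⟨s, y, rfl, rfl, e3⟩ := List.map_eq_append_iff.1 e2
    obtain ⟨a', r, rfl, ha, rfl⟩ := List.map_eq_cons_iff.1 e3
    obtain rfl := hg ha
    obtain rfl := hg hb
    simp only [List.mem_map_of_injective hg] at h1 h2 h3 h4
    exact ⟨s, rfl, p, r, fun h => h0 (congrArg g h), h1, h2, h3, h4, rfl⟩
  all_goals
    obtain ⟨p, h1, e⟩ := h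
    obtain ⟨x, y, rfl, rfl, e1⟩ := List.map_eq_append_iff.1 e
    obtain ⟨a', y, rfl, ha, rfl⟩ := List.map_eq_cons_iff.1 e1
    obtain rfl := hg ha
    simp only [List.mem_map_of_injective hg] at h1
    exact ⟨_, rfl, _, h1, rfl⟩

/-- Apart from `stay`, a cut only uses letters of the word, so the ambient alphabet is irrelevant.
This reduces terms over an infinite alphabet to the finitely many letters in them. -/
theorem agree_map_iff (hg : Function.Injective g) : ∀ {n : ℕ} {q : State} {u v : List B},
    Agree n q (u.map g) (v.map g) ↔ Agree n q u v
  | 0, _, _, _ => Iff.rfl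
  | n + 1, q, u, v => by
    have ih := fun q u v => agree_map_iff (n := n) (q := q) (u := u) (v := v) hg
    constructor
    · intro h
      refine agree_succ_of (fun u v => Agree (n + 1) q (u.map g) (v.map g))
        (fun _ _ h => h.symm) ?_ h
      intro u v h k a b q' hq s hs
      obtain ⟨t', ht', hst⟩ := (h k (g a) (g b) q' hq).1 _ (hs.map hg)
      obtain ⟨t, rfl, ht⟩ := ht'.of_map hg
      exact ⟨t, ht, (ih _ _ _).1 hst⟩
    · intro h
      refine agree_succ_of (fun x y => ∃ u v, x = u.map g ∧ y = v.map g ∧ Agree (n + 1) q u v)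
        ?_ ?_ ⟨u, v, rfl, rfl, h⟩
      · rintro _ _ ⟨u, v, rfl, rfl, h⟩
        exact ⟨v, u, rfl, rfl, h.symm⟩
      rintro _ _ ⟨u, v, rfl, rfl, h⟩ k a b q' hq s hs
      by_cases hk : k = .stay
      · subst hk
        obtain rfl : s = u.map g := hs
        refine ⟨_, rfl, (ih _ _ _).2 ?_⟩
        -- If `B` has no letters, `stay` cannot be played over `B`; but then both words are empty.
        rcases u with _ | ⟨c, u⟩
        · rcases v with _ | ⟨c, v⟩
          · exact Agree.refl _ _ _
          · obtain ⟨t, rfl, ht⟩ := (h .stay c c q' hq).1 _ rfl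
            exact ht
        · obtain ⟨t, rfl, ht⟩ := (h .stay c c q' hq).1 _ rfl
          exact ht
      · obtain ⟨a', b', ha, hb, hab⟩ := hs.exists_letters hk
        obtain ⟨a', -, rfl⟩ := List.mem_map.1 ha
        obtain ⟨b', -, rfl⟩ := List.mem_map.1 hb
        obtain ⟨s, rfl, hs'⟩ := ((hab _ _).1 hs).of_map hg
        obtain ⟨t, ht, hst⟩ := (h k a' b' q' hq).1 s hs'
        exact ⟨t.map g, (hab _ _).2 (ht.map hg), (ih _ _ _).2 hst⟩

/-- Over a finite alphabet, `Agree n q` has finite index. -/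
theorem exists_finite_invariant [Finite A] : ∀ (n : ℕ) (q : State),
    ∃ (F : Type u) (_ : Finite F) (sig : List A → F), ∀ u v, sig u = sig v → Agree n q u v
  | 0, _ => ⟨PUnit, inferInstance, fun _ => ⟨⟩, fun _ _ _ => trivial⟩
  | n + 1, q => by
    choose F hF sig hsig using exists_finite_invariant n
    -- The signature lists, for each operation and pair of letters, the signatures of the outcomes.
    -- The default in `getD` concerns illegal operations, which are never played.
    refine ⟨∀ k : Op, (A → A → Set (F ((step q k).getD q))) × F ((step q k).getD q), inferInstance,
      fun u k => (fun a b => {x | ∃ s, Cut k a b u s ∧ sig _ s = x}, sig _ u), ?_⟩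
    intro u v h
    refine agree_succ_of (fun u v => ∀ k : Op, ((fun a b =>
      {x | ∃ s, Cut k a b u s ∧ sig ((step q k).getD q) s = x}), sig ((step q k).getD q) u) =
      ((fun a b => {x | ∃ s, Cut k a b v s ∧ sig ((step q k).getD q) s = x}),
        sig ((step q k).getD q) v)) (fun u v h k => (h k).symm) ?_ (fun k => congrFun h k)
    intro u v h k a b q' hq s hs
    have h1 := congrFun (congrFun (Prod.ext_iff.1 (h k)).1 a) b
    have : sig ((step q k).getD q) s ∈ {x | ∃ s, Cut k a b v s ∧ sig ((step q k).getD q) s = x} := by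
      exact (Set.ext_iff.1 h1 _).1 ⟨s, hs, rfl⟩
    obtain ⟨t, ht, hst⟩ := this
    have := hsig _ _ _ hst.symm
    rw [hq] at this
    exact ⟨t, ht, this⟩

end Letters

-- Quotients of free monoids by agreement

section Quotients

variable {A : Type u}

theorem ev_map {M N : Type*} [Monoid M] [Monoid N] (g : M →* N) (f : A → M) (u : List A) :
    ev (fun a => g (f a)) u = g (ev f u) := by
  simp [ev, map_list_prod]
  rfl

/-- `Agree n q` as a congruence on the free monoid. -/
def conAgree (A : Type*) (n : ℕ) (q : State) : Con (FreeMonoid A) where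
  r u v := Agree n q u.toList v.toList
  iseqv := ⟨fun _ => Agree.refl _ _ _, Agree.symm, Agree.trans⟩
  mul' h h' := by simpa using h.append h'

theorem finite_conAgree [Finite A] (n : ℕ) (q : State) : Finite (conAgree A n q).Quotient := by
  obtain ⟨F, hF, sig, h⟩ := exists_finite_invariant (A := A) n q
  refine Finite.of_injective (β := F) (fun x => sig (Quotient.out x).toList) fun x y hxy => ?_
  have := h _ _ hxy
  rw [← Quotient.out_eq x, ← Quotient.out_eq y]
  exact Quotient.sound this

/-- A finite quotient of a free monoid has a copy in `Type`. -/
theorem exists_quotient (c : Con (FreeMonoid A)) [Finite c.Quotient] :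
    ∃ (M : Type) (_ : Monoid M) (_ : Finite M) (f : A → M), (∀ x, ∃ u, ev f u = x) ∧
      ∀ u v, ev f u = ev f v ↔ c (FreeMonoid.ofList u) (FreeMonoid.ofList v) := by
  let φ : Shrink.{0} c.Quotient ≃* c.Quotient := Shrink.mulEquiv
  have key : ∀ u : List A, ev (fun a => φ.symm (c.mk' (FreeMonoid.of a))) u =
      φ.symm (c.mk' (FreeMonoid.ofList u)) := by
    intro u
    induction u with
    | nil => simp
    | cons a u ih => rw [ev_cons, ih, ← map_mul, ← map_mul]; rfl
  refine ⟨Shrink.{0} c.Quotient, inferInstance, Finite.of_equiv _ φ.symm.toEquiv,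
    fun a => φ.symm (c.mk' (FreeMonoid.of a)), fun x => ?_, fun u v => ?_⟩
  · obtain ⟨u, hu⟩ := c.mk'_surjective (φ x)
    exact ⟨u.toList, by rw [key, FreeMonoid.ofList_toList, hu, MulEquiv.symm_apply_apply]⟩
  · rw [key, key, φ.symm.injective.eq_iff]
    exact Con.eq c

end Quotients

-- Level one: Simon's congruence

section Subwords

variable {A : Type*}

theorem cons_sublist_first {a : A} {p s w : List A} (hp : a ∉ p) :
    (a :: w).Sublist (p ++ a :: s) ↔ w.Sublist s := by
  induction p with
  | nil => simp
  | cons c p ih =>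
    simp only [List.mem_cons, not_or] at hp
    rw [List.cons_append, ← ih hp.2]
    constructor
    · intro h
      rcases List.sublist_cons_iff.1 h with h | ⟨r, hr, -⟩
      · exact h
      · exact absurd (List.cons.inj hr).1 hp.1
    · intro h
      exact h.cons c

theorem concat_sublist_last {a : A} {p s w : List A} (hs : a ∉ s) :
    (w ++ [a]).Sublist (p ++ a :: s) ↔ w.Sublist p := by
  rw [← List.reverse_sublist, ← List.reverse_sublist (l₁ := w)]
  simpa using cons_sublist_first (a := a) (p := s.reverse) (s := p.reverse) (w := w.reverse)
    (by simpa using hs)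

/-- Any change of direction ends at level zero, where everything agrees, so only `xr` counts. It
performs the greedy embedding of a subword: its first letter may be placed at the first occurrence.
-/
theorem agree_one_iff : ∀ {n : ℕ} {u v : List A}, Agree n (.x, some 1) u v ↔
    ∀ w : List A, w.length ≤ n → (w.Sublist u ↔ w.Sublist v)
  | 0, u, v => by
    refine ⟨fun _ w hw => ?_, fun _ => trivial⟩
    obtain rfl : w = [] := List.length_eq_zero_iff.1 (by omega)
    simp
  | n + 1, u, v => by
    have ih := fun u v => agree_one_iff (n := n) (u := u) (v := v)
    constructor
    · have key : ∀ u v : List A, Agree (n + 1) (.x, some 1) u v → ∀ w : List A,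
          w.length ≤ n + 1 → w.Sublist u → w.Sublist v := by
        intro u v h w hw hwu
        rcases w with _ | ⟨a, w⟩
        · simp
        · obtain ⟨p, s, hp, rfl⟩ := exists_first (hwu.subset List.mem_cons_self)
          obtain ⟨p', s', hp', rfl, h1, -⟩ := h.x_first (by simp) hp rfl
          rw [cons_sublist_first hp] at hwu
          rw [cons_sublist_first hp']
          exact ((ih _ _).1 h1 w (by simpa using hw)).1 hwu
      exact fun h w hw => ⟨key u v h w hw, key v u h.symm w hw⟩
    · intro h
      refine agree_x_of (fun u v => ∀ w : List A, w.length ≤ n + 1 → (w.Sublist u ↔ w.Sublist v))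
        (fun u v h w hw => (h w hw).symm) (fun u v _ => agree_level_zero _ _ _ _) ?_ h
      rintro u v h a p s hp rfl
      have ha : a ∈ v := by
        have := (h [a] (by simp)).1 (by simp)
        simpa using this
      obtain ⟨p', s', hp', rfl⟩ := exists_first ha
      refine ⟨p', s', hp', rfl, (ih _ _).2 fun w hw => ?_, agree_level_zero _ _ _ _⟩
      have := h (a :: w) (by simpa using hw)
      rwa [cons_sublist_first hp, cons_sublist_first hp'] at this

theorem agree_one_swap {n : ℕ} {u v : List A} (h : Agree n (.y, some 1) u v) :
    Agree n (.x, some 1) u v := by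
  have h' : Agree n (.x, some 1) u.reverse v.reverse := agree_reverse.2 h
  rw [agree_one_iff] at h' ⊢
  intro w hw
  have := h' w.reverse (by simpa using hw)
  rwa [List.reverse_sublist, List.reverse_sublist] at this

/-- The subword condition is symmetric, which yields the cuts at last occurrences. Whether a centre
exists at `a` and `b` is visible from the subword `a b` and the letters present; its content is
compared at level zero. -/
theorem agree_w_one : ∀ {n : ℕ} {u v : List A}, Agree (n + 1) (.x, some 1) u v →
    Agree n (.w, some 1) u v
  | 0, _, _, _ => trivial
  | n + 1, u, v, h => by
    have ih := fun u v => agree_w_one (n := n) (u := u) (v := v)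
    have mem : ∀ {u v : List A}, Agree (n + 2) (.x, some 1) u v → ∀ a, a ∈ u → a ∈ v :=
      fun h a => (h.mem_iff (by simp) a).1
    refine agree_w_of (Agree (n + 2) (.x, some 1)) (fun _ _ h => h.symm)
      (fun _ _ _ => agree_level_zero _ _ _ _) ?_ ?_ ?_ h
    · intro u v h a p s hp hu
      obtain ⟨p', s', h1, h2, h3, -⟩ := h.x_first (by simp) hp hu
      exact ⟨p', s', h1, h2, ih _ _ h3, agree_level_zero _ _ _ _⟩
    · rintro u v h a p s hs rfl
      obtain ⟨p', s', hs', rfl⟩ := exists_last (mem h a (by simp))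
      refine ⟨p', s', hs', rfl, ih _ _ (agree_one_iff.2 fun w hw => ?_), agree_level_zero _ _ _ _⟩
      have := agree_one_iff.1 h (w ++ [a]) (by simpa using hw)
      rwa [concat_sublist_last hs, concat_sublist_last hs'] at this
    · rintro u v h a b p s r hab h1 h2 h3 h4 rfl
      obtain ⟨p', r', hp', rfl⟩ := exists_first (mem h a (by simp))
      have hb : b ∉ r' := by
        have := agree_one_iff.1 h [a, b] (by simp)
        rw [cons_sublist_first hp',
          show p ++ b :: (s ++ a :: r) = (p ++ b :: s) ++ a :: r by simp,
          cons_sublist_first (by simp [h1, h2, hab])] at this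
        simp only [List.singleton_sublist] at this
        rwa [← this]
      have hb' : b ∈ p' := by
        have := mem h b (by simp)
        simpa [hb, hab.symm] using this
      obtain ⟨p', s', hs', rfl⟩ := exists_last hb'
      simp only [List.mem_append, List.mem_cons, not_or] at hp'
      exact ⟨p', s', r', hp'.1, hp'.2.2, hs', hb, by simp, agree_level_zero _ _ _ _⟩

end Subwords

-- Soundness for the corners

section CornerSound

variable {A : Type*}

/-- In an 𝓡- and 𝓛-trivial monoid, a factor that stays in the 𝓡-class of `s` or the 𝓛-class of `t`
is absorbed by it, so both words of a spliced pair contribute nothing between `s` and `t`. Besides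
`J` this serves `R_2 ∩ L_2`. -/
theorem eq_of_agree_w_one {M : Type*} [Monoid M] [Finite M] (h : DAProp M)
    (hR : ∀ x y : M, GreenR x y → x = y) (hL : ∀ x y : M, GreenL x y → x = y) (f : A → M) :
    ∃ n, ∀ u v, Agree n (.w, some 1) u v → ev f u = ev f v := by
  have hs : Splice f (.w, predLevel (some 1)) 0
      (fun s t u v => s * ev f u * t = s * ev f v * t) := by
    constructor
    · intro s t u v _ hu hv
      rw [hR _ _ hu, mul_assoc s, hL _ _ hv]
    · intro s t u u' a v v' h1 h2
      calc s * ev f (u ++ a :: v) * t = s * ev f u * f a * ev f v * t := by simp [mul_assoc]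
        _ = s * ev f u * (f a * (ev f v' * t)) := by rw [h2]; simp only [mul_assoc]
        _ = s * ev f (u' ++ a :: v') * t := by rw [h1]; simp [mul_assoc]
  refine ⟨0 + 2 + lsize (1 : M) + rsize (1 : M), fun u v huv => ?_⟩
  simpa using hs.of_agree h (by simp) huv

theorem GreenR.greenJ {M : Type*} [Monoid M] {x y : M} (h : GreenR x y) : GreenJ x y := by
  obtain ⟨⟨a, ha⟩, ⟨b, hb⟩⟩ := greenR_iff.1 h
  refine Set.ext fun t => ⟨?_, ?_⟩
  · rintro ⟨⟨p, q⟩, rfl⟩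
    exact ⟨(p, b * q), by simp only [← hb, mul_assoc]⟩
  · rintro ⟨⟨p, q⟩, rfl⟩
    exact ⟨(p, a * q), by simp only [← ha, mul_assoc]⟩

theorem GreenL.greenJ {M : Type*} [Monoid M] {x y : M} (h : GreenL x y) : GreenJ x y := by
  obtain ⟨⟨a, ha⟩, ⟨b, hb⟩⟩ := greenL_iff.1 h
  refine Set.ext fun t => ⟨?_, ?_⟩
  · rintro ⟨⟨p, q⟩, rfl⟩
    exact ⟨(p * b, q), by simp only [← hb, mul_assoc]⟩
  · rintro ⟨⟨p, q⟩, rfl⟩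
    exact ⟨(p * a, q), by simp only [← ha, mul_assoc]⟩

theorem varJ_sound {M : Type} [Monoid M] (h : varJ M) (f : A → M) :
    ∃ n, ∀ u v, Agree n (.x, some 1) u v → ev f u = ev f v := by
  have := h.1
  obtain ⟨n, hn⟩ := eq_of_agree_w_one (varJ_daProp h) (fun x y hxy => h.2 _ _ hxy.greenJ)
    (fun x y hxy => h.2 _ _ hxy.greenJ) f
  exact ⟨n + 1, fun u v huv => hn u v (agree_w_one huv)⟩

/-- In the monoids of the corner `R_m`, words that agree for long enough in the state `(x, m)`
have the same value; dually for `L_m`. -/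
theorem corner_sound : ∀ m : ℕ,
    (∀ (M : Type) [Monoid M], varR (m + 1) M → ∀ f : A → M,
      ∃ n, ∀ u v, Agree n (.x, some (m + 1)) u v → ev f u = ev f v) ∧
    (∀ (M : Type) [Monoid M], varL (m + 1) M → ∀ f : A → M,
      ∃ n, ∀ u v, Agree n (.y, some (m + 1)) u v → ev f u = ev f v)
  | 0 => by
    constructor
    · intro M _ h f
      rw [varR] at h
      exact varJ_sound h f
    · intro M _ h f
      rw [varL] at h
      obtain ⟨n, hn⟩ := varJ_sound h f
      exact ⟨n, fun u v huv => hn u v (agree_one_swap huv)⟩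
  | m + 1 => by
    have ih := corner_sound m
    constructor
    · intro M _ h f
      have hDA := ((finite_daProp_of_corner _).1 M h).2
      rw [varR] at h
      have := h.1
      obtain ⟨n, hn⟩ := ih.2 _ h.2 (fun a => (conK M).mk' (f a))
      refine ⟨n + 1 + rsize (1 : M), fun u v huv => ?_⟩
      have := hDA.eq_of_agree_x (f := f) (l := some (m + 1 + 1)) (by simp) (n0 := n)
        (fun u v huv => by
          have := hn u v huv
          rw [ev_map, ev_map] at this
          exact (Con.eq (conK M)).1 this) _ 1 le_rfl u v huv
      simpa using this
    · intro M _ h f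
      have hDA := ((finite_daProp_of_corner _).2 M h).2
      rw [varL] at h
      have := h.1
      obtain ⟨n, hn⟩ := ih.1 _ h.2 (fun a => (conD M).mk' (f a))
      refine ⟨n + 1 + rsize (1 : Mᵐᵒᵖ), fun u v huv => ?_⟩
      have huv' := huv.reverse
      have := hDA.op.eq_of_agree_x (f := fun a => MulOpposite.op (f a)) (l := some (m + 1 + 1))
        (by simp) (n0 := n)
        (fun u v huv => by
          have := hn u.reverse v.reverse (agree_reverse.2 huv)
          rw [ev_map, ev_map] at this
          rw [ev_op, ev_op]
          exact simD_iff_op.1 ((Con.eq (conD M)).1 this)) _ 1 le_rfl u.reverse v.reverse huv'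
      simpa [ev_op] using this

end CornerSound

-- Completeness for the corners

section CornerComplete

variable {A : Type*}

/-- If `e u z = e`, the idempotent `e` is the value of every positive power of the word `e u z`. A
large power contains all letters of `u` and `v`, hence hides their first occurrences, and
`agree_absorb` lifts agreement from `(y, l - 1)` to `(x, l)`. The level after turning must be
positive for the letters of `v` to be controlled. -/
theorem simK_of_agree {M : Type*} [Monoid M] {f : A → M} (hf : ∀ x, ∃ u, ev f u = x)
    {l : Option ℕ} (hl : predLevel l ≠ some 0) {n : ℕ}
    (h : ∀ u v, Agree n (.x, l) u v → ev f u = ev f v) {u v : List A}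
    (huv : Agree n (.y, predLevel l) u v) : SimK (ev f u) (ev f v) := by
  rcases n with _ | n
  · rw [h u v trivial]
    exact fun _ _ _ => rfl
  have key : ∀ u v : List A, Agree (n + 1) (.y, predLevel l) u v → ∀ e : M, IsIdempotentElem e →
      GreenR (e * ev f u) e → e * ev f u = e * ev f v := by
    intro u v huv e he hu
    obtain ⟨z, hz⟩ := greenR_mul_iff.1 hu
    obtain ⟨e, rfl⟩ := hf e
    obtain ⟨z, rfl⟩ := hf z
    have hmem := huv.mem_iff hl
    have hG : ev f (wpow (n + 2) (e ++ u ++ z)) = ev f e := by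
      rw [ev_wpow, ev_append, ev_append, hz, he.pow_succ_eq]
    have := h _ _ (agree_absorb (G := e ++ u ++ z) l (n + 1) (n + 2) u v (by omega) (by simp_all)
      (by simp_all) huv)
    rwa [ev_append, ev_append, hG] at this
  rintro e he (hu | hv)
  · exact key u v huv e he hu
  · exact (key v u huv.symm e he hv).symm

theorem surjective_ev_op {M : Type*} [Monoid M] {f : A → M} (hf : ∀ x, ∃ u, ev f u = x) :
    ∀ x, ∃ u, ev (fun a => MulOpposite.op (f a)) u = x := by
  intro x
  obtain ⟨u, hu⟩ := hf x.unop
  exact ⟨u.reverse, by rw [ev_op, List.reverse_reverse, hu, MulOpposite.op_unop]⟩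

theorem simD_of_agree {M : Type*} [Monoid M] {f : A → M} (hf : ∀ x, ∃ u, ev f u = x)
    {l : Option ℕ} (hl : predLevel l ≠ some 0) {n : ℕ}
    (h : ∀ u v, Agree n (.y, l) u v → ev f u = ev f v) {u v : List A}
    (huv : Agree n (.x, predLevel l) u v) : SimD (ev f u) (ev f v) := by
  have := simK_of_agree (surjective_ev_op hf) hl (n := n) (fun u v huv => by
    rw [ev_op, ev_op, h _ _ (agree_reverse.2 huv)]) (u := u.reverse) (v := v.reverse) huv.reverse
  rw [ev_op, ev_op, List.reverse_reverse, List.reverse_reverse] at this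
  exact simD_iff_op.2 this

/-- With `x = p y q` and `y = r x s`, the word `G k = (p r)^k x (s q)^k` has the value of `x`. Then
`G (n + 1)` is a subword of `r G (n + 1) s`, which is a subword of `G (n + 2)`; the two ends have
the same short subwords, hence so does the middle. -/
theorem varJ_complete {M : Type} [Monoid M] [Finite M] {f : A → M} (hf : ∀ x, ∃ u, ev f u = x)
    {n : ℕ} (h : ∀ u v, Agree n (.x, some 1) u v → ev f u = ev f v) : varJ M := by
  refine ⟨inferInstance, fun x y hxy => ?_⟩
  obtain ⟨⟨p, q⟩, hx⟩ : x ∈ Set.range (fun p : M × M => p.1 * y * p.2) := by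
    rw [← show _ = _ from hxy]; exact ⟨(1, 1), by simp⟩
  obtain ⟨⟨r, s⟩, hy⟩ : y ∈ Set.range (fun p : M × M => p.1 * x * p.2) := by
    rw [show _ = _ from hxy]; exact ⟨(1, 1), by simp⟩
  obtain ⟨x, rfl⟩ := hf x
  obtain ⟨p, rfl⟩ := hf p
  obtain ⟨q, rfl⟩ := hf q
  obtain ⟨r, rfl⟩ := hf r
  obtain ⟨s, rfl⟩ := hf s
  simp only at hx hy
  have hpx : ∀ k, ev f (wpow k (p ++ r) ++ x ++ wpow k (s ++ q)) = ev f x := by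
    intro k
    simp only [ev_append, ev_wpow]
    induction k with
    | zero => simp
    | succ k ih =>
      calc (ev f p * ev f r) ^ (k + 1) * ev f x * (ev f s * ev f q) ^ (k + 1)
          = (ev f p * ev f r) ^ k * (ev f p * (ev f r * ev f x * ev f s) * ev f q) *
              (ev f s * ev f q) ^ k := by
            rw [pow_succ, pow_succ']; simp only [mul_assoc]
        _ = ev f x := by rw [hy, hx, ih]
  set G := fun k => wpow k (p ++ r) ++ x ++ wpow k (s ++ q) with hG
  have hag : Agree n (.x, some 1) (G (n + 1)) (G (n + 2)) :=
    (((agree_wpow _ n _ _ (by omega) (by omega)).of_top _).append (Agree.refl _ _ _)).append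
      ((agree_wpow _ n _ _ (by omega) (by omega)).of_top _)
  have hag' : Agree n (.x, some 1) (G (n + 1)) (r ++ G (n + 1) ++ s) := by
    rw [agree_one_iff] at hag ⊢
    intro w hw
    constructor
    · intro h1
      exact h1.trans ((List.sublist_append_right r _).trans (List.sublist_append_left _ s))
    · intro h1
      rw [hag w hw]
      have e : G (n + 2) = p ++ (r ++ G (n + 1) ++ s) ++ q := by
        simp only [hG]
        rw [wpow_succ (n + 1) (p ++ r), wpow_succ' (n + 1) (s ++ q)]
        simp only [List.append_assoc]
      rw [e]
      exact h1.trans ((List.sublist_append_right p _).trans (List.sublist_append_left _ q))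
  have hGx : ev f (G (n + 1)) = ev f x := hpx (n + 1)
  have := h _ _ hag'
  have e : ev f (r ++ G (n + 1) ++ s) = ev f r * ev f (G (n + 1)) * ev f s := by
    generalize G (n + 1) = g
    simp [mul_assoc]
  rwa [e, hGx, hy] at this

/-- A finite monoid in which words that agree in the state `(x, m)` have the same value is in
`R_m`; dually for `L_m`. -/
theorem corner_complete (n : ℕ) : ∀ m : ℕ,
    (∀ (M : Type) [Monoid M] [Finite M] (f : A → M), (∀ x, ∃ u, ev f u = x) →
      (∀ u v, Agree n (.x, some (m + 1)) u v → ev f u = ev f v) → varR (m + 1) M) ∧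
    (∀ (M : Type) [Monoid M] [Finite M] (f : A → M), (∀ x, ∃ u, ev f u = x) →
      (∀ u v, Agree n (.y, some (m + 1)) u v → ev f u = ev f v) → varL (m + 1) M)
  | 0 => by
    constructor
    · intro M _ _ f hf h
      rw [varR]
      exact varJ_complete hf h
    · intro M _ _ f hf h
      rw [varL]
      refine varJ_complete hf (n := n) fun u v huv => h u v ?_
      have := agree_reverse.1 (agree_one_swap (agree_reverse (q := (.y, some 1)).2 huv))
      exact this
  | m + 1 => by
    have ih := corner_complete n m
    constructor
    · intro M _ _ f hf h
      rw [varR]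
      refine ⟨inferInstance, ?_⟩
      have : Finite (conK M).Quotient := Finite.of_surjective _ (conK M).mk'_surjective
      refine ih.2 _ (fun a => (conK M).mk' (f a)) (fun x => ?_) (fun u v huv => ?_)
      · obtain ⟨y, rfl⟩ := (conK M).mk'_surjective x
        obtain ⟨u, rfl⟩ := hf y
        exact ⟨u, ev_map _ _ _⟩
      · rw [ev_map, ev_map]
        exact (Con.eq (conK M)).2 (simK_of_agree hf (l := some (m + 1 + 1)) (by simp [predLevel]) h
          huv)
    · intro M _ _ f hf h
      rw [varL]
      refine ⟨inferInstance, ?_⟩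
      have : Finite (conD M).Quotient := Finite.of_surjective _ (conD M).mk'_surjective
      refine ih.1 _ (fun a => (conD M).mk' (f a)) (fun x => ?_) (fun u v huv => ?_)
      · obtain ⟨y, rfl⟩ := (conD M).mk'_surjective x
        obtain ⟨u, rfl⟩ := hf y
        exact ⟨u, ev_map _ _ _⟩
      · rw [ev_map, ev_map]
        exact (Con.eq (conD M)).2 (simD_of_agree hf (l := some (m + 1 + 1)) (by simp [predLevel]) h
          huv)

/-- Agreement without restriction on the level is implied by agreement at a large level. -/
theorem Agree.unlimited : ∀ {n m : ℕ} {d : Mode} {u v : List A}, d ≠ .w → n ≤ m →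
    Agree n (d, some m) u v → Agree n (d, none) u v
  | 0, _, _, _, _, _, _, _ => trivial
  | n + 1, m, d, u, v, hd, hnm, h => by
    refine agree_succ_of (Agree (n + 1) (d, some m)) (fun _ _ h => h.symm) ?_ h
    intro u v h k a b q' hq s hs
    rw [step_ne (by simp), Option.map_eq_some_iff] at hq
    obtain ⟨⟨d', r⟩, h1, rfl⟩ := hq
    have hm : some m ≠ some 0 := by simp; omega
    obtain ⟨t, ht, hst⟩ := (h k a b _ (by rw [step_ne hm, h1]; rfl)).1 s hs
    refine ⟨t, ht, ?_⟩
    have hd' : d' ≠ .w := by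
      cases d <;> cases k <;> simp_all [modeStep] <;> simp [← h1.1]
    cases r
    · exact Agree.unlimited (m := m - 1) hd' (by omega) hst
    · exact Agree.unlimited (m := m) hd' (by omega) hst

end CornerComplete

-- From modes `x` and `y` to mode `w` at one level less

section Windows

variable {A : Type*} {l : Option ℕ}

/-- Agreement in mode `x` is inherited by the factors before the first occurrence of a letter. -/
theorem Agree.before_first (hl : l ≠ some 0) (hl' : predLevel l ≠ some 0) {a : A} :
    ∀ {n : ℕ} {p p' s s' : List A}, a ∉ p → a ∉ p' →
      Agree (n + 2) (.x, l) (p ++ a :: s) (p' ++ a :: s') → Agree n (.x, l) p p'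
  | 0, _, _, _, _, _, _, _ => trivial
  | n + 1, p, p', s, s', hp, hp', h => by
    refine agree_x_of (fun p p' => a ∉ p ∧ a ∉ p' ∧ ∃ s s',
      Agree (n + 3) (.x, l) (p ++ a :: s) (p' ++ a :: s')) ?_ ?_ ?_ ⟨hp, hp', s, s', h⟩
    · rintro p p' ⟨hp, hp', s, s', h⟩
      exact ⟨hp', hp, s', s, h.symm⟩
    all_goals
      rintro p p' ⟨hp, hp', s, s', h⟩
      obtain ⟨p1, s1, hp1, e, -, hy⟩ := h.x_first hl hp rfl
      obtain ⟨rfl, rfl⟩ := first_unique hp' hp1 e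
    · exact hy.mono (by omega)
    · rintro b q t hb rfl
      obtain ⟨q1, t1, hq1, e, ht, hqq⟩ := h.x_first (a := b) (p := q) (s := t ++ a :: s) hl hb
        (by simp)
      have hb' : b ∈ p' := (Agree.mem_iff (n := n + 1) hl' hy b).1 (by simp)
      obtain ⟨q2, t2, hq2, rfl⟩ := exists_first hb'
      rw [List.append_assoc, List.cons_append] at e
      obtain ⟨rfl, rfl⟩ := first_unique hq2 hq1 e
      refine ⟨q2, t2, hq2, rfl, Agree.before_first hl hl' ?_ ?_ ht, hqq.mono (by omega)⟩
      · exact fun h => hp (by simp [h])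
      · exact fun h => hp' (by simp [h])

theorem Agree.after_last (hl : l ≠ some 0) (hl' : predLevel l ≠ some 0) {a : A}
    {n : ℕ} {p p' s s' : List A} (hs : a ∉ s) (hs' : a ∉ s')
    (h : Agree (n + 2) (.y, l) (p ++ a :: s) (p' ++ a :: s')) : Agree n (.y, l) s s' := by
  have := (Agree.before_first (a := a) (p := s.reverse) (p' := s'.reverse) (s := p.reverse)
    (s' := p'.reverse) hl hl' (by simpa using hs) (by simpa using hs')
    (by simpa [State.dual, Mode.dual] using h.reverse)).reverse
  simpa [State.dual, Mode.dual] using this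

/-- `LastPath j U V u v`: the words `u` and `v` result from `U` and `V` by going `j` times to the
factor before the last occurrence of a letter, each time of the same letter in both words. -/
inductive LastPath : ℕ → List A → List A → List A → List A → Prop
  | refl (U V : List A) : LastPath 0 U V U V
  | cut {j : ℕ} {U V p p' s s' : List A} {b : A} : LastPath j U V (p ++ b :: s) (p' ++ b :: s') →
      b ∉ s → b ∉ s' → LastPath (j + 1) U V p p'

theorem LastPath.agree {j : ℕ} {U V u v : List A} (h : LastPath j U V u v) (hl : l ≠ some 0) :
    ∀ {n : ℕ}, Agree (n + j) (.y, l) U V → Agree n (.y, l) u v := by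
  induction h with
  | refl U V => exact fun h => h
  | @cut j U V p p' s s' b _ hs hs' ih =>
    intro n h
    obtain ⟨p1, s1, hs1, e, hp, -⟩ := (ih (n := n + 1) (by rwa [add_right_comm])).y_last hl hs rfl
    obtain ⟨rfl, rfl⟩ := last_unique hs' hs1 e
    exact hp

/-- Going left repeatedly yields prefixes, so a cut position of `u` is one of `U`, and the later
cuts only affect what lies to its right. -/
theorem LastPath.split {j : ℕ} {U V u v : List A} (h : LastPath j U V u v) {a : A} :
    ∀ {p p' s s' : List A}, u = p ++ a :: s → v = p' ++ a :: s' →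
      ∃ U2 V2, U = p ++ a :: U2 ∧ V = p' ++ a :: V2 ∧ LastPath j U2 V2 s s' := by
  induction h with
  | refl U V => exact fun hu hv => ⟨_, _, hu, hv, .refl _ _⟩
  | @cut j U V q q' t t' b _ ht ht' ih =>
    rintro p p' s s' rfl rfl
    obtain ⟨U2, V2, h1, h2, h3⟩ := ih (p := p) (p' := p') (s := s ++ b :: t) (s' := s' ++ b :: t')
      (by simp) (by simp)
    exact ⟨U2, V2, h1, h2, h3.cut ht ht'⟩

/-- Agreement at level `m + 1` in mode `x` implies agreement at level `m` in mode `w`. -/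
theorem exists_agree_w (A : Type*) : ∀ m n : ℕ, ∃ N, ∀ u v : List A,
    Agree N (.x, some (m + 1)) u v → Agree n (.w, some m) u v
  | 0, n => ⟨0, fun _ _ _ => agree_level_zero _ _ _ _⟩
  | m + 1, n => by
    choose f hf using exists_agree_w A m
    have hf' : ∀ n (u v : List A), Agree (f n) (.y, some (m + 1)) u v → Agree n (.w, some m) u v :=
      fun n u v h => by
        have := (hf n _ _ (by simpa [State.dual, Mode.dual] using h.reverse)).reverse
        simpa [State.dual, Mode.dual] using this
    have hlast : ∀ n (a : A) p p' s s', a ∉ s → a ∉ s' →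
        Agree (f n + 2) (.y, some (m + 1)) (p ++ a :: s) (p' ++ a :: s') →
        Agree n (.w, some m) s s' := by
      intro n a p p' s s' hs hs' h
      rcases m with _ | m
      · exact agree_level_zero _ _ _ _
      · exact hf' _ _ _ (h.after_last (by simp) (by simp [predLevel]) hs hs')
    -- Mode `x` has no free cut at last occurrences. The words reached by such cuts are therefore
    -- remembered as ends of a path from words `U`, `V` that still agree at the higher level.
    -- First-occurrence cuts are made in `U` and `V`. The summand `j` pays for replaying the path in
    -- mode `y`.
    suffices key : ∃ N, ∀ j (U V u v : List A), Agree (N + j) (.x, some (m + 2)) U V →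
        LastPath j U V u v → Agree n (.w, some (m + 1)) u v by
      obtain ⟨N, hN⟩ := key
      exact ⟨N, fun u v h => hN 0 u v u v h (.refl u v)⟩
    induction n with
    | zero => exact ⟨0, fun _ _ _ _ _ _ _ => trivial⟩
    | succ n ih =>
      obtain ⟨N, hN⟩ := ih
      refine ⟨N + f n + 4, fun j U V u v h hp => ?_⟩
      have hy : ∀ {j} {U V u v : List A}, Agree (N + f n + 4 + j) (.x, some (m + 2)) U V →
          LastPath j U V u v → Agree (N + f n + 3) (.y, some (m + 1)) u v := fun {j} _ _ _ _ h hp =>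
        hp.agree (by simp) (Agree.x_stay (l := some (m + 2)) (by simp) (by
          rwa [show N + f n + 3 + j + 1 = N + f n + 4 + j by omega]))
      have hfirst : ∀ {j} {U V u v : List A}, Agree (N + f n + 4 + j) (.x, some (m + 2)) U V →
          LastPath j U V u v → ∀ (a : A) p s, a ∉ p → u = p ++ a :: s → ∃ p' s' U2 V2, a ∉ p' ∧
            v = p' ++ a :: s' ∧ Agree (N + f n + 3 + j) (.x, some (m + 2)) U2 V2 ∧
            LastPath j U2 V2 s s' ∧ Agree (N + f n + 3 + j) (.y, some (m + 1)) p p' := by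
        rintro j U V u v h hp a p s ha rfl
        obtain ⟨p', s', ha', rfl⟩ :=
          exists_first (((hy h hp).mem_iff (by simp) a).1 (by simp))
        obtain ⟨U2, V2, rfl, rfl, hp2⟩ := hp.split rfl rfl
        obtain ⟨p1, s1, hp1, e, hs, hpp⟩ := Agree.x_first (n := N + f n + 3 + j)
          (l := some (m + 2)) (by simp) (by rwa [show N + f n + 3 + j + 1 = N + f n + 4 + j by omega])
          ha rfl
        obtain ⟨rfl, rfl⟩ := first_unique ha' hp1 e
        exact ⟨p', s', U2, V2, ha', rfl, hs, hp2, hpp⟩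
      refine agree_w_of (fun u v => ∃ j U V, Agree (N + f n + 4 + j) (.x, some (m + 2)) U V ∧
        LastPath j U V u v) ?_ ?_ ?_ ?_ ?_ ⟨j, U, V, h, hp⟩
      · rintro u v ⟨j, U, V, h, hp⟩
        refine ⟨j, V, U, h.symm, ?_⟩
        clear h
        induction hp with
        | refl U V => exact .refl V U
        | cut _ h1 h2 ih => exact ih.cut h2 h1
      · rintro u v ⟨j, U, V, h, hp⟩
        exact hf' n _ _ ((hy h hp).mono (by omega))
      · rintro u v ⟨j, U, V, h, hp⟩ a p s ha hu
        obtain ⟨p', s', U2, V2, ha', hv, hU, hp2, hpp⟩ := hfirst h hp a p s ha hu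
        exact ⟨p', s', ha', hv, hN j U2 V2 s s' (hU.mono (by omega)) hp2,
          hf' n _ _ (hpp.mono (by omega))⟩
      · rintro u v ⟨j, U, V, h, hp⟩ a p s ha rfl
        obtain ⟨p', s', ha', rfl⟩ := exists_last (((hy h hp).mem_iff (by simp) a).1 (by simp))
        exact ⟨p', s', ha', rfl, hN (j + 1) U V p p' (h.mono (by omega)) (hp.cut ha ha'),
          hlast n a p p' s s' ha ha' ((hy h hp).mono (by omega))⟩
      · rintro u v ⟨j, U, V, h, hp⟩ a b p s r hab h1 h2 h3 h4 hu
        obtain ⟨q, r', U2, V2, ha', rfl, hU, hp2, hpp⟩ := hfirst h hp a (p ++ b :: s) r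
          (by simp [h1, h2, hab]) (by simp [hu])
        obtain ⟨p', s', hb', rfl⟩ := exists_last
          (((hpp.mono (show N + f n + 3 ≤ _ by omega)).mem_iff (by simp) b).1 (by simp))
        -- Comparing the letters after the first `a` shows that the last `b` before it is the last
        -- one overall.
        have hr : Agree (N + f n + 2) (.y, some (m + 1)) r r' :=
          hp2.agree (by simp) (Agree.x_stay (l := some (m + 2)) (by simp) (by
            rwa [show N + f n + 2 + j + 1 = N + f n + 3 + j by omega]))
        simp only [List.mem_append, List.mem_cons, not_or] at ha'
        exact ⟨p', s', r', ha'.1, ha'.2.2, hb', fun hb => h4 ((hr.mem_iff (by simp) b).2 hb),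
          by simp, hlast n b p p' s s' h3 hb' (hpp.mono (by omega))⟩

theorem exists_agree_w' (A : Type*) (m n : ℕ) : ∃ N, ∀ u v : List A,
    Agree N (.y, some (m + 1)) u v → Agree n (.w, some m) u v := by
  obtain ⟨N, hN⟩ := exists_agree_w A m n
  refine ⟨N, fun u v h => ?_⟩
  have := (hN _ _ (by simpa [State.dual, Mode.dual] using h.reverse)).reverse
  simpa [State.dual, Mode.dual] using this

end Windows

-- Letters that stabilize a context, recognized by short subwords

section Stability

variable {A : Type*} {M : Type*} [Monoid M] [Finite M] {f : A → M}

theorem DAProp.greenR_of_letters (h : DAProp M) {s : M} {v : List A}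
    (hv : ∀ c ∈ v, GreenR (s * f c) s) : GreenR (s * ev f v) s := by
  induction v using List.reverseRecOn with
  | nil => simp [GreenR]
  | append_singleton v c ih =>
    have ih := ih fun d hd => hv d (by simp [hd])
    have := (h.greenR_letter (f := f) (u := [c]) (c := c) (by simpa using hv c (by simp)) (by simp)
      ih).trans ih
    simpa [mul_assoc] using this

theorem DAProp.greenL_of_letters (h : DAProp M) {t : M} {v : List A}
    (hv : ∀ c ∈ v, GreenL (f c * t) t) : GreenL (ev f v * t) t := by
  have := h.op.greenR_of_letters (f := fun a => MulOpposite.op (f a)) (s := MulOpposite.op t)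
    (v := v.reverse) fun c hc => by
      rw [← MulOpposite.op_mul]
      exact greenL_iff_op.1 (hv c (by simpa using hc))
  rw [ev_op, List.reverse_reverse, ← MulOpposite.op_mul] at this
  exact greenL_iff_op.2 this

theorem concat_sublist_concat {c d : A} {w p : List A} (h : (w ++ [c]).Sublist (p ++ [d])) :
    w.Sublist p ∧ (c ≠ d → (w ++ [c]).Sublist p) := by
  have h' : (c :: w.reverse).Sublist (d :: p.reverse) := by simpa using h.reverse
  refine ⟨by simpa using h'.tail, fun hcd => ?_⟩
  rcases List.sublist_cons_iff.1 h' with h1 | ⟨r, hr, -⟩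
  · simpa using h1.reverse
  · exact absurd (List.cons.inj hr).1 hcd

/-- If the letter `c` leads out of the `𝓡`-class that is reached after the word `P`, then this is
witnessed by a short subword. -/
theorem DAProp.exists_sublist (h : DAProp M) : ∀ {P : List A} {c : A},
    ¬ GreenR (ev f P * f c) (ev f P) → ∃ p : List A, p.Sublist P ∧ ¬ (p ++ [c]).Sublist P ∧
      p.length + rsize (ev f P) ≤ rsize (1 : M) := by
  intro P
  induction P using List.reverseRecOn with
  | nil => exact fun _ => ⟨[], by simp, by simp, by simp⟩
  | append_singleton P d ih =>
    intro c hc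
    have e : ev f (P ++ [d]) = ev f P * f d := by simp
    rw [e] at hc ⊢
    by_cases hd : GreenR (ev f P * f d) (ev f P)
    · have hPc : ¬ GreenR (ev f P * f c) (ev f P) := fun hPc =>
        hc (h.greenR_letter (f := f) (u := [c]) (c := c) (by simpa using hPc) (by simp) hd)
      obtain ⟨p, h1, h2, h3⟩ := ih hPc
      refine ⟨p, h1.trans (List.sublist_append_left _ _), fun h4 => ?_, by rwa [hd.rsize_eq]⟩
      refine h2 ((concat_sublist_concat h4).2 ?_)
      rintro rfl
      exact hPc hd
    -- The letter `d` leaves the 𝓡-class itself: it is appended to its own witness, and the drop of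
    -- the right ideal pays for the extra length.
    · obtain ⟨p, h1, h2, h3⟩ := ih hd
      refine ⟨p ++ [d], h1.append (List.Sublist.refl _), fun h4 => h2 (concat_sublist_concat h4).1,
        ?_⟩
      have := rsize_mul_lt hd
      simp only [List.length_append, List.length_singleton]
      omega

theorem DAProp.greenR_of_sublists (h : DAProp M) {k : ℕ} (hk : rsize (1 : M) ≤ k) {P : List A}
    {c : A} (hP : ∀ w : List A, w.length ≤ k → (w.Sublist (P ++ [c]) ↔ w.Sublist P)) :
    GreenR (ev f P * f c) (ev f P) := by
  by_contra hc
  obtain ⟨p, h1, h2, h3⟩ := h.exists_sublist hc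
  have : 0 < rsize (ev f P) := (Set.ncard_pos (Set.toFinite _)).2 ⟨_, 1, rfl⟩
  exact h2 ((hP _ (by simp only [List.length_append, List.length_singleton]; omega)).1
    (h1.append (List.Sublist.refl _)))

theorem DAProp.greenL_of_sublists (h : DAProp M) {k : ℕ} (hk : rsize (1 : Mᵐᵒᵖ) ≤ k) {Q : List A}
    {c : A} (hQ : ∀ w : List A, w.length ≤ k → (w.Sublist (c :: Q) ↔ w.Sublist Q)) :
    GreenL (f c * ev f Q) (ev f Q) := by
  have := h.op.greenR_of_sublists (f := fun a => MulOpposite.op (f a)) hk (P := Q.reverse) (c := c)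
    fun w hw => by
      have := hQ w.reverse (by simpa using hw)
      rw [← List.reverse_sublist, ← List.reverse_sublist (l₁ := w.reverse)] at this
      simpa using this
  rw [ev_op, List.reverse_reverse, ← MulOpposite.op_mul] at this
  exact greenL_iff_op.2 this

end Stability

-- Agreement in mode `w` and the join of the two congruences

section Link

/-- The join of the congruences `Agree k (x, m)` and `Agree k (y, m)`. -/
def conLink (A : Type*) (k m : ℕ) : Con (FreeMonoid A) where
  r := Relation.ReflTransGen fun u v => Agree k (.x, some m) u.toList v.toList ∨
    Agree k (.y, some m) u.toList v.toList
  iseqv := by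
    refine ⟨fun _ => .refl, fun h => ?_, Relation.ReflTransGen.trans⟩
    have : Std.Symm (fun u v : FreeMonoid A => Agree k (.x, some m) u.toList v.toList ∨
        Agree k (.y, some m) u.toList v.toList) :=
      ⟨fun u v h => h.imp Agree.symm Agree.symm⟩
    exact Relation.ReflTransGen.stdSymm.symm _ _ h
  mul' := by
    intro a b c d h h'
    refine Relation.ReflTransGen.trans (b := b * c) (h.lift (· * c) fun u v h => ?_)
      (h'.lift (b * ·) fun u v h => ?_)
    · exact h.imp (fun h => by simpa using h.append_right _) (fun h => by simpa using h.append_right _)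
    · exact h.imp (fun h => by simpa using h.append_left _) (fun h => by simpa using h.append_left _)

theorem finite_conLink (A : Type*) [Finite A] (k m : ℕ) : Finite (conLink A k m).Quotient := by
  have := finite_conAgree (A := A) k (.x, some m)
  refine Finite.of_surjective (Con.map (conAgree A k (.x, some m)) (conLink A k m)
    fun u v h => Relation.ReflTransGen.single (Or.inl h)) fun x => ?_
  obtain ⟨u, rfl⟩ := (conLink A k m).mk'_surjective x
  exact ⟨(conAgree A k (.x, some m)).mk' u, rfl⟩

/-- This is 𝓡-triviality of the monoids in `R_2`. For `x = x p q` and `E = (p q)^N`, the elements `E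
p` and `E` are 𝓡-equivalent, hence equal in the 𝓙-trivial quotient; `∼_K`, tested at `E`, gives `E p
= E`, and `x` absorbs `E`. -/
theorem eq_of_greenR_of_conK {M : Type} [Monoid M] [Finite M] (h : varJ (conK M).Quotient)
    {x y : M} (hxy : GreenR x y) : x = y := by
  obtain ⟨⟨p, rfl⟩, ⟨q, hq⟩⟩ := greenR_iff.1 hxy
  obtain ⟨N, hN, hid⟩ := exists_isIdempotentElem_pow M
  have hx : ∀ k, x * (p * q) ^ k = x := by
    intro k
    induction k with
    | zero => simp
    | succ k ih => rw [pow_succ, ← mul_assoc, ih, ← mul_assoc, hq]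
  have hs : SimK ((p * q) ^ N * p) ((p * q) ^ N) := by
    refine (Con.eq (conK M)).1 (h.2 _ _ (GreenR.greenJ (greenR_iff.2 ⟨⟨(conK M).mk'
      (q * (p * q) ^ (N - 1)), ?_⟩, ⟨(conK M).mk' p, ?_⟩⟩)))
    · refine (map_mul (conK M).mk' _ _).symm.trans (congrArg _ ?_)
      rw [mul_assoc, ← mul_assoc p, mul_pow_sub_one hN.ne', (hid (p * q)).eq]
    · exact (map_mul (conK M).mk' _ _).symm
  have := hs _ (hid (p * q)) (Or.inr (by rw [(hid _).eq]; rfl))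
  rw [← mul_assoc, (hid _).eq] at this
  rw [← hx N, mul_assoc, this]

theorem eq_of_greenL_of_conD {M : Type} [Monoid M] [Finite M] (h : varJ (conD M).Quotient)
    {x y : M} (hxy : GreenL x y) : x = y := by
  obtain ⟨⟨p, rfl⟩, ⟨q, hq⟩⟩ := greenL_iff.1 hxy
  obtain ⟨N, hN, hid⟩ := exists_isIdempotentElem_pow M
  have hx : ∀ k, (q * p) ^ k * x = x := by
    intro k
    induction k with
    | zero => simp
    | succ k ih => rw [pow_succ, mul_assoc, mul_assoc, hq, ih]
  have hs : SimD (p * (q * p) ^ N) ((q * p) ^ N) := by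
    refine (Con.eq (conD M)).1 (h.2 _ _ (GreenL.greenJ (greenL_iff.2 ⟨⟨(conD M).mk'
      ((q * p) ^ (N - 1) * q), ?_⟩, ⟨(conD M).mk' p, ?_⟩⟩)))
    · refine (map_mul (conD M).mk' _ _).symm.trans (congrArg _ ?_)
      rw [← mul_assoc, mul_assoc _ q, pow_pred_mul hN, (hid (q * p)).eq]
    · exact (map_mul (conD M).mk' _ _).symm
  have := hs _ (hid (q * p)) (Or.inr (by rw [(hid _).eq]; rfl))
  rw [mul_assoc, (hid _).eq] at this
  rw [← hx N, ← mul_assoc, this]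

/-- Agreement at level `m` in mode `w` is finer than any of the congruences `conLink A k (m + 1)`. -/
theorem exists_link (A : Type u) [Finite A] : ∀ m k : ℕ, ∃ n, ∀ u v : List A,
    Agree n (.w, some (m + 1)) u v → conLink A k (m + 2) (FreeMonoid.ofList u)
      (FreeMonoid.ofList v) := by
  intro m
  induction m using Nat.strong_induction_on with | _ m ih
  intro k
  have := finite_conLink A k (m + 2)
  obtain ⟨M, _, _, f, hf, hM⟩ := exists_quotient (conLink A k (m + 2))
  simp only [← hM]
  have hx : ∀ u v, Agree k (.x, some (m + 2)) u v → ev f u = ev f v := fun u v h =>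
    (hM u v).2 (Relation.ReflTransGen.single (Or.inl h))
  have hy : ∀ u v, Agree k (.y, some (m + 2)) u v → ev f u = ev f v := fun u v h =>
    (hM u v).2 (Relation.ReflTransGen.single (Or.inr h))
  have hR := (corner_complete k (m + 1)).1 M f hf hx
  have hL := (corner_complete k (m + 1)).2 M f hf hy
  have hDA := ((finite_daProp_of_corner _).1 M hR).2
  rcases m with _ | m
  -- At the lowest level `M` lies in `R_2 ∩ L_2`, so it is 𝓡- and 𝓛-trivial.
  · rw [varR, malcevK, varL] at hR
    rw [varL, malcevD, varR] at hL
    exact eq_of_agree_w_one hDA (fun _ _ h => eq_of_greenR_of_conK hR.2 h)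
      (fun _ _ h => eq_of_greenL_of_conD hL.2 h) f
  -- One round more than `k`, so that every link of the chain preserves the set of letters.
  obtain ⟨n0, hn0⟩ := ih m (by omega) (k + 1)
  -- Subwords up to length `K` of a context decide which letters it absorbs in `M`. The 𝓙-trivial
  -- monoid `M'` records these subwords and steers the cutting, while values are compared in `M`.
  set K := rsize (1 : M) + rsize (1 : Mᵐᵒᵖ) with hK
  have := finite_conAgree (A := A) K (.x, some 1)
  obtain ⟨M', _, _, f', hf', hM'⟩ := exists_quotient (conAgree A K (.x, some 1))
  have hJ : varJ M' := varJ_complete hf' fun u v h => (hM' u v).2 h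
  have hs : Splice f' (.w, predLevel (some (m + 1 + 1))) (n0 + 1) (fun s t u v =>
      ∀ P Q, ev f' P = s → ev f' Q = t → ev f (P ++ u ++ Q) = ev f (P ++ v ++ Q)) := by
    constructor
    · rintro _ _ u v huv hu hv P Q rfl rfl
      have hmem : ∀ c, c ∈ u ↔ c ∈ v := huv.mem_iff (by simp [predLevel])
      have hP : ∀ c ∈ u, GreenR (ev f P * f c) (ev f P) := by
        intro c hc
        have := hJ.2 _ _ ((varJ_daProp hJ).greenR_letter hu hc rfl).greenJ
        have e : ev f' (P ++ [c]) = ev f' P := by simpa using this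
        exact hDA.greenR_of_sublists (k := K) (by omega) (agree_one_iff.1 ((hM' _ _).1 e))
      have hQ : ∀ c ∈ u, GreenL (f c * ev f Q) (ev f Q) := by
        intro c hc
        have := hJ.2 _ _ ((varJ_daProp hJ).greenL_word (v := [c]) hv
          (by simpa using (hmem c).1 hc)).greenJ
        have e : ev f' (c :: Q) = ev f' Q := by simpa using this
        exact hDA.greenL_of_sublists (k := K) (by omega) (agree_one_iff.1 ((hM' _ _).1 e))
      have hchain := hn0 u v huv.of_succ
      suffices h : ∀ w, Relation.ReflTransGen (fun u v : FreeMonoid A =>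
          Agree (k + 1) (.x, some (m + 2)) u.toList v.toList ∨
          Agree (k + 1) (.y, some (m + 2)) u.toList v.toList) (FreeMonoid.ofList u) w →
          (∀ c ∈ w.toList, c ∈ u) ∧ ev f (P ++ u ++ Q) = ev f (P ++ w.toList ++ Q) from
        (h _ hchain).2
      intro w hw
      induction hw with
      | refl => exact ⟨fun c hc => hc, rfl⟩
      | @tail w w' _ hww ih =>
        obtain ⟨ih1, ih2⟩ := ih
        have hmem' : ∀ c, c ∈ w.toList ↔ c ∈ w'.toList := by
          rcases hww with h | h <;> exact h.mem_iff (by simp)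
        refine ⟨fun c hc => ih1 c ((hmem' c).2 hc), ih2.trans ?_⟩
        simp only [ev_append]
        -- A link in mode `x` gives `∼_D`, which becomes equality next to the right context `Q`; a
        -- link in mode `y` gives `∼_K`, which becomes equality next to the left context `P`.
        rcases hww with h | h
        · have := simD_of_agree hf (l := some (m + 1 + 2)) (by simp [predLevel]) hy h.of_succ
          rw [mul_assoc, this.mul_eq (hDA.greenL_of_letters fun c hc => hQ c (ih1 c hc)),
            mul_assoc]
        · have := simK_of_agree hf (l := some (m + 1 + 2)) (by simp [predLevel]) hx h.of_succ
          rw [this.mul_eq (hDA.greenR_of_letters fun c hc => hP c (ih1 c hc))]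
    · rintro _ _ u u' a v v' h1 h2 P Q rfl rfl
      have e1 := h1 P (a :: v' ++ Q) rfl (by simp)
      have e2 := h2 (P ++ u ++ [a]) Q (by simp [mul_assoc]) rfl
      simp only [List.append_assoc, List.cons_append, List.nil_append] at e1 e2 ⊢
      exact e2.trans e1
  refine ⟨n0 + 1 + 2 + lsize (1 : M') + rsize (1 : M'), fun u v huv => ?_⟩
  simpa using hs.of_agree (varJ_daProp hJ) (by simp) huv [] [] (by simp) (by simp)

end Link

-- `π`-terms and their values in finite monoids

section Terms

variable {A : Type u}

/-- The word that results from a `π`-term by substituting `n` for the formal exponents. -/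
def PiTerm.word (n : ℕ) : PiTerm A → List A
  | .eps => []
  | .letter a => [a]
  | .concat α β => α.word n ++ β.word n
  | .pow γ => wpow n (γ.word n)

def PiTerm.letters : PiTerm A → List A
  | .eps => []
  | .letter a => [a]
  | .concat α β => α.letters ++ β.letters
  | .pow γ => γ.letters

theorem PiTerm.mem_letters {n : ℕ} {c : A} : ∀ {α : PiTerm A}, c ∈ α.word n → c ∈ α.letters
  | .eps, h => h
  | .letter _, h => h
  | .concat α β, h => by
    rcases List.mem_append.1 h with h | h
    · exact List.mem_append_left _ (mem_letters h)
    · exact List.mem_append_right _ (mem_letters h)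
  | .pow γ, h => mem_letters (α := γ) (mem_wpow.1 h).2

theorem PiTerm.map_subst {M : Type*} [Monoid M] (σ : FreeMonoid A →* M) (n : ℕ) : ∀ α : PiTerm A,
    σ (α.subst n) = ev (fun a => σ (FreeMonoid.of a)) (α.word n)
  | .eps => by simp [subst, word]
  | .letter a => by simp [subst, word]
  | .concat α β => by simp [subst, word, map_subst σ n α, map_subst σ n β]
  | .pow γ => by simp [subst, word, map_subst σ n γ, ev_wpow]

theorem Agree.wpow {n : ℕ} {q : State} {u v : List A} (h : Agree n q u v) (N : ℕ) :
    Agree n q (wpow N u) (wpow N v) := by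
  induction N with
  | zero => exact Agree.refl _ _ _
  | succ N ih => exact h.append ih

theorem PiTerm.agree_word {n N N' : ℕ} (hN : n < N) (hN' : n < N') : ∀ α : PiTerm A,
    Agree n (.w, none) (α.word N) (α.word N')
  | .eps => Agree.refl _ _ _
  | .letter _ => Agree.refl _ _ _
  | .concat α β => (agree_word hN hN' α).append (agree_word hN hN' β)
  | .pow γ => (agree_wpow _ n N N' hN hN').trans ((agree_word hN hN' γ).wpow N')

/-- `N` can be used in the place of the exponent of `M`. -/
def IsExponent (M : Type*) [Monoid M] (N : ℕ) : Prop :=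
  0 < N ∧ ∀ x : M, IsIdempotentElem (x ^ N)

theorem isExponent_exponent (M : Type*) [Monoid M] [Finite M] : IsExponent M (exponent M) :=
  Nat.sInf_mem (exists_isIdempotentElem_pow M)

theorem IsExponent.pow_eq {M : Type*} [Monoid M] {N N' : ℕ} (h : IsExponent M N)
    (h' : IsExponent M N') (x : M) : x ^ N = x ^ N' := by
  have e1 : x ^ (N * N') = x ^ N := by
    rw [pow_mul, (h.2 x).pow_eq h'.1.ne']
  have e2 : x ^ (N * N') = x ^ N' := by
    rw [mul_comm, pow_mul, (h'.2 x).pow_eq h.1.ne']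
  rw [← e1, e2]

theorem IsExponent.mul {M : Type*} [Monoid M] {N : ℕ} (h : IsExponent M N) (k : ℕ) :
    IsExponent M (N * (k + 1)) :=
  ⟨Nat.mul_pos h.1 k.succ_pos, fun x => by rw [pow_mul, (h.2 x).pow_succ_eq]; exact h.2 x⟩

theorem IsExponent.of_surjective {M N : Type*} [Monoid M] [Monoid N] (g : M →* N)
    (hg : Function.Surjective g) {k : ℕ} (h : IsExponent M k) : IsExponent N k := by
  refine ⟨h.1, fun y => ?_⟩
  obtain ⟨x, rfl⟩ := hg y
  rw [← map_pow]
  exact (h.2 x).map g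

theorem IsExponent.of_injective {M N : Type*} [Monoid M] [Monoid N] (g : N →* M)
    (hg : Function.Injective g) {k : ℕ} (h : IsExponent M k) : IsExponent N k := by
  refine ⟨h.1, fun y => hg ?_⟩
  rw [map_mul, map_pow]
  exact h.2 (g y)

theorem IsExponent.ev_word {M : Type*} [Monoid M] {N N' : ℕ} (h : IsExponent M N)
    (h' : IsExponent M N') (f : A → M) : ∀ α : PiTerm A, ev f (α.word N) = ev f (α.word N')
  | .eps => rfl
  | .letter _ => rfl
  | .concat α β => by simp [PiTerm.word, ev_word h h' f α, ev_word h h' f β]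
  | .pow γ => by simp [PiTerm.word, ev_wpow, ev_word h h' f γ, h.pow_eq h']

theorem holds_iff {M : Type*} [Monoid M] [Finite M] {N : ℕ} (h : IsExponent M N)
    {α β : PiTerm A} : Holds α β M ↔ ∀ f : A → M, ev f (α.word N) = ev f (β.word N) := by
  have h' := isExponent_exponent M
  constructor
  · intro hM f
    have := hM (FreeMonoid.lift f)
    simp only [PiTerm.map_subst, FreeMonoid.lift_eval_of] at this
    rwa [h.ev_word h', h.ev_word h']
  · intro hM σ
    rw [PiTerm.map_subst, PiTerm.map_subst, h'.ev_word h, h'.ev_word h, hM]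

theorem isVariety_holds (α β : PiTerm A) : IsVariety fun M _ => Finite M ∧ Holds α β M where
  finite M _ h := h.1
  submonoid M _ N h := by
    have := h.1
    have hM := isExponent_exponent M
    refine ⟨inferInstance, (holds_iff (hM.of_injective N.subtype N.subtype_injective)).2
      fun f => N.subtype_injective ?_⟩
    rw [← ev_map, ← ev_map]
    exact (holds_iff hM).1 h.2 _
  image M N _ _ g hg h := by
    have := h.1
    have hM := isExponent_exponent M
    have : Finite N := Finite.of_surjective g hg
    refine ⟨this, (holds_iff (hM.of_surjective g hg)).2 fun f => ?_⟩
    choose f' hf' using fun a => hg (f a)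
    obtain rfl : (fun a => g (f' a)) = f := funext hf'
    rw [ev_map, ev_map, (holds_iff hM).1 h.2]
  prod ι _ M _ h := by
    have := fun i => (h i).1
    have hM := isExponent_exponent (∀ i, M i)
    refine ⟨inferInstance, (holds_iff hM).2 fun f => funext fun i => ?_⟩
    have := (holds_iff (hM.of_surjective (Pi.evalMonoidHom M i)
      (Function.surjective_eval i))).1 (h i).2 (fun a => Pi.evalMonoidHom M i (f a))
    rwa [ev_map, ev_map] at this

/-- The finite monoids satisfying a given equation form a variety; if it contains both classes, it
contains their join. -/
theorem holdsIn_join {V W : MonoidClass} (hV : ∀ (M : Type) [Monoid M], V M → Finite M)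
    (hW : ∀ (M : Type) [Monoid M], W M → Finite M) (α β : PiTerm A) :
    HoldsIn (join V W) α β ↔ HoldsIn V α β ∧ HoldsIn W α β := by
  constructor
  · exact fun h => ⟨fun M _ hM => h M fun X _ hX _ => hX M hM,
      fun M _ hM => h M fun X _ _ hX => hX M hM⟩
  · rintro ⟨h1, h2⟩ M _ hM
    exact (hM _ (isVariety_holds α β) (fun N _ hN => ⟨hV N hN, h1 N hN⟩)
      (fun N _ hN => ⟨hW N hN, h2 N hN⟩)).2

end Terms

-- The states that describe the varieties

section Characterizations

/-- The equations that hold in the class `V` are described by agreement in the state `q`. -/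
structure Describes (q : State) (V : MonoidClass) : Prop where
  finite : ∀ (M : Type) [Monoid M], V M → Finite M
  sound : ∀ (B : Type u) [Finite B] (M : Type) [Monoid M], V M → ∀ f : B → M,
    ∃ n, ∀ u v, Agree n q u v → ev f u = ev f v
  complete : ∀ (B : Type u) [Finite B] (n : ℕ), ∃ (M : Type) (_ : Monoid M) (f : B → M), V M ∧
    ∀ u v, ev f u = ev f v → Agree n q u v

/-- A multiple of the exponent of `M` gives the same values and can be made larger than `n`, where
the game of `n` rounds no longer sees the exponent. Restricting to the letters of the two terms
makes the alphabet finite. -/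
theorem Describes.holdsIn_iff {A : Type u} {q : State} {V : MonoidClass}
    (h : Describes.{u} q V) (α β : PiTerm A) :
    HoldsIn V α β ↔ ∀ n, Agree n q (α.word (n + 1)) (β.word (n + 1)) := by
  classical
  let B := {a // a ∈ α.letters ++ β.letters}
  have hα : ∀ N, ∃ u : List B, u.map Subtype.val = α.word N := fun N =>
    ⟨(α.word N).attachWith _ fun c hc => List.mem_append_left _ (PiTerm.mem_letters hc),
      List.attachWith_map_subtype_val _⟩
  have hβ : ∀ N, ∃ u : List B, u.map Subtype.val = β.word N := fun N =>
    ⟨(β.word N).attachWith _ fun c hc => List.mem_append_right _ (PiTerm.mem_letters hc),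
      List.attachWith_map_subtype_val _⟩
  have hev : ∀ {M : Type} [Monoid M] (f : A → M) (u : List B),
      ev f (u.map Subtype.val) = ev (fun b : B => f b) u := by
    intro M _ f u
    rw [ev, ev, List.map_map]
    rfl
  constructor
  · intro hV n
    obtain ⟨M, _, f, hM, hf⟩ := h.complete B n
    have := h.finite M hM
    have hN := (isExponent_exponent M).mul n
    have hlt : n < exponent M * (n + 1) := by
      have := Nat.mul_le_mul_right (n + 1) (isExponent_exponent M).1
      omega
    obtain ⟨u, hu⟩ := hα (exponent M * (n + 1))
    obtain ⟨v, hv⟩ := hβ (exponent M * (n + 1))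
    have := (holds_iff hN).1 (hV M hM) (fun a => if ha : a ∈ α.letters ++ β.letters then f ⟨a, ha⟩
      else 1)
    rw [← hu, ← hv, hev, hev, show (fun b : B => if ha : b.1 ∈ α.letters ++ β.letters then f ⟨b, ha⟩
      else 1) = f from funext fun b => dif_pos b.2] at this
    have := (agree_map_iff Subtype.val_injective).2 (hf u v this)
    rw [hu, hv] at this
    exact (((PiTerm.agree_word n.lt_succ_self hlt α).of_top q).trans this).trans
      ((PiTerm.agree_word hlt n.lt_succ_self β).of_top q)
  · intro hag M _ hM
    have := h.finite M hM
    refine (holds_iff (isExponent_exponent M)).2 fun f => ?_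
    obtain ⟨n, hn⟩ := h.sound B M hM (fun b => f b)
    have hN := (isExponent_exponent M).mul n
    have hlt : n < exponent M * (n + 1) := by
      have := Nat.mul_le_mul_right (n + 1) (isExponent_exponent M).1
      omega
    obtain ⟨u, hu⟩ := hα (exponent M * (n + 1))
    obtain ⟨v, hv⟩ := hβ (exponent M * (n + 1))
    rw [(isExponent_exponent M).ev_word hN, (isExponent_exponent M).ev_word hN, ← hu, ← hv, hev,
      hev]
    refine hn u v ((agree_map_iff Subtype.val_injective).1 ?_)
    rw [hu, hv]
    exact (((PiTerm.agree_word hlt n.lt_succ_self α).of_top q).trans (hag n)).trans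
      ((PiTerm.agree_word n.lt_succ_self hlt β).of_top q)

theorem describes_varR (m : ℕ) : Describes.{u} (.x, some (m + 1)) (varR (m + 1)) where
  finite M _ h := ((finite_daProp_of_corner _).1 M h).1
  sound B _ M _ h f := (corner_sound m).1 M h f
  complete B _ n := by
    have := finite_conAgree (A := B) n (.x, some (m + 1))
    obtain ⟨M, _, _, f, hf, hM⟩ := exists_quotient (conAgree B n (.x, some (m + 1)))
    exact ⟨M, _, f, (corner_complete n m).1 M f hf fun u v h => (hM u v).2 h,
      fun u v h => (hM u v).1 h⟩

theorem describes_varL (m : ℕ) : Describes.{u} (.y, some (m + 1)) (varL (m + 1)) where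
  finite M _ h := ((finite_daProp_of_corner _).2 M h).1
  sound B _ M _ h f := (corner_sound m).2 M h f
  complete B _ n := by
    have := finite_conAgree (A := B) n (.y, some (m + 1))
    obtain ⟨M, _, _, f, hf, hM⟩ := exists_quotient (conAgree B n (.y, some (m + 1)))
    exact ⟨M, _, f, (corner_complete n m).2 M f hf fun u v h => (hM u v).2 h,
      fun u v h => (hM u v).1 h⟩

/-- Completeness comes from the corners, which lie in `DA`: a game of `n` rounds turns at most `n`
times, so level `n + 1` is as good as no restriction. -/
theorem describes_varDA : Describes.{u} (.x, none) varDA where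
  finite M _ h := h.1
  sound B _ M _ h f := by
    classical
    have := h.1
    have := Fintype.ofFinite B
    obtain ⟨n, hn⟩ := (daProp_of_varDA h).eq_of_agree_top f (Fintype.card B)
    exact ⟨n, fun u v huv => hn Finset.univ le_rfl u v (by simp) huv⟩
  complete B _ n := by
    obtain ⟨M, _, f, hM, hf⟩ := (describes_varR n).complete B n
    obtain ⟨_, hDA⟩ := (finite_daProp_of_corner _).1 M hM
    exact ⟨M, _, f, varDA_of_daProp hDA,
      fun u v h => (hf u v h).unlimited (by simp) n.le_succ⟩

theorem describes_meet_one : Describes.{u} (.x, some 1) (meet (varR 1) (varL 1)) where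
  finite M _ h := ((finite_daProp_of_corner _).1 M h.1).1
  sound B _ M _ h f := (corner_sound 0).1 M h.1 f
  complete B _ n := by
    obtain ⟨M, _, f, hM, hf⟩ := (describes_varR 0).complete B n
    rw [varR] at hM
    exact ⟨M, _, f, by rw [meet, varR, varL]; exact ⟨hM, hM⟩, hf⟩

/-- A monoid in both corners respects every link of a chain, whence soundness by `exists_link`.
Conversely, agreement in mode `w` is coarser than long agreement in either of the other modes at the
next level, so its quotient lies in both corners. -/
theorem describes_meet (m : ℕ) :
    Describes.{u} (.w, some (m + 1)) (meet (varR (m + 2)) (varL (m + 2))) where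
  finite M _ h := ((finite_daProp_of_corner _).1 M h.1).1
  sound B _ M _ h f := by
    obtain ⟨n1, h1⟩ := (corner_sound (m + 1)).1 M h.1 f
    obtain ⟨n2, h2⟩ := (corner_sound (m + 1)).2 M h.2 f
    obtain ⟨n, hn⟩ := exists_link B m (max n1 n2)
    refine ⟨n, fun u v huv => ?_⟩
    have key : ∀ w : FreeMonoid B, Relation.ReflTransGen (fun u v : FreeMonoid B =>
        Agree (max n1 n2) (.x, some (m + 2)) u.toList v.toList ∨
        Agree (max n1 n2) (.y, some (m + 2)) u.toList v.toList) (FreeMonoid.ofList u) w →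
        ev f u = ev f w.toList := by
      intro w hw
      induction hw with
      | refl => rfl
      | tail _ hww ih =>
        rcases hww with h | h
        · exact ih.trans (h1 _ _ (h.mono (le_max_left _ _)))
        · exact ih.trans (h2 _ _ (h.mono (le_max_right _ _)))
    exact key _ (hn u v huv)
  complete B _ n := by
    have := finite_conAgree (A := B) n (.w, some (m + 1))
    obtain ⟨M, _, _, f, hf, hM⟩ := exists_quotient (conAgree B n (.w, some (m + 1)))
    obtain ⟨N1, h1⟩ := exists_agree_w B (m + 1) n
    obtain ⟨N2, h2⟩ := exists_agree_w' B (m + 1) n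
    exact ⟨M, _, f, ⟨(corner_complete N1 (m + 1)).1 M f hf fun u v h => (hM u v).2 (h1 _ _ h),
      (corner_complete N2 (m + 1)).2 M f hf fun u v h => (hM u v).2 (h2 _ _ h)⟩,
      fun u v h => (hM u v).1 h⟩

end Characterizations

-- Factors of the words of a `π`-term, up to agreement

section Factors

variable {A : Type*}

theorem first_append {a : A} {p s x y : List A} (hp : a ∉ p) (h : x ++ y = p ++ a :: s) :
    (∃ x', x = p ++ a :: x' ∧ s = x' ++ y) ∨ (a ∉ x ∧ ∃ y', p = x ++ y' ∧ y = y' ++ a :: s) := by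
  by_cases hx : a ∈ x
  · obtain ⟨x1, x2, hx1, rfl⟩ := exists_first hx
    rw [List.append_assoc, List.cons_append] at h
    obtain ⟨rfl, rfl⟩ := first_unique hx1 hp h
    exact Or.inl ⟨_, rfl, rfl⟩
  · have hy : a ∈ y := by
      have : a ∈ x ++ y := by simp [h]
      simpa [hx] using this
    obtain ⟨y1, y2, hy1, rfl⟩ := exists_first hy
    rw [← List.append_assoc] at h
    obtain ⟨rfl, rfl⟩ := first_unique (by simp [hx, hy1]) hp h
    exact Or.inr ⟨hx, _, rfl, rfl⟩

theorem wpow_reverse (N : ℕ) (u : List A) : (wpow N u).reverse = wpow N u.reverse := by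
  induction N with
  | zero => rfl
  | succ N ih => rw [wpow_succ, wpow_succ', List.reverse_append, ih]

/-- A finite set of factors of the word `α.word N`. Up to agreement, it is closed under cuts, and
its size does not depend on `N`. -/
def PiTerm.factors [DecidableEq A] (N : ℕ) : PiTerm A → Finset (List A)
  | .eps => {[]}
  | .letter a => {[], [a]}
  | .concat α β => Finset.image₂ (· ++ ·) (α.factors N) (β.factors N)
  | .pow γ => Finset.image₂ (· ++ ·) (γ.factors N) (γ.factors N) ∪
      Finset.image₂ (fun x y => x ++ (wpow N (γ.word N) ++ y)) (γ.factors N) (γ.factors N)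

def PiTerm.reverse : PiTerm A → PiTerm A
  | .eps => .eps
  | .letter a => .letter a
  | .concat α β => .concat β.reverse α.reverse
  | .pow γ => .pow γ.reverse

theorem PiTerm.word_reverse (N : ℕ) : ∀ α : PiTerm A, α.reverse.word N = (α.word N).reverse
  | .eps => rfl
  | .letter _ => rfl
  | .concat α β => by simp [reverse, word, word_reverse N α, word_reverse N β]
  | .pow γ => by simp [reverse, word, word_reverse N γ, wpow_reverse]

theorem PiTerm.reverse_reverse : ∀ α : PiTerm A, α.reverse.reverse = α
  | .eps => rfl
  | .letter _ => rfl
  | .concat α β => by simp [reverse, reverse_reverse α, reverse_reverse β]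
  | .pow γ => by simp [reverse, reverse_reverse γ]

variable [DecidableEq A]

theorem PiTerm.mem_factors_reverse (N : ℕ) : ∀ (α : PiTerm A) (u : List A),
    u ∈ α.factors N → u.reverse ∈ α.reverse.factors N
  | .eps, u, h => by simpa [factors, reverse] using h
  | .letter a, u, h => by
    simp only [factors, reverse, Finset.mem_insert, Finset.mem_singleton] at h ⊢
    rcases h with rfl | rfl <;> simp
  | .concat α β, u, h => by
    obtain ⟨x, hx, y, hy, rfl⟩ := Finset.mem_image₂.1 h
    exact Finset.mem_image₂.2 ⟨_, mem_factors_reverse N β y hy, _, mem_factors_reverse N α x hx,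
      by simp⟩
  | .pow γ, u, h => by
    rcases Finset.mem_union.1 h with h | h
    all_goals obtain ⟨x, hx, y, hy, rfl⟩ := Finset.mem_image₂.1 h
    · exact Finset.mem_union_left _ (Finset.mem_image₂.2 ⟨_, mem_factors_reverse N γ y hy, _,
        mem_factors_reverse N γ x hx, by simp⟩)
    · exact Finset.mem_union_right _ (Finset.mem_image₂.2 ⟨_, mem_factors_reverse N γ y hy, _,
        mem_factors_reverse N γ x hx, by simp [wpow_reverse, word_reverse]⟩)

theorem PiTerm.nil_mem_factors (N : ℕ) : ∀ α : PiTerm A, [] ∈ α.factors N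
  | .eps => by simp [factors]
  | .letter a => by simp [factors]
  | .concat α β => Finset.mem_image₂.2 ⟨_, nil_mem_factors N α, _, nil_mem_factors N β, rfl⟩
  | .pow γ => Finset.mem_union_left _
      (Finset.mem_image₂.2 ⟨_, nil_mem_factors N γ, _, nil_mem_factors N γ, rfl⟩)

theorem PiTerm.word_mem_factors (N : ℕ) : ∀ α : PiTerm A, α.word N ∈ α.factors N
  | .eps => by simp [factors, word]
  | .letter a => by simp [factors, word]
  | .concat α β => Finset.mem_image₂.2 ⟨_, word_mem_factors N α, _, word_mem_factors N β, rfl⟩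
  | .pow γ => Finset.mem_union_right _
      (Finset.mem_image₂.2 ⟨_, nil_mem_factors N γ, _, nil_mem_factors N γ, by simp [word]⟩)

theorem PiTerm.mem_word_of_factors {N : ℕ} (hN : N ≠ 0) {c : A} : ∀ {α : PiTerm A} {u : List A},
    u ∈ α.factors N → c ∈ u → c ∈ α.word N
  | .eps, u, h, hc => by
    obtain rfl := Finset.mem_singleton.1 h
    exact hc
  | .letter a, u, h, hc => by
    simp only [factors, Finset.mem_insert, Finset.mem_singleton] at h
    rcases h with rfl | rfl
    · simp at hc
    · exact hc
  | .concat α β, u, h, hc => by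
    obtain ⟨x, hx, y, hy, rfl⟩ := Finset.mem_image₂.1 h
    rcases List.mem_append.1 hc with hc | hc
    · exact List.mem_append_left _ (mem_word_of_factors hN hx hc)
    · exact List.mem_append_right _ (mem_word_of_factors hN hy hc)
  | .pow γ, u, h, hc => by
    refine mem_wpow.2 ⟨hN, ?_⟩
    rcases Finset.mem_union.1 h with h | h
    all_goals obtain ⟨x, hx, y, hy, rfl⟩ := Finset.mem_image₂.1 h
    · rcases List.mem_append.1 hc with hc | hc
      · exact mem_word_of_factors hN hx hc
      · exact mem_word_of_factors hN hy hc
    · rcases List.mem_append.1 hc with hc | hc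
      · exact mem_word_of_factors hN hx hc
      · rcases List.mem_append.1 hc with hc | hc
        · exact (mem_wpow.1 hc).2
        · exact mem_word_of_factors hN hy hc

/-- Inside a power, cuts would create all intermediate exponents; as these are large, they are
replaced by `N`, and only the exponents `0` and `N` are needed. -/
theorem PiTerm.factors_first {n N : ℕ} (hN : n + 1 < N) {a : A} : ∀ {α : PiTerm A}
    {p s : List A}, a ∉ p → p ++ a :: s ∈ α.factors N →
      (∃ p' ∈ α.factors N, Agree n (.w, none) p p') ∧
      (∃ s' ∈ α.factors N, Agree n (.w, none) s s')
  | .eps, p, s, _, hu => by simp [factors] at hu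
  | .letter c, p, s, _, hu => by
    have : p = [] ∧ a = c ∧ s = [] := by
      simpa [factors, List.append_eq_singleton_iff] using hu
    obtain ⟨rfl, -, rfl⟩ := this
    have := nil_mem_factors N (.letter c)
    exact ⟨⟨_, this, Agree.refl _ _ _⟩, ⟨_, this, Agree.refl _ _ _⟩⟩
  | .concat α β, p, s, hp, hu => by
    obtain ⟨x, hx, y, hy, e⟩ := Finset.mem_image₂.1 hu
    rcases first_append hp e with ⟨x', rfl, rfl⟩ | ⟨-, y', rfl, rfl⟩
    · obtain ⟨⟨p', hp', h1⟩, ⟨s', hs', h2⟩⟩ := factors_first hN hp hx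
      exact ⟨⟨p' ++ [], Finset.mem_image₂.2 ⟨_, hp', _, nil_mem_factors N β, rfl⟩, by simpa using h1⟩,
        ⟨_, Finset.mem_image₂.2 ⟨_, hs', _, hy, rfl⟩, h2.append_right _⟩⟩
    · obtain ⟨⟨p', hp', h1⟩, ⟨s', hs', h2⟩⟩ := factors_first hN (fun h => hp (by simp [h])) hy
      exact ⟨⟨_, Finset.mem_image₂.2 ⟨_, hx, _, hp', rfl⟩, h1.append_left _⟩,
        ⟨[] ++ s', Finset.mem_image₂.2 ⟨_, nil_mem_factors N α, _, hs', rfl⟩, h2⟩⟩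
  | .pow γ, p, s, hp, hu => by
    have nil := nil_mem_factors N γ
    have hl : ∀ {x y}, x ∈ γ.factors N → y ∈ γ.factors N → x ++ y ∈ (PiTerm.pow γ).factors N :=
      fun hx hy => Finset.mem_union_left _ (Finset.mem_image₂.2 ⟨_, hx, _, hy, rfl⟩)
    have hr : ∀ {x y}, x ∈ γ.factors N → y ∈ γ.factors N →
        x ++ (wpow N (γ.word N) ++ y) ∈ (PiTerm.pow γ).factors N :=
      fun hx hy => Finset.mem_union_right _ (Finset.mem_image₂.2 ⟨_, hx, _, hy, rfl⟩)
    rcases Finset.mem_union.1 hu with hu | hu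
    all_goals obtain ⟨x, hx, y, hy, e⟩ := Finset.mem_image₂.1 hu
    all_goals rcases first_append hp e with ⟨x', rfl, rfl⟩ | ⟨hax, y', rfl, e'⟩
    · obtain ⟨⟨p', hp', h1⟩, ⟨s', hs', h2⟩⟩ := factors_first hN hp hx
      exact ⟨⟨_, hl hp' nil, by simpa using h1⟩, ⟨_, hl hs' hy, h2.append_right _⟩⟩
    · subst e'
      obtain ⟨⟨p', hp', h1⟩, ⟨s', hs', h2⟩⟩ := factors_first hN (fun h => hp (by simp [h])) hy
      exact ⟨⟨_, hl hx hp', h1.append_left _⟩, ⟨_, hl nil hs', h2⟩⟩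
    · obtain ⟨⟨p', hp', h1⟩, ⟨s', hs', h2⟩⟩ := factors_first hN hp hx
      exact ⟨⟨_, hl hp' nil, by simpa using h1⟩, ⟨_, hr hs' hy, h2.append_right _⟩⟩
    -- The first `a` lies in the first copy of `γ`, even if it was known to occur only in `y`. The
    -- lost copy is restored up to agreement.
    · obtain ⟨N', rfl⟩ : ∃ N', N = N' + 1 := ⟨N - 1, by omega⟩
      set g := γ.word (N' + 1) with hg
      have hag : a ∈ g := by
        have : a ∈ wpow (N' + 1) g ++ y := by simp [e']
        rcases List.mem_append.1 this with h | h
        · exact (mem_wpow.1 h).2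
        · exact mem_word_of_factors (by omega) hy h
      obtain ⟨g1, g2, hg1, hg'⟩ := exists_first hag
      have e2 : y' ++ a :: s = g1 ++ a :: (g2 ++ (wpow N' g ++ y)) := by
        rw [← e', wpow_succ]
        conv_lhs => rw [show g ++ wpow N' g = (g1 ++ a :: g2) ++ wpow N' g by rw [← hg']]
        simp
      have hay' : a ∉ y' := fun h => hp (by simp [h])
      obtain ⟨rfl, rfl⟩ := first_unique hay' hg1 e2
      obtain ⟨⟨p', hp', h1⟩, ⟨s', hs', h2⟩⟩ := factors_first (α := γ) hN hg1
        (by rw [← hg', hg]; exact word_mem_factors _ _)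
      exact ⟨⟨_, hl hx hp', h1.append_left _⟩, ⟨_, hr hs' hy, h2.append
        ((agree_wpow _ n _ _ (by omega) (by omega)).append_right _)⟩⟩

theorem PiTerm.factors_last {n N : ℕ} (hN : n + 1 < N) {a : A} {α : PiTerm A}
    {p s : List A} (hs : a ∉ s) (h : p ++ a :: s ∈ α.factors N) :
      (∃ p' ∈ α.factors N, Agree n (.w, none) p p') ∧
      (∃ s' ∈ α.factors N, Agree n (.w, none) s s') := by
  have key : ∀ {u v : List A}, v ∈ α.reverse.factors N → Agree n (.w, none) u.reverse v →
      ∃ v' ∈ α.factors N, Agree n (.w, none) u v' := by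
    intro u v hv huv
    refine ⟨v.reverse, ?_, ?_⟩
    · rw [← reverse_reverse α]
      exact mem_factors_reverse N _ _ hv
    · have := huv.reverse
      rwa [List.reverse_reverse] at this
  obtain ⟨⟨s', hs', h1⟩, ⟨p', hp', h2⟩⟩ := factors_first (α := α.reverse) (a := a)
    (p := s.reverse) (s := p.reverse) hN (by simpa using hs)
    (by simpa using mem_factors_reverse N _ _ h)
  exact ⟨key hp' h2, key hs' h1⟩

/-- The centre is obtained by a first-occurrence cut followed by a last-occurrence cut. The first
one is correct only up to agreement, so a further round is needed to carry out the second. -/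
theorem PiTerm.factors_cut {n N : ℕ} (hN : n + 2 < N) {α : PiTerm A} {k : Op} {a b : A}
    {u s : List A} (hu : u ∈ α.factors N) (h : Cut k a b u s) :
    ∃ s' ∈ α.factors N, Agree n (.w, none) s s' := by
  have hN' : n + 1 < N := by omega
  cases k
  case xr =>
    obtain ⟨p, hp, rfl⟩ := h
    exact (factors_first hN' hp hu).2
  case xl =>
    obtain ⟨p, hp, rfl⟩ := h
    exact (factors_first hN' hp hu).1
  case yl =>
    obtain ⟨p, hp, rfl⟩ := h
    exact (factors_last hN' hp hu).1
  case yr =>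
    obtain ⟨p, hp, rfl⟩ := h
    exact (factors_last hN' hp hu).2
  case ctr =>
    obtain ⟨p, r, hab, h1, h2, h3, h4, rfl⟩ := h
    obtain ⟨⟨q, hq, hpq⟩, -⟩ := factors_first (n := n + 1) (α := α) (a := a) (p := p ++ b :: s)
      (s := r) hN (by simp [h1, h2, hab]) (by simpa using hu)
    obtain ⟨p', s', hs', rfl, -, hss⟩ := hpq.w_last (by simp) h3 rfl
    obtain ⟨-, t, ht, hst⟩ := factors_last hN' hs' hq
    exact ⟨t, ht, hss.trans hst⟩
  case stay =>
    obtain rfl : s = u := h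
    exact ⟨s, hu, Agree.refl _ _ _⟩

theorem PiTerm.card_factors_le (N : ℕ) (α : PiTerm A) :
    (α.factors N).card ≤ 2 ^ 2 ^ α.toWord.length := by
  -- The stronger bound `e + 1 ≤ 2 ^ length` survives the induction: exponents add up under
  -- concatenation, and a power turns `e` into `2 * e + 1`, which its two parentheses pay for.
  suffices h : ∃ e, (α.factors N).card ≤ 2 ^ e ∧ e + 1 ≤ 2 ^ α.toWord.length by
    obtain ⟨e, h1, h2⟩ := h
    exact h1.trans (Nat.pow_le_pow_right (by omega) (by omega))
  induction α with
  | eps => exact ⟨0, by simp [factors], by simp [toWord]⟩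
  | letter a => exact ⟨1, (Finset.card_le_two).trans (by simp), by simp [toWord]⟩
  | concat α β iα iβ =>
    obtain ⟨e, h1, h2⟩ := iα
    obtain ⟨e', h1', h2'⟩ := iβ
    refine ⟨e + e', (Finset.card_image₂_le _ _ _).trans ?_, ?_⟩
    · rw [pow_add]
      exact Nat.mul_le_mul h1 h1'
    · rw [toWord, List.length_append, pow_add]
      refine le_trans ?_ (Nat.mul_le_mul h2 h2')
      nlinarith
  | pow γ ih =>
    obtain ⟨e, h1, h2⟩ := ih
    refine ⟨2 * e + 1, (Finset.card_union_le _ _).trans ?_, ?_⟩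
    · have h3 := fun f : List A → List A → List A => (Finset.card_image₂_le f (γ.factors N) (γ.factors N)).trans
        (Nat.mul_le_mul h1 h1)
      refine (add_le_add (h3 _) (h3 _)).trans (le_of_eq ?_)
      rw [pow_succ, two_mul, pow_add]
      ring
    · have : (PiTerm.pow γ).toWord.length = γ.toWord.length + 2 := by simp [toWord]
      rw [this, pow_add]
      omega

end Factors

-- A bound for the number of rounds

section Bound

variable {A : Type*}

theorem exists_eq_succ_of_antitone {X : Type*} (T : ℕ → Finset X) (hT : ∀ n, T (n + 1) ⊆ T n)
    {C : ℕ} (hC : (T 0).card ≤ C) : ∃ i ≤ C, T i = T (i + 1) := by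
  by_contra! h
  have : ∀ i ≤ C + 1, (T i).card + i ≤ C := by
    intro i
    induction i with
    | zero => exact fun _ => hC
    | succ i ih =>
      intro hi
      have h1 := ih (by omega)
      have h2 := Finset.card_lt_card
        ((hT i).ssubset_of_ne (h i (by omega)).symm)
      omega
  have := this (C + 1) le_rfl
  omega

/-- The states that can be reached from the states of level `m` or of unlimited level. -/
def states (m : ℕ) : Finset State :=
  Finset.univ ×ˢ insert none ((Finset.range (m + 1)).image some)

theorem card_states_le (m : ℕ) : (states m).card ≤ 3 * (m + 2) := by
  rw [states, Finset.card_product]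
  refine Nat.mul_le_mul (le_of_eq rfl) ((Finset.card_insert_le _ _).trans ?_)
  have := (Finset.card_image_le (s := Finset.range (m + 1)) (f := (some : ℕ → Option ℕ)))
  rw [Finset.card_range] at this
  omega

theorem mem_states_of_step {m : ℕ} {q q' : State} {k : Op} (hq : q ∈ states m)
    (h : step q k = some q') : q' ∈ states m := by
  obtain ⟨d, l⟩ := q
  rw [step_ne (step_ne_of_eq h), Option.map_eq_some_iff] at h
  obtain ⟨⟨d', r⟩, -, rfl⟩ := h
  simp only [states, Finset.mem_product, Finset.mem_univ, true_and, Finset.mem_insert,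
    Finset.mem_image, Finset.mem_range] at hq ⊢
  cases r
  · rcases hq with rfl | ⟨i, hi, rfl⟩
    · exact Or.inl rfl
    · exact Or.inr ⟨i - 1, by omega, rfl⟩
  · simpa using hq

/-- The sets `T i` of triples (state, factor of `α`, factor of `β`) that agree for `i` rounds
decrease and have at most `K` elements, so two consecutive ones coincide. As cuts of factors are
again factors up to agreement, the sequence is constant from there on. -/
theorem agree_of_bound {m K : ℕ} {q : State} (hq : q ∈ states m) (α β : PiTerm A)
    (hK : 3 * (m + 2) * (2 ^ 2 ^ α.toWord.length * 2 ^ 2 ^ β.toWord.length) ≤ K)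
    (h : Agree K q (α.word (K + 1)) (β.word (K + 1))) (n : ℕ) :
    Agree n q (α.word (n + 1)) (β.word (n + 1)) := by
  classical
  suffices h : Agree n q (α.word (n + K + 3)) (β.word (n + K + 3)) from
    (((PiTerm.agree_word (by omega) (by omega) α).of_top q).trans h).trans
      ((PiTerm.agree_word (by omega) (by omega) β).of_top q)
  -- One exponent, large enough for all rounds considered; stationarity is accordingly needed, and
  -- proved, only up to round `n + K + 1`.
  set N := n + K + 3 with hN
  replace h : Agree K q (α.word N) (β.word N) :=
    (((PiTerm.agree_word (by omega) (by omega) α).of_top q).trans h).trans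
      ((PiTerm.agree_word (by omega) (by omega) β).of_top q)
  let T : ℕ → Finset (State × List A × List A) := fun i =>
    (states m ×ˢ α.factors N ×ˢ β.factors N).filter fun x => Agree i x.1 x.2.1 x.2.2
  have hT : ∀ i, T (i + 1) ⊆ T i := fun i x hx => by
    simp only [T, Finset.mem_filter] at hx ⊢
    exact ⟨hx.1, hx.2.of_succ⟩
  obtain ⟨i, hi, hTi⟩ := exists_eq_succ_of_antitone T hT (C := K) (by
    refine (Finset.card_filter_le _ _).trans (le_trans ?_ hK)
    rw [Finset.card_product, Finset.card_product]
    exact Nat.mul_le_mul (card_states_le m)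
      (Nat.mul_le_mul (α.card_factors_le N) (β.card_factors_le N)))
  have key : ∀ j, i + j ≤ n + K → T i ⊆ T (i + j + 1) := by
    intro j
    induction j with
    | zero => exact fun _ => hTi.subset
    | succ j ih =>
      intro hj
      have ih := ih (by omega)
      have hsub : T (i + j) ⊆ T (i + j + 1) := by
        exact subset_trans (antitone_nat_of_succ_le hT (Nat.le_add_right i j)) ih
      intro x hx
      obtain ⟨⟨hx1, hx2, hx3⟩, hx4⟩ : (x.1 ∈ states m ∧ x.2.1 ∈ α.factors N ∧
          x.2.2 ∈ β.factors N) ∧ Agree (i + j + 1) x.1 x.2.1 x.2.2 := by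
        simpa [T] using ih hx
      suffices Agree (i + (j + 1) + 1) x.1 x.2.1 x.2.2 by simp [T, hx1, hx2, hx3, this]
      have step : ∀ {s t : List A} {q' : State}, q' ∈ states m →
          (∃ s' ∈ α.factors N, Agree (i + j + 1) (.w, none) s s') →
          (∃ t' ∈ β.factors N, Agree (i + j + 1) (.w, none) t t') →
          Agree (i + j) q' s t → Agree (i + j + 1) q' s t := by
        rintro s t q' hq' ⟨s', hs', hss⟩ ⟨t', ht', htt⟩ hst
        have h1 : (q', s', t') ∈ T (i + j) := by
          simp only [T, Finset.mem_filter, Finset.mem_product]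
          exact ⟨⟨hq', hs', ht'⟩,
            ((hss.of_succ.of_top q').symm.trans hst).trans (htt.of_succ.of_top q')⟩
        have h2 := (Finset.mem_filter.1 (hsub h1)).2
        exact ((hss.of_top q').trans h2).trans (htt.of_top q').symm
      intro k a b q' hq'
      have hq'm := mem_states_of_step hx1 hq'
      refine ⟨fun s hs => ?_, fun t ht => ?_⟩
      · obtain ⟨t, ht, hst⟩ := (hx4 k a b q' hq').1 s hs
        exact ⟨t, ht, step hq'm (PiTerm.factors_cut (by omega) hx2 hs)
          (PiTerm.factors_cut (by omega) hx3 ht) hst⟩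
      · obtain ⟨s, hs, hst⟩ := (hx4 k a b q' hq').2 t ht
        exact ⟨s, hs, step hq'm (PiTerm.factors_cut (by omega) hx2 hs)
          (PiTerm.factors_cut (by omega) hx3 ht) hst⟩
  have h1 : (q, α.word N, β.word N) ∈ T i := by
    simp only [T, Finset.mem_filter, Finset.mem_product]
    exact ⟨⟨hq, α.word_mem_factors N, β.word_mem_factors N⟩, h.mono hi⟩
  exact (Finset.mem_filter.1 (key (n + K - i) (by omega) h1)).2.mono (by omega)

end Bound

-- The game as a computation

section Procedure

variable {A : Type*}

/-- A state and two words that have to be compared in this state. -/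
abbrev Conf (A : Type*) := State × List A × List A

def moves (l : List A) : List (Op × A × A) :=
  [Op.xr, .xl, .yl, .yr, .ctr, .stay].flatMap fun k => l.flatMap fun a => l.map fun b => (k, a, b)

theorem mem_moves {l : List A} {r : Op × A × A} : r ∈ moves l ↔ r.2.1 ∈ l ∧ r.2.2 ∈ l := by
  obtain ⟨k, a, b⟩ := r
  cases k <;> simp [moves]

variable [DecidableEq A]

/-- The words before and after the first occurrence of a letter. -/
def splitFirst (a : A) (u : List A) : Option (List A × List A) :=
  if u.idxOf a < u.length then some (u.take (u.idxOf a), u.drop (u.idxOf a + 1)) else none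

def splitLast (a : A) (u : List A) : Option (List A × List A) :=
  (splitFirst a u.reverse).map fun r => (r.2.reverse, r.1.reverse)

/-- The result of a cut. -/
def cutFun (k : Op) (a b : A) (u : List A) : Option (List A) :=
  if k = .xr then (splitFirst a u).map Prod.snd
  else if k = .xl then (splitFirst a u).map Prod.fst
  else if k = .yl then (splitLast a u).map Prod.fst
  else if k = .yr then (splitLast a u).map Prod.snd
  else if k = .ctr then (splitFirst a u).bind fun r =>
    if a = b ∨ r.2.idxOf b < r.2.length then none else (splitLast b r.1).map Prod.snd
  else some u

theorem splitFirst_eq_some {a : A} {u p s : List A} :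
    splitFirst a u = some (p, s) ↔ a ∉ p ∧ u = p ++ a :: s := by
  simp only [splitFirst, List.idxOf_lt_length_iff]
  by_cases ha : a ∈ u
  · obtain ⟨p', s', hp', rfl⟩ := exists_first ha
    have e : (p' ++ a :: s').idxOf a = p'.length := by
      rw [List.idxOf_append_of_notMem hp']
      simp
    rw [if_pos ha, e]
    simp only [List.take_left', Option.some.injEq, Prod.mk.injEq]
    rw [show (p' ++ a :: s').drop (p'.length + 1) = s' by simp]
    constructor
    · rintro ⟨rfl, rfl⟩
      exact ⟨hp', rfl⟩
    · rintro ⟨hp, e⟩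
      exact first_unique hp' hp e
  · rw [if_neg ha]
    refine ⟨fun h => by simp at h, ?_⟩
    rintro ⟨-, rfl⟩
    simp at ha

theorem splitLast_eq_some {a : A} {u p s : List A} :
    splitLast a u = some (p, s) ↔ a ∉ s ∧ u = p ++ a :: s := by
  rw [splitLast, Option.map_eq_some_iff]
  constructor
  · rintro ⟨⟨x, y⟩, h, e⟩
    obtain ⟨rfl, rfl⟩ := Prod.mk.inj e
    obtain ⟨h1, h2⟩ := splitFirst_eq_some.1 h
    exact ⟨by simpa using h1, by simpa using congrArg List.reverse h2⟩
  · rintro ⟨h, rfl⟩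
    exact ⟨(s.reverse, p.reverse), splitFirst_eq_some.2 ⟨by simpa using h, by simp⟩, by simp⟩

theorem cutFun_eq_some {k : Op} {a b : A} {u s : List A} :
    cutFun k a b u = some s ↔ Cut k a b u s := by
  cases k
  case ctr =>
    simp only [cutFun, Cut, reduceCtorEq, if_false, if_true, Option.bind_eq_some_iff,
      List.idxOf_lt_length_iff]
    constructor
    · rintro ⟨⟨x, r⟩, h1, h2⟩
      obtain ⟨h3, rfl⟩ := splitFirst_eq_some.1 h1
      by_cases h : a = b ∨ b ∈ r
      · simp [h] at h2
      · simp only [h, if_false, Option.map_eq_some_iff] at h2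
        obtain ⟨⟨p, t⟩, h4, rfl⟩ := h2
        obtain ⟨h5, rfl⟩ := splitLast_eq_some.1 h4
        simp only [List.mem_append, List.mem_cons, not_or] at h3 h
        exact ⟨p, r, h.1, h3.1, h3.2.2, h5, h.2, by simp⟩
    · rintro ⟨p, r, hab, h1, h2, h3, h4, rfl⟩
      refine ⟨(p ++ b :: s, r), splitFirst_eq_some.2 ⟨by simp [h1, h2, hab], by simp⟩, ?_⟩
      simp only [hab, h4, or_self, if_false, Option.map_eq_some_iff]
      exact ⟨(p, s), splitLast_eq_some.2 ⟨h3, rfl⟩, rfl⟩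
  case stay => simp [cutFun, Cut, eq_comm]
  all_goals
    simp only [cutFun, Cut, reduceCtorEq, if_false, if_true, Option.map_eq_some_iff,
      Prod.exists, splitFirst_eq_some, splitLast_eq_some]
    constructor
    · rintro ⟨x, y, h, rfl⟩
      exact ⟨_, h⟩
    · rintro ⟨x, h⟩
      exact ⟨_, _, h, rfl⟩

/-- The comparisons that are left after a cut; `none` stands for a failed comparison. -/
def move (c : Conf A) (r : Op × A × A) : List (Option (Conf A)) :=
  (step c.1 r.1).elim [] fun q =>
    if cutFun r.1 r.2.1 r.2.2 c.2.1 = none ∧ cutFun r.1 r.2.1 r.2.2 c.2.2 = none then [] else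
      [(cutFun r.1 r.2.1 r.2.2 c.2.1).bind fun s =>
        (cutFun r.1 r.2.1 r.2.2 c.2.2).map fun t => (q, s, t)]

def succs (o : Option (Conf A)) : List (Option (Conf A)) :=
  o.elim [none] fun c => (moves (c.2.1 ++ c.2.2)).flatMap (move c)

def explore (n : ℕ) (L : List (Option (Conf A))) : List (Option (Conf A)) :=
  (fun L => L.flatMap succs)^[n] L

/-- The comparison `o` succeeds. -/
def Succeed (n : ℕ) (o : Option (Conf A)) : Prop :=
  ∃ c, o = some c ∧ Agree n c.1 c.2.1 c.2.2

theorem succeed_move {n : ℕ} {c : Conf A} {k : Op} {a b : A} :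
    (∀ o ∈ move c (k, a, b), Succeed n o) ↔ ∀ q', step c.1 k = some q' →
      (∀ s, Cut k a b c.2.1 s → ∃ t, Cut k a b c.2.2 t ∧ Agree n q' s t) ∧
      (∀ t, Cut k a b c.2.2 t → ∃ s, Cut k a b c.2.1 s ∧ Agree n q' s t) := by
  obtain ⟨q, u, v⟩ := c
  simp only [move, ← cutFun_eq_some]
  rcases step q k with _ | ⟨d, l⟩
  · simp
  rcases cutFun k a b u with _ | s <;> rcases cutFun k a b v with _ | t <;> simp [Succeed]

theorem agree_succ_iff {n : ℕ} {q : State} {u v : List A} : Agree (n + 1) q u v ↔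
    ∀ r ∈ moves (u ++ v), ∀ o ∈ move (q, u, v) r, Succeed n o := by
  constructor
  · rintro h ⟨k, a, b⟩ -
    exact succeed_move.2 fun q' hq' => h k a b q' hq'
  · intro h
    have h' : ∀ k a b, a ∈ u ++ v → b ∈ u ++ v → ∀ q', step q k = some q' →
        (∀ s, Cut k a b u s → ∃ t, Cut k a b v t ∧ Agree n q' s t) ∧
        (∀ t, Cut k a b v t → ∃ s, Cut k a b u s ∧ Agree n q' s t) := fun k a b ha hb =>
      succeed_move.1 (h (k, a, b) (mem_moves.2 ⟨ha, hb⟩))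
    clear h
    intro k a b q' hq
    by_cases hk : k = .stay
    · subst hk
      rcases huv : u ++ v with _ | ⟨c, w⟩
      · obtain ⟨rfl, rfl⟩ := List.append_eq_nil_iff.1 huv
        exact Agree.refl (n + 1) q [] .stay a b q' hq
      · exact h' .stay c c (by simp [huv]) (by simp [huv]) q' hq
    · constructor
      · intro s hs
        obtain ⟨a', b', ha, hb, hab⟩ := hs.exists_letters hk
        obtain ⟨t, ht, hst⟩ := (h' k a' b' (by simp [ha]) (by simp [hb]) q' hq).1 s
          ((hab _ _).1 hs)
        exact ⟨t, (hab _ _).2 ht, hst⟩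
      · intro t ht
        obtain ⟨a', b', ha, hb, hab⟩ := ht.exists_letters hk
        obtain ⟨s, hs, hst⟩ := (h' k a' b' (by simp [ha]) (by simp [hb]) q' hq).2 t
          ((hab _ _).1 ht)
        exact ⟨s, (hab _ _).2 hs, hst⟩

theorem explore_ne_none : ∀ {n : ℕ} {L : List (Option (Conf A))},
    (∀ o ∈ explore n L, o ≠ none) ↔ ∀ o ∈ L, Succeed n o
  | 0, L => by
    refine forall₂_congr fun o _ => ?_
    rw [Option.ne_none_iff_exists']
    exact ⟨fun ⟨c, hc⟩ => ⟨c, hc, trivial⟩, fun ⟨c, hc, _⟩ => ⟨c, hc⟩⟩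
  | n + 1, L => by
    have : explore (n + 1) L = explore n (L.flatMap succs) := Function.iterate_succ_apply _ _ _
    rw [this, explore_ne_none]
    simp only [List.mem_flatMap, forall_exists_index, and_imp]
    rw [forall_comm]
    refine forall_congr' fun o => ?_
    rw [forall_comm]
    refine forall_congr' fun _ => ?_
    rcases o with _ | c
    · simp [succs, Succeed]
    · have := agree_succ_iff (n := n) (q := c.1) (u := c.2.1) (v := c.2.2)
      simp only [succs, Option.elim, List.mem_flatMap, forall_exists_index, and_imp]
      rw [forall_comm]
      simp only [Succeed, Option.some.injEq, exists_eq_left', this]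
      exact ⟨fun h r hr o ho => h r o hr ho, fun h r o hr ho => h r hr o ho⟩

end Procedure

-- Reading `π`-terms

section Parsing

variable {A : Type*}

/-- Reading a symbol: the stack holds the words that belong to the open parentheses. -/
def readSymb (N : ℕ) (o : Option (List (List A))) (c : Symb A) : Option (List (List A)) :=
  o.bind fun st => Sum.casesOn c (fun a => some ((st.headI ++ [a]) :: st.tail)) fun b =>
    bif b then
      if st.length < 2 then none
      else some ((st.tail.headI ++ wpow N st.headI) :: st.tail.tail)
    else some ([] :: st)

/-- The word that results from a `π`-term by substituting `N` for the formal exponents, computed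
from the symbols of the term. -/
def parse (N : ℕ) (l : List (Symb A)) : Option (List A) :=
  (l.foldl (readSymb N) (some [[]])).bind fun st =>
    if st.length = 1 then some st.headI else none

theorem foldl_readSymb (N : ℕ) : ∀ (α : PiTerm A) (w : List A) (st : List (List A)),
    α.toWord.foldl (readSymb N) (some (w :: st)) = some ((w ++ α.word N) :: st)
  | .eps, w, st => by simp [PiTerm.toWord, PiTerm.word]
  | .letter a, w, st => by simp [PiTerm.toWord, PiTerm.word, readSymb]
  | .concat α β, w, st => by
    simp [PiTerm.toWord, PiTerm.word, foldl_readSymb N α, foldl_readSymb N β]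
  | .pow γ, w, st => by
    have h : readSymb N (some (w :: st)) (Sum.inr false) = some ([] :: w :: st) := rfl
    simp only [PiTerm.toWord, List.foldl_append, List.foldl_cons, List.foldl_nil]
    rw [h, foldl_readSymb N γ]
    simp [PiTerm.word, readSymb]

/-- The words in the stack belong to `π`-terms. -/
inductive Parsed (N : ℕ) : List (Symb A) → List (List A) → Prop
  | base (α : PiTerm A) : Parsed N α.toWord [α.word N]
  | push (α : PiTerm A) {l : List (Symb A)} {st : List (List A)} : Parsed N l st →
      Parsed N (l ++ Sum.inr false :: α.toWord) (α.word N :: st)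

theorem Parsed.letter {N : ℕ} {l : List (Symb A)} {st : List (List A)} (h : Parsed N l st) (a : A) :
    Parsed N (l ++ [Sum.inl a]) ((st.headI ++ [a]) :: st.tail) := by
  cases h with
  | base α => exact .base (.concat α (.letter a))
  | push α h => simpa [PiTerm.toWord, PiTerm.word] using Parsed.push (.concat α (.letter a)) h

theorem Parsed.close {N : ℕ} {l : List (Symb A)} {st : List (List A)} (h : Parsed N l st)
    (hst : ¬ st.length < 2) :
    Parsed N (l ++ [Sum.inr true]) ((st.tail.headI ++ wpow N st.headI) :: st.tail.tail) := by
  cases h with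
  | base α => simp at hst
  | push α h =>
    cases h with
    | base β => simpa [PiTerm.toWord, PiTerm.word] using Parsed.base (.concat β (.pow α))
    | push β h => simpa [PiTerm.toWord, PiTerm.word] using Parsed.push (.concat β (.pow α)) h

theorem parsed_of_foldl {N : ℕ} {l : List (Symb A)} {st : List (List A)}
    (h : l.foldl (readSymb N) (some [[]]) = some st) : Parsed N l st := by
  induction l using List.reverseRecOn generalizing st with
  | nil =>
    obtain rfl := Option.some.inj h
    exact .base .eps
  | append_singleton l c ih =>
    rw [List.foldl_append, List.foldl_cons, List.foldl_nil, readSymb, Option.bind_eq_some_iff] at h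
    obtain ⟨st', h1, h2⟩ := h
    have ih := ih h1
    rcases c with a | b | b
    · obtain rfl := Option.some.inj h2
      exact ih.letter a
    · obtain rfl := Option.some.inj h2
      exact .push .eps ih
    · simp only [cond_true] at h2
      split_ifs at h2 with hst
      obtain rfl := Option.some.inj h2
      exact ih.close hst

/-- A word of symbols does not determine the term, since concatenations may be bracketed differently
and empty words inserted, but it does determine the substituted word. So nothing has to be chosen
when parsing. -/
theorem parse_eq_some {N : ℕ} {l : List (Symb A)} {u : List A} :
    parse N l = some u ↔ ∃ α : PiTerm A, α.toWord = l ∧ α.word N = u := by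
  constructor
  · intro h
    obtain ⟨st, h1, h2⟩ := Option.bind_eq_some_iff.1 h
    split_ifs at h2 with hst
    obtain rfl := Option.some.inj h2
    have hp := parsed_of_foldl h1
    clear h h1
    cases hp with
    | base α => exact ⟨α, rfl, rfl⟩
    | push α h =>
      cases h <;> simp at hst
  · rintro ⟨α, rfl, rfl⟩
    rw [parse, foldl_readSymb]
    simp

end Parsing

-- Correctness of the decision procedure

section Decision

variable {A : Type*} [DecidableEq A]

/-- A number of cuts that suffices for the comparison of two `π`-terms. -/
def bound (m : ℕ) (p : List (Symb A) × List (Symb A)) : ℕ :=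
  3 * (m + 2) * (2 ^ 2 ^ p.1.length * 2 ^ 2 ^ p.2.length)

/-- The comparison of two words of symbols in the states from the list `I`. -/
def decideAgree (I : List State) (m : ℕ) (p : List (Symb A) × List (Symb A)) :
    Option (List (Option (Conf A))) :=
  (parse (bound m p + 1) p.1).bind fun u => (parse (bound m p + 1) p.2).map fun v =>
    explore (bound m p) (I.map fun q => some (q, u, v))

theorem mem_wordProblem_iff {V : MonoidClass} {I : List State} {m : ℕ}
    (hI : ∀ q ∈ I, q ∈ states m) (hV : ∀ α β : PiTerm A, HoldsIn V α β ↔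
      ∀ q ∈ I, ∀ n, Agree n q (α.word (n + 1)) (β.word (n + 1)))
    (p : List (Symb A) × List (Symb A)) : p ∈ WordProblem A V ↔
      ∃ L, decideAgree I m p = some L ∧ ∀ o ∈ L, o ≠ none := by
  obtain ⟨l, l'⟩ := p
  have key : ∀ (N n : ℕ) (α β : PiTerm A), (∀ o ∈ explore n (I.map fun q => some (q, α.word N,
      β.word N)), o ≠ none) ↔ ∀ q ∈ I, Agree n q (α.word N) (β.word N) := by
    intro N n α β
    rw [explore_ne_none, List.forall_mem_map]
    refine forall₂_congr fun q _ => ⟨?_, fun h => ⟨_, rfl, h⟩⟩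
    rintro ⟨c, hc, h⟩
    obtain rfl := Option.some.inj hc
    exact h
  simp only [decideAgree, Option.bind_eq_some_iff, Option.map_eq_some_iff, parse_eq_some]
  constructor
  · rintro ⟨α, β, rfl, rfl, h⟩
    exact ⟨_, ⟨_, ⟨α, rfl, rfl⟩, _, ⟨β, rfl, rfl⟩, rfl⟩,
      (key _ _ _ _).2 fun q hq => (hV α β).1 h q hq _⟩
  · rintro ⟨_, ⟨_, ⟨α, rfl, rfl⟩, _, ⟨β, rfl, rfl⟩, rfl⟩, h⟩
    exact ⟨α, β, rfl, rfl, (hV α β).2 fun q hq =>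
      agree_of_bound (hI q hq) α β le_rfl ((key _ _ _ _).1 h q hq)⟩

end Decision

-- Primitive recursiveness of the procedure

section Computability

open Primrec

noncomputable instance : Primcodable Mode :=
  Primcodable.ofEquiv (Fin (Nat.card Mode)) (Finite.equivFin Mode)

noncomputable instance : Primcodable Op :=
  Primcodable.ofEquiv (Fin (Nat.card Op)) (Finite.equivFin Op)

theorem primrec_step : Primrec₂ step := by
  refine Primrec.ite (Primrec.eq.comp (snd.comp fst) (const (some 0))) (const none)
    (option_map (f := fun p : State × Op => modeStep p.1.1 p.2)
      (g := fun p r => (r.1, if r.2 then p.1.2 else predLevel p.1.2))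
      ((dom_finite fun p : Mode × Op => modeStep p.1 p.2).comp ((fst.comp fst).pair snd)) ?_)
  refine Primrec.pair (fst.comp snd) (Primrec.ite (Primrec.eq.comp (snd.comp snd) (const true))
    (snd.comp (fst.comp fst)) ?_)
  exact (option_map₁ Primrec.pred).comp (snd.comp (fst.comp fst))

variable {A : Type*} [Primcodable A]

theorem primrec_wpow : Primrec₂ (wpow : ℕ → List A → List A) := by
  refine Primrec.of_eq (f := fun p : ℕ × List A => (List.range p.1).flatMap fun _ => p.2)
    (list_flatMap (list_range.comp fst) (snd.comp fst)) ?_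
  rintro ⟨N, u⟩
  induction N with
  | zero => rfl
  | succ N ih =>
    simp only [List.range_succ, List.flatMap_append] at ih ⊢
    rw [ih, wpow_succ']
    simp

theorem primrec_readSymb : Primrec fun p : ℕ × Option (List (List A)) × Symb A =>
    readSymb p.1 p.2.1 p.2.2 := by
  refine option_bind (fst.comp snd) ?_
  refine sumCasesOn (snd.comp (snd.comp fst)) ?_ ?_
  · refine option_some.comp (list_cons.comp (list_concat.comp (list_headI.comp (snd.comp fst)) snd)
      (list_tail.comp (snd.comp fst)))
  · refine Primrec.cond snd (Primrec.ite (Primrec.nat_lt.comp (list_length.comp (snd.comp fst))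
      (const 2)) (const none) (option_some.comp ?_))
      (option_some.comp (list_cons.comp (const []) (snd.comp fst)))
    exact list_cons.comp (list_append.comp (list_headI.comp (list_tail.comp (snd.comp fst)))
      (primrec_wpow.comp (fst.comp (fst.comp fst)) (list_headI.comp (snd.comp fst))))
      (list_tail.comp (list_tail.comp (snd.comp fst)))

theorem primrec_parse : Primrec₂ (parse : ℕ → List (Symb A) → Option (List A)) := by
  refine option_bind (list_foldl (h := fun p r => readSymb p.1 r.1 r.2) snd (const (some [[]])) ?_)
    ?_
  · exact primrec_readSymb.comp ((fst.comp fst).pair ((fst.comp snd).pair (snd.comp snd)))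
  · exact Primrec.ite (Primrec.eq.comp (list_length.comp snd) (const 1))
      (option_some.comp (list_headI.comp snd)) (const none)

theorem primrec_moves : Primrec (moves : List A → _) := by
  refine list_flatMap (const _) (list_flatMap fst ?_)
  exact list_map (fst.comp fst) ((snd.comp (fst.comp fst)).pair ((snd.comp fst).pair snd))

theorem primrec_bound (m : ℕ) : Primrec (bound m : List (Symb A) × List (Symb A) → ℕ) := by
  have hpow : Primrec₂ ((· ^ ·) : ℕ → ℕ → ℕ) := Primrec₂.unpaired'.1 Nat.Primrec.pow
  have h2 : ∀ {f : List (Symb A) × List (Symb A) → ℕ}, Primrec f → Primrec fun p => 2 ^ f p :=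
    fun hf => hpow.comp (const 2) hf
  exact nat_mul.comp (const _) (nat_mul.comp (h2 (h2 (list_length.comp fst)))
    (h2 (h2 (list_length.comp snd))))

variable [DecidableEq A]

theorem primrec_splitFirst : Primrec₂ (splitFirst : A → List A → _) := by
  have h : Primrec fun p : A × List A => p.2.idxOf p.1 := list_idxOf.comp fst snd
  exact Primrec.ite (Primrec.nat_lt.comp h (list_length.comp snd))
    (option_some.comp ((list_take.comp h snd).pair (list_drop.comp (Primrec.succ.comp h) snd)))
    (const none)

theorem primrec_splitLast : Primrec₂ (splitLast : A → List A → _) :=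
  option_map (primrec_splitFirst.comp fst (list_reverse.comp snd))
    ((list_reverse.comp (snd.comp snd)).pair (list_reverse.comp (fst.comp snd)))

theorem primrec_cutFun : Primrec fun p : (Op × A × A) × List A =>
    cutFun p.1.1 p.1.2.1 p.1.2.2 p.2 := by
  have hk : ∀ k : Op, PrimrecPred fun p : (Op × A × A) × List A => p.1.1 = k := fun k =>
    Primrec.eq.comp (fst.comp fst) (const k)
  have ha : Primrec fun p : (Op × A × A) × List A => p.1.2.1 := fst.comp (snd.comp fst)
  have hb : Primrec fun p : (Op × A × A) × List A => p.1.2.2 := snd.comp (snd.comp fst)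
  have hF := primrec_splitFirst.comp ha snd
  have hL := primrec_splitLast.comp ha snd
  refine Primrec.ite (hk _) (option_map hF (snd.comp snd)) <|
    Primrec.ite (hk _) (option_map hF (fst.comp snd)) <|
    Primrec.ite (hk _) (option_map hL (fst.comp snd)) <|
    Primrec.ite (hk _) (option_map hL (snd.comp snd)) <|
    Primrec.ite (hk _) (option_bind hF ?_) (option_some.comp snd)
  refine Primrec.ite (PrimrecPred.or (Primrec.eq.comp (ha.comp fst) (hb.comp fst))
    (Primrec.nat_lt.comp (list_idxOf.comp (hb.comp fst) (snd.comp snd))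
      (list_length.comp (snd.comp snd)))) (const none) ?_
  exact option_map (primrec_splitLast.comp (hb.comp fst) (fst.comp snd)) (snd.comp snd)

theorem primrec_move : Primrec₂ (move : Conf A → Op × A × A → _) := by
  have hu : Primrec fun p : Conf A × Op × A × A => cutFun p.2.1 p.2.2.1 p.2.2.2 p.1.2.1 :=
    primrec_cutFun.comp (snd.pair (fst.comp (snd.comp fst)))
  have hv : Primrec fun p : Conf A × Op × A × A => cutFun p.2.1 p.2.2.1 p.2.2.2 p.1.2.2 :=
    primrec_cutFun.comp (snd.pair (snd.comp (snd.comp fst)))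
  have hs : Primrec fun p : Conf A × Op × A × A => step p.1.1 p.2.1 :=
    primrec_step.comp (fst.comp fst) (fst.comp snd)
  have h1 : Primrec₂ fun (p : Conf A × Op × A × A) (q : State) =>
      (cutFun p.2.1 p.2.2.1 p.2.2.2 p.1.2.1).bind fun s =>
        (cutFun p.2.1 p.2.2.1 p.2.2.2 p.1.2.2).map fun t => (q, s, t) := by
    refine option_bind (hu.comp fst) ?_
    refine option_map (hv.comp (fst.comp fst)) ?_
    exact (snd.comp (fst.comp fst)).pair ((snd.comp fst).pair snd)
  have h2 : PrimrecPred fun p : (Conf A × Op × A × A) × State =>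
      cutFun p.1.2.1 p.1.2.2.1 p.1.2.2.2 p.1.1.2.1 = none ∧
        cutFun p.1.2.1 p.1.2.2.1 p.1.2.2.2 p.1.1.2.2 = none :=
    PrimrecPred.and (Primrec.eq.comp (hu.comp fst) (const none))
      (Primrec.eq.comp (hv.comp fst) (const none))
  have h3 : Primrec₂ fun (p : Conf A × Op × A × A) (q : State) =>
      if cutFun p.2.1 p.2.2.1 p.2.2.2 p.1.2.1 = none ∧ cutFun p.2.1 p.2.2.1 p.2.2.2 p.1.2.2 = none
      then [] else [(cutFun p.2.1 p.2.2.1 p.2.2.2 p.1.2.1).bind fun s =>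
        (cutFun p.2.1 p.2.2.1 p.2.2.2 p.1.2.2).map fun t => (q, s, t)] :=
    Primrec.ite h2 (const []) (list_cons.comp h1 (const []))
  refine Primrec.of_eq (option_casesOn hs (const []) h3) ?_
  rintro ⟨c, r⟩
  simp only [move]
  cases step c.1 r.1 <;> rfl

theorem primrec_succs : Primrec (succs : Option (Conf A) → _) := by
  refine Primrec.of_eq (option_casesOn Primrec.id (const [none]) (list_flatMap (primrec_moves.comp
    (list_append.comp (fst.comp (snd.comp snd)) (snd.comp (snd.comp snd))))
      (primrec_move.comp (snd.comp fst) snd).to₂).to₂) ?_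
  rintro (_ | c) <;> rfl

theorem primrec_explore : Primrec₂ (explore : ℕ → List (Option (Conf A)) → _) :=
  nat_iterate fst snd (list_flatMap snd (primrec_succs.comp snd))

theorem primrec_decideAgree (I : List State) (m : ℕ) :
    Primrec (decideAgree I m : List (Symb A) × List (Symb A) → _) := by
  have hN : Primrec fun p : List (Symb A) × List (Symb A) => bound m p + 1 :=
    Primrec.succ.comp (primrec_bound m)
  refine option_bind (primrec_parse.comp hN fst) (option_map
    (primrec_parse.comp (hN.comp fst) (snd.comp fst)) ?_)
  refine primrec_explore.comp ((primrec_bound m).comp (fst.comp fst)) (list_map (const I) ?_)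
  exact option_some.comp (snd.pair ((snd.comp (fst.comp fst)).pair (snd.comp fst)))

end Computability

-- Decidability of the word problems

section Corollary

open Primrec

variable {A : Type u} [Primcodable A]

/-- If the equations that hold in `V` are described by finitely many states, then the word problem
is decidable. -/
theorem wordProblemDecidable_of_states {V : MonoidClass} (I : List State) (m : ℕ)
    (hI : ∀ q ∈ I, q ∈ states m) (hV : ∀ α β : PiTerm A, HoldsIn V α β ↔
      ∀ q ∈ I, ∀ n, Agree n q (α.word (n + 1)) (β.word (n + 1))) : WordProblemDecidable A V := by
  classical
  have h : PrimrecPred fun L : List (Option (Conf A)) => ∀ o ∈ L, o ≠ none :=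
    PrimrecPred.forall_mem_list (PrimrecPred.not (Primrec.eq.comp Primrec.id (const none)))
  have h' : PrimrecPred fun p : List (Symb A) × List (Symb A) => p ∈ WordProblem A V := by
    refine Primrec.primrecPred (Primrec.of_eq (option_casesOn (primrec_decideAgree I m) (const false)
      (h.decide.comp snd).to₂) fun p => ?_)
    rw [Bool.eq_iff_iff, decide_eq_true_iff, mem_wordProblem_iff hI hV p]
    cases decideAgree I m p <;> simp
  exact ⟨h'.choose, h'.choose_spec.to_comp⟩

theorem Describes.wordProblemDecidable {V : MonoidClass} {q : State} (h : Describes.{u} q V) (m : ℕ)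
    (hq : q ∈ states m) : WordProblemDecidable A V :=
  wordProblemDecidable_of_states [q] m (by simpa using hq) fun α β => by
    simpa using h.holdsIn_iff α β

end Corollary

end TrotterWeil

theorem mainTheorem6 (A : Type*) [Primcodable A] :
    (∀ m : ℕ, 1 ≤ m →
      TrotterWeil.WordProblemDecidable A (TrotterWeil.varR m) ∧
      TrotterWeil.WordProblemDecidable A (TrotterWeil.varL m) ∧
      TrotterWeil.WordProblemDecidable A
        (TrotterWeil.join (TrotterWeil.varR m) (TrotterWeil.varL m)) ∧
      TrotterWeil.WordProblemDecidable A
        (TrotterWeil.meet (TrotterWeil.varR m) (TrotterWeil.varL m))) ∧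
    TrotterWeil.WordProblemDecidable A TrotterWeil.varDA := by
  open TrotterWeil in
  have hst : ∀ (d : Mode) (m : ℕ), (d, some m) ∈ states m := fun d m => by simp [states]
  refine ⟨fun m hm => ?_, describes_varDA.wordProblemDecidable 0 (by simp [states])⟩
  obtain ⟨m, rfl⟩ : ∃ k, m = k + 1 := ⟨m - 1, by omega⟩
  have hR := describes_varR m
  have hL := describes_varL m
  refine ⟨hR.wordProblemDecidable _ (hst _ _), hL.wordProblemDecidable _ (hst _ _), ?_, ?_⟩
  · refine wordProblemDecidable_of_states [(.x, some (m + 1)), (.y, some (m + 1))] (m + 1)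
      (by simp [hst]) fun α β => ?_
    rw [holdsIn_join hR.finite hL.finite, hR.holdsIn_iff, hL.holdsIn_iff]
    simp
  -- The intersection at `m + 1` corresponds to mode `w` at level `m`. At level zero the game is
  -- void, so the first intersection, which is `J`, is described by `(x, 1)` instead.
  · rcases m with _ | m
    · exact describes_meet_one.wordProblemDecidable _ (hst _ _)
    · exact (describes_meet m).wordProblemDecidable _ (hst _ _)
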